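/- Let $(a_k)_{k\ge 0}$ be i.i.d. real standard Gaussian random variables, and let $f(t)=\sum_{k=0}^\infty a_k t^k$, a power series which almost surely converges for all $t\in(-1,1)$. For $0<r<1$ let $N_r$ be the number of real zeros of $f$ in the interval $[-r,r]$, i.e. the number of points $t\in[-r,r]$ with $f(t)=0$. Then, for every $0<r<1$, $N_r$ is almost surely finite and has a finite second moment, $$\mathbb{E} N_r=\frac1\pi\log\frac{1+r}{1-r},$$ and $$\operatorname{Var} N_r = 2\Big(1-\frac{2}{\pi}\Big)\,\mathbb{E} N_r+O(1)\qquad\text{as } r\to 1^-.$$ -/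

import Mathlib

open Filter Topology Asymptotics MeasureTheory ProbabilityTheory

/-- The random power series `f(t) = ∑ₖ aₖ tᵏ` at a real point `t`, for the outcome `ω`. -/
noncomputable def randomSeries {Ω : Type*} (a : ℕ → Ω → ℝ) (ω : Ω) (t : ℝ) : ℝ :=
  ∑' k : ℕ, a k ω * t ^ k

/-- The set of real zeros of the random power series in the interval `[-r, r]`. -/
def realZeros {Ω : Type*} (a : ℕ → Ω → ℝ) (r : ℝ) (ω : Ω) : Set ℝ :=
  {t : ℝ | t ∈ Set.Icc (-r) r ∧ randomSeries a ω t = 0}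

/-- The number `N_r` of real zeros in `[-r, r]`, as a real-valued random variable. -/
noncomputable def realZeroCount {Ω : Type*} (a : ℕ → Ω → ℝ) (r : ℝ) (ω : Ω) : ℝ :=
  ((realZeros a r ω).ncard : ℝ)

/-! Put `t = tanh u`. The process `X_u = sech u * f (tanh u)` is centred Gaussian with covariance
`sech (u - v)`, hence stationary, and the zeros of `f` in `[-r, r]` correspond to the zeros of `X`
in an interval of length `L = 2 artanh r = log ((1 + r) / (1 - r))`.

The kernel has a special property (`sech_mul_add_tanh_mul`): conditioned on `X_v = 0`, the process
has the law of `tanh (u - v) * X_u`. So conditioning on two zeros changes the signs of `X` elsewhere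
only by deterministic factors. Differentiating a smoothed sign correlation in one of the times
(Gaussian integration by parts) produces two approximate delta functions, that is, conditioning on
two zeros. The derivative of the two-point correlation is thus explicit, and that of the four-point
correlation reduces to two-point ones. With `A = sechAngle`, where `A' = -sech` and `A 0 = π / 2`,
integration gives `E[sign X_u sign X_w] = (2 / π) A (w - u)` for `u ≤ w` (`integral_sign_two`) and a
Pfaffian for four points (`integral_sign_four`).

Now count sign changes of `X` on a grid of step `h = L / M`. Sign products of cells `m` steps apart
have covariance `(2 / π)² (A ((m + 1) h) A ((m - 1) h) - A (m h)²)`, which is approximately `(2 /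
π)² h² (A A'' - A'²)` at `m h`. Since `A A'' - A'²` is the second derivative of `A² / 2 - 2 log
cosh`, the double sum over cells telescopes up to a vanishing error (`tendsto_sum_gridCov`). The
limiting mean is `L / π` and the limiting variance is the explicit `limitVar L`; as `log cosh L = L
+ O(1)`, the latter is `2 (1 - 2 / π) L / π + O(1)` (`abs_limitVar_sub_le`).

Sign changes never outnumber zeros, and for fine grids they equal them, provided that no grid point
is a zero and that both signs occur near every zero. The second condition holds almost surely
(`ae_crossesAtZeros`): a zero where `f` keeps one sign would determine `a₀` from the other
coefficients, whereas `a₀` is independent of them and has no atoms. Fatou's lemma then gives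
finiteness and square integrability, and dominated convergence gives the two moments
(`zero_count_moments`). -/

/-! ### Identities for `sech` and `tanh`. -/

/-- The hyperbolic secant. -/
noncomputable def sech (x : ℝ) : ℝ := (Real.cosh x)⁻¹

theorem sech_zero : sech 0 = 1 := by simp [sech]

theorem sech_pos (x : ℝ) : 0 < sech x := inv_pos.2 (Real.cosh_pos x)

theorem sech_le_one (x : ℝ) : sech x ≤ 1 := inv_le_one_of_one_le₀ (Real.one_le_cosh x)

theorem sech_sq_add_tanh_sq (x : ℝ) : sech x ^ 2 + Real.tanh x ^ 2 = 1 := by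
  have := Real.cosh_sq x
  have h := (Real.cosh_pos x).ne'
  rw [sech, Real.tanh_eq_sinh_div_cosh]
  field_simp
  linarith

/-- Conditioning at the point `v` reproduces the kernel. -/
theorem sech_mul_add_tanh_mul (a b v : ℝ) :
    sech (a - v) * sech (b - v) + Real.tanh (a - v) * Real.tanh (b - v) * sech (a - b)
      = sech (a - b) := by
  have ha := (Real.cosh_pos (a - v)).ne'
  have hb := (Real.cosh_pos (b - v)).ne'
  have hab := (Real.cosh_pos (a - b)).ne'
  have key : Real.cosh (a - b) = Real.cosh (a - v) * Real.cosh (b - v)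
      - Real.sinh (a - v) * Real.sinh (b - v) := by
    rw [← Real.cosh_sub]; congr 1; ring
  rw [sech, sech, sech, Real.tanh_eq_sinh_div_cosh, Real.tanh_eq_sinh_div_cosh]
  field_simp
  linarith

theorem hasDerivAt_sech (x : ℝ) : HasDerivAt sech (-(sech x * Real.tanh x)) x := by
  have h := (Real.hasDerivAt_cosh x).inv (Real.cosh_pos x).ne'
  refine h.congr_deriv ?_
  rw [sech, Real.tanh_eq_sinh_div_cosh]
  have := (Real.cosh_pos x).ne'
  field_simp

theorem contDiff_sech : ContDiff ℝ 1 sech :=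
  Real.contDiff_cosh.inv fun x => (Real.cosh_pos x).ne'

theorem continuous_sech : Continuous sech := contDiff_sech.continuous

theorem contDiff_tanh_one : ContDiff ℝ 1 Real.tanh := by
  have : Real.tanh = fun x => Real.sinh x / Real.cosh x := by
    ext x; exact Real.tanh_eq_sinh_div_cosh x
  rw [this]
  exact Real.contDiff_sinh.div Real.contDiff_cosh fun x => (Real.cosh_pos x).ne'

/-! ### Finite-dimensional Gaussian vectors. -/

/-- A centred Gaussian vector with covariance matrix `C`, described by its characteristic
function. -/
structure GaussVec {Ω ι : Type*} [MeasurableSpace Ω] [Fintype ι] (P : Measure Ω)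
    (Y : Ω → ι → ℝ) (C : ι → ι → ℝ) : Prop where
  meas : Measurable Y
  charFun : ∀ θ : ι → ℝ, ∫ ω, Complex.exp ((∑ j, θ j * Y ω j : ℝ) * Complex.I) ∂P
    = Complex.exp (-((∑ i, ∑ j, θ i * θ j * C i j : ℝ) / 2 : ℝ))

namespace GaussVec

variable {Ω Ω' ι : Type*} [MeasurableSpace Ω] [MeasurableSpace Ω'] [Fintype ι]
  {P : Measure Ω} {P' : Measure Ω'} {Y : Ω → ι → ℝ} {Y' : Ω' → ι → ℝ} {C : ι → ι → ℝ}

theorem map_eq [IsFiniteMeasure P] [IsFiniteMeasure P'] (h : GaussVec P Y C)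
    (h' : GaussVec P' Y' C) : P.map Y = P'.map Y' := by
  classical
  refine Measure.ext_of_charFunDual ?_
  ext L
  obtain ⟨θ, key⟩ : ∃ θ : ι → ℝ, ∀ v : ι → ℝ, L v = ∑ j, θ j * v j := by
    refine ⟨fun j => L (Pi.single j 1), fun v => ?_⟩
    conv_lhs => rw [← Finset.univ_sum_single v, map_sum]
    refine Finset.sum_congr rfl fun j _ => ?_
    have : (Pi.single j (v j) : ι → ℝ) = v j • Pi.single j (1 : ℝ) := by
      rw [← Pi.single_smul]; simp
    rw [this, map_smul, smul_eq_mul, mul_comm]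
  have hm : Continuous fun v : ι → ℝ => Complex.exp ((L v : ℂ) * Complex.I) := by fun_prop
  rw [charFunDual_apply, charFunDual_apply, integral_map h.meas.aemeasurable
    hm.aestronglyMeasurable, integral_map h'.meas.aemeasurable hm.aestronglyMeasurable]
  simp_rw [key]
  rw [h.charFun, h'.charFun]

/-- Expectations may be computed in whichever realisation of the covariance is convenient: the given
process, a conditioned representation, or a finite-dimensional standard Gaussian space. -/
theorem integral_comp_eq [IsFiniteMeasure P] [IsFiniteMeasure P'] (h : GaussVec P Y C)
    (h' : GaussVec P' Y' C) {Φ : (ι → ℝ) → ℝ} (hΦ : Measurable Φ) :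
    ∫ ω, Φ (Y ω) ∂P = ∫ ω, Φ (Y' ω) ∂P' := by
  rw [← integral_map h.meas.aemeasurable hΦ.aestronglyMeasurable, h.map_eq h',
    integral_map h'.meas.aemeasurable hΦ.aestronglyMeasurable]

/-- An independent standard Gaussian contributes the rank-one part of the covariance. With `α =
sech` and `β = tanh` of the distance to a point, this is the conditioning at that point. -/
theorem prod [SFinite P] (h : GaussVec P Y C) (α β : ι → ℝ) :
    GaussVec ((gaussianReal 0 1).prod P) (fun p j => α j * p.1 + β j * Y p.2 j)
      (fun i j => α i * α j + β i * β j * C i j) where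
  meas := by
    have := h.meas
    refine measurable_pi_lambda _ fun j => ?_
    have h2 : Measurable fun p : ℝ × Ω => Y p.2 j := (measurable_pi_apply j).comp
      (this.comp measurable_snd)
    exact (measurable_fst.const_mul _).add (h2.const_mul _)
  charFun θ := by
    have hg : ∫ x, Complex.exp (((∑ j, θ j * α j : ℝ) * x : ℝ) * Complex.I) ∂(gaussianReal 0 1)
        = Complex.exp (-((∑ j, θ j * α j) ^ 2 / 2 : ℝ)) := by
      have := charFun_gaussianReal (μ := 0) (v := 1) (∑ j, θ j * α j)
      rw [charFun_apply_real] at this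
      push_cast at this ⊢
      rw [this]
      congr 1
      simp
    have e : ∀ p : ℝ × Ω, Complex.exp ((∑ j, θ j * (α j * p.1 + β j * Y p.2 j) : ℝ) * Complex.I)
        = Complex.exp (((∑ j, θ j * α j : ℝ) * p.1 : ℝ) * Complex.I)
          * Complex.exp ((∑ j, (θ j * β j) * Y p.2 j : ℝ) * Complex.I) := by
      intro p
      rw [← Complex.exp_add, ← add_mul, ← Complex.ofReal_add]
      congr 3
      rw [Finset.sum_mul, ← Finset.sum_add_distrib]
      exact Finset.sum_congr rfl fun j _ => by ring
    simp_rw [e]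
    rw [integral_prod_mul (fun x : ℝ => Complex.exp (((∑ j, θ j * α j : ℝ) * x : ℝ) * Complex.I))
      (fun ω => Complex.exp ((∑ j, (θ j * β j) * Y ω j : ℝ) * Complex.I)), hg, h.charFun,
      ← Complex.exp_add, ← Complex.ofReal_neg, ← Complex.ofReal_neg, ← Complex.ofReal_add,
      ← Complex.ofReal_neg]
    congr 2
    have : (∑ i, ∑ j, θ i * θ j * (α i * α j + β i * β j * C i j))
        = (∑ j, θ j * α j) ^ 2 + ∑ i, ∑ j, θ i * β i * (θ j * β j) * C i j := by
      rw [sq, Finset.sum_mul_sum, ← Finset.sum_add_distrib]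
      refine Finset.sum_congr rfl fun i _ => ?_
      rw [← Finset.sum_add_distrib]
      exact Finset.sum_congr rfl fun j _ => by ring
    rw [this]; ring

/-- Realises a Gram matrix on `ℝ^κ`, where coordinatewise integration by parts is available. -/
theorem pi_gaussian {κ : Type*} [Fintype κ] (x : ι → κ → ℝ) :
    GaussVec (Measure.pi fun _ : κ => gaussianReal 0 1) (fun z j => ∑ k, x j k * z k)
      (fun i j => ∑ k, x i k * x j k) where
  meas := by fun_prop
  charFun θ := by
    have hg : ∀ b : ℝ, ∫ y, Complex.exp ((b * y : ℝ) * Complex.I) ∂(gaussianReal 0 1)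
        = Complex.exp (-(b ^ 2 / 2 : ℝ)) := by
      intro b
      have := charFun_gaussianReal (μ := 0) (v := 1) b
      rw [charFun_apply_real] at this
      push_cast at this ⊢
      rw [this]
      congr 1
      simp
    have e : ∀ z : κ → ℝ, Complex.exp ((∑ j, θ j * ∑ k, x j k * z k : ℝ) * Complex.I)
        = ∏ k, Complex.exp (((∑ j, θ j * x j k) * z k : ℝ) * Complex.I) := by
      intro z
      rw [← Complex.exp_sum, ← Finset.sum_mul, ← Complex.ofReal_sum]
      congr 3
      simp_rw [Finset.mul_sum, Finset.sum_mul]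
      rw [Finset.sum_comm]
      exact Finset.sum_congr rfl fun k _ => Finset.sum_congr rfl fun j _ => by ring
    simp_rw [e]
    rw [integral_fintype_prod_eq_prod (μ := fun _ : κ => gaussianReal 0 1)
      (fun k y => Complex.exp (((∑ j, θ j * x j k) * y : ℝ) * Complex.I))]
    simp_rw [hg]
    rw [← Complex.exp_sum, Finset.sum_neg_distrib, ← Complex.ofReal_sum]
    congr 3
    rw [← Finset.sum_div]
    congr 1
    simp_rw [sq, Finset.sum_mul_sum, Finset.mul_sum]
    rw [Finset.sum_comm]
    refine Finset.sum_congr rfl fun i _ => ?_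
    rw [Finset.sum_comm]
    exact Finset.sum_congr rfl fun k _ => Finset.sum_congr rfl fun j _ => by ring

end GaussVec

/-! ### The `sech` process and conditioning on its values. -/

/-- A centred Gaussian process on the line with covariance `sech (u - v)`. -/
def SechProcess {Ω : Type*} [MeasurableSpace Ω] (P : Measure Ω) (X : ℝ → Ω → ℝ) : Prop :=
  ∀ (n : ℕ) (u : Fin n → ℝ),
    GaussVec P (fun ω j => X (u j) ω) (fun i j => sech (u i - u j))

theorem SechProcess.measurable {Ω : Type*} [MeasurableSpace Ω] {P : Measure Ω} {X : ℝ → Ω → ℝ}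
    (h : SechProcess P X) (u : ℝ) : Measurable (X u) :=
  (measurable_pi_apply (0 : Fin 1)).comp (h 1 fun _ => u).meas

/-- The representation of the process obtained by conditioning on its value at `v`. -/
theorem SechProcess.prod {Ω : Type*} [MeasurableSpace Ω] {P : Measure Ω} [SFinite P]
    {X : ℝ → Ω → ℝ} (h : SechProcess P X) (v : ℝ) :
    SechProcess ((gaussianReal 0 1).prod P)
      (fun u p => sech (u - v) * p.1 + Real.tanh (u - v) * X u p.2) := by
  intro n u
  have := (h n u).prod (fun j => sech (u j - v)) (fun j => Real.tanh (u j - v))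
  simpa only [sech_mul_add_tanh_mul] using this

/-! ### Gaussian integration by parts and differentiation along curves. -/

/-- Integration by parts for the standard Gaussian measure on the line. -/
theorem integral_id_mul_gaussianReal {g g' : ℝ → ℝ} {C : ℝ} (hd : ∀ x, HasDerivAt g (g' x) x)
    (hg : ∀ x, |g x| ≤ C) (hg' : ∀ x, |g' x| ≤ C) :
    ∫ x, x * g x ∂(gaussianReal 0 1) = ∫ x, g' x ∂(gaussianReal 0 1) := by
  have hgm : Measurable g :=
    (continuous_iff_continuousAt.2 fun x => (hd x).continuousAt).measurable
  have hg'm : Measurable g' := by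
    have : g' = deriv g := by ext x; exact (hd x).deriv.symm
    rw [this]; exact measurable_deriv g
  set p := gaussianPDFReal 0 1 with hp
  have hpint : Integrable p := integrable_gaussianPDFReal 0 1
  -- The density satisfies `p' = -x p`, so the identity is ordinary integration by parts.
  have hpd : ∀ x, HasDerivAt p (-(x * p x)) x := by
    intro x
    have h1 : HasDerivAt (fun y : ℝ => -(y - 0) ^ 2 / (2 * ((1 : NNReal) : ℝ))) (-x) x := by
      have := ((hasDerivAt_id x).sub_const 0).pow 2 |>.neg.div_const (2 * ((1 : NNReal) : ℝ))
      refine this.congr_deriv ?_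
      simp
      ring
    have h2 := (h1.exp.const_mul (√(2 * Real.pi * ((1 : NNReal) : ℝ)))⁻¹)
    refine (h2.congr_deriv ?_)
    rw [hp, gaussianPDFReal]; ring
  have hxp : Integrable fun x => x * p x := by
    have h : Integrable (fun x : ℝ => x) (gaussianReal 0 1) :=
      memLp_one_iff_integrable.1 (memLp_id_gaussianReal 1)
    rw [gaussianReal_of_var_ne_zero _ one_ne_zero,
      integrable_withDensity_iff_integrable_smul' (measurable_gaussianPDF 0 1)
        (ae_of_all _ fun x => by simp [gaussianPDF])] at h
    refine h.congr (ae_of_all _ fun x => ?_)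
    simp [gaussianPDF, ENNReal.toReal_ofReal (gaussianPDFReal_nonneg 0 1 x), hp, mul_comm]
  rw [integral_gaussianReal_eq_integral_smul one_ne_zero,
    integral_gaussianReal_eq_integral_smul one_ne_zero]
  have key := integral_mul_deriv_eq_deriv_mul_of_integrable (u := g) (v := p) (u' := g')
    (v' := fun x => -(x * p x)) (fun x _ => hd x) (fun x _ => hpd x)
    ((hxp.neg.bdd_mul (c := C) hgm.aestronglyMeasurable (ae_of_all _ fun x => by simpa using hg x)))
    ((hpint.bdd_mul (c := C) hg'm.aestronglyMeasurable (ae_of_all _ fun x => by simpa using hg' x)))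
    ((hpint.bdd_mul (c := C) hgm.aestronglyMeasurable (ae_of_all _ fun x => by simpa using hg x)))
  have e1 : ∫ x, gaussianPDFReal 0 1 x • (x * g x) = -∫ x, g x * -(x * p x) := by
    rw [← integral_neg]
    refine integral_congr_ae (ae_of_all _ fun x => ?_)
    simp only [smul_eq_mul, hp]; ring
  have e2 : ∫ x, gaussianPDFReal 0 1 x • g' x = ∫ x, g' x * p x := by
    refine integral_congr_ae (ae_of_all _ fun x => ?_)
    simp only [smul_eq_mul, hp]; ring
  rw [e1, e2, key, neg_neg]

/-- The standard Gaussian measure on `Fin n → ℝ`. -/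
noncomputable abbrev stdGaussianPi (n : ℕ) : Measure (Fin n → ℝ) :=
  Measure.pi fun _ => gaussianReal 0 1

theorem integrable_eval_stdGaussianPi {n : ℕ} (i : Fin n) :
    Integrable (fun z : Fin n → ℝ => z i) (stdGaussianPi n) := by
  have h : Integrable (fun x : ℝ => x) (gaussianReal 0 1) :=
    memLp_one_iff_integrable.1 (memLp_id_gaussianReal 1)
  exact (measurePreserving_eval (fun _ : Fin n => gaussianReal 0 1) i).integrable_comp_of_integrable h

/-- Integration by parts for the standard Gaussian measure in one coordinate. -/
theorem integral_eval_mul_stdGaussianPi {n : ℕ} (i : Fin (n + 1))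
    {H H' : (Fin (n + 1) → ℝ) → ℝ} {C : ℝ} (hHm : Measurable H) (hH'm : Measurable H')
    (hd : ∀ z, HasDerivAt (fun x => H (Function.update z i x)) (H' z) (z i))
    (hH : ∀ z, |H z| ≤ C) (hH' : ∀ z, |H' z| ≤ C) :
    ∫ z, z i * H z ∂(stdGaussianPi (n + 1)) = ∫ z, H' z ∂(stdGaussianPi (n + 1)) := by
  have mp := (measurePreserving_piFinSuccAbove (fun _ : Fin (n + 1) => gaussianReal 0 1) i).symm
  have e : ∀ p : ℝ × (Fin n → ℝ),
      (MeasurableEquiv.piFinSuccAbove (fun _ : Fin (n + 1) => ℝ) i).symm p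
        = i.insertNth p.1 p.2 := fun p => rfl
  have i1 : Integrable (fun z => z i * H z) (stdGaussianPi (n + 1)) :=
    (integrable_eval_stdGaussianPi i).mul_bdd (c := C) hHm.aestronglyMeasurable
      (ae_of_all _ fun x => by simpa using hH x)
  have i2 : Integrable H' (stdGaussianPi (n + 1)) :=
    Integrable.of_bound hH'm.aestronglyMeasurable C (ae_of_all _ fun x => by simpa using hH' x)
  have j1 : Integrable (fun p => (MeasurableEquiv.piFinSuccAbove (fun _ => ℝ) i).symm p i
      * H ((MeasurableEquiv.piFinSuccAbove (fun _ => ℝ) i).symm p))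
      ((gaussianReal 0 1).prod (stdGaussianPi n)) := mp.integrable_comp_of_integrable i1
  have j2 : Integrable (fun p => H' ((MeasurableEquiv.piFinSuccAbove (fun _ => ℝ) i).symm p))
      ((gaussianReal 0 1).prod (stdGaussianPi n)) := mp.integrable_comp_of_integrable i2
  rw [← mp.integral_comp', ← mp.integral_comp', integral_prod_symm _ j1, integral_prod_symm _ j2]
  refine integral_congr_ae (ae_of_all _ fun y => ?_)
  simp only [e, Fin.insertNth_apply_same]
  refine integral_id_mul_gaussianReal (C := C) (fun x => ?_) (fun x => hH _) (fun x => hH' _)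
  have := hd (i.insertNth x y)
  simpa only [Fin.update_insertNth, Fin.insertNth_apply_same] using this

theorem hasDerivAt_sum_mul_update {n : ℕ} (a z : Fin n → ℝ) (i : Fin n) :
    HasDerivAt (fun x => ∑ j, a j * Function.update z i x j) (a i) (z i) := by
  have : ∀ x, ∑ j, a j * Function.update z i x j
      = a i * x + ∑ j ∈ Finset.univ.erase i, a j * z j := by
    intro x
    rw [← Finset.add_sum_erase _ _ (Finset.mem_univ i), Function.update_self]
    congr 1
    refine Finset.sum_congr rfl fun j hj => ?_
    rw [Function.update_of_ne (Finset.ne_of_mem_erase hj)]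
  simp_rw [this]
  simpa using ((hasDerivAt_id (z i)).const_mul (a i)).add_const
    (∑ j ∈ Finset.univ.erase i, a j * z j)

/-- Differentiation of a Gaussian expectation along a curve of unit vectors. -/
theorem hasDerivAt_integral_mul_comp_inner {n : ℕ} {G : (Fin (n + 1) → ℝ) → ℝ}
    {g : Fin (n + 1) → (Fin (n + 1) → ℝ) → ℝ} {F F' F'' : ℝ → ℝ} {e e' : ℝ → Fin (n + 1) → ℝ}
    {C : ℝ} (hG : ∀ i z, HasDerivAt (fun x => G (Function.update z i x)) (g i z) (z i))
    (hGc : Continuous G) (hgc : ∀ i, Continuous (g i)) (hGb : ∀ z, |G z| ≤ C)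
    (hgb : ∀ i z, |g i z| ≤ C) (hF : ∀ x, HasDerivAt F (F' x) x)
    (hF' : ∀ x, HasDerivAt F' (F'' x) x) (hF''c : Continuous F'')
    (hFb : ∀ x, |F x| ≤ C) (hF'b : ∀ x, |F' x| ≤ C) (hF''b : ∀ x, |F'' x| ≤ C)
    (he : ∀ i w, HasDerivAt (fun w => e w i) (e' w i) w) (he'c : Continuous e')
    (horth : ∀ w, ∑ i, e w i * e' w i = 0) (w₀ : ℝ) :
    HasDerivAt (fun w => ∫ z, G z * F (∑ i, e w i * z i) ∂(stdGaussianPi (n + 1)))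
      (∫ z, (∑ i, e' w₀ i * g i z) * F' (∑ i, e w₀ i * z i) ∂(stdGaussianPi (n + 1))) w₀ := by
  have hC : 0 ≤ C := (abs_nonneg _).trans (hFb 0)
  have hFc : Continuous F := continuous_iff_continuousAt.2 fun x => (hF x).continuousAt
  have hF'c : Continuous F' := continuous_iff_continuousAt.2 fun x => (hF' x).continuousAt
  have hlin : ∀ w, Continuous fun z : Fin (n + 1) → ℝ => ∑ i, e w i * z i := by
    intro w; fun_prop
  -- Local bound on the velocity of the curve, giving a dominating function for differentiation
  -- under the integral.
  obtain ⟨B, hB⟩ := (isCompact_closedBall w₀ (1 : ℝ)).exists_bound_of_continuousOn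
    he'c.continuousOn
  have hder : ∀ (z : Fin (n + 1) → ℝ) (w : ℝ), HasDerivAt (fun w => G z * F (∑ i, e w i * z i))
      (∑ i, e' w i * (z i * (G z * F' (∑ j, e w j * z j)))) w := by
    intro z w
    have h1 : HasDerivAt (fun w => ∑ i, e w i * z i) (∑ i, e' w i * z i) w :=
      HasDerivAt.fun_sum fun i _ => (he i w).mul_const _
    refine (((hF _).comp w h1).const_mul (G z)).congr_deriv ?_
    rw [Finset.mul_sum, Finset.mul_sum]
    exact Finset.sum_congr rfl fun i _ => by ring
  have main := hasDerivAt_integral_of_dominated_loc_of_deriv_le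
    (μ := stdGaussianPi (n + 1)) (x₀ := w₀) (s := Metric.ball w₀ 1)
    (F := fun w z => G z * F (∑ i, e w i * z i))
    (F' := fun w z => ∑ i, e' w i * (z i * (G z * F' (∑ j, e w j * z j))))
    (bound := fun z => ∑ i, B * (|z i| * (C * C)))
    (Metric.ball_mem_nhds w₀ one_pos)
    (Eventually.of_forall fun w => (hGc.mul (hFc.comp (hlin w))).aestronglyMeasurable)
    (Integrable.of_bound (hGc.mul (hFc.comp (hlin w₀))).aestronglyMeasurable (C * C)
      (ae_of_all _ fun z => by
        rw [Real.norm_eq_abs, abs_mul]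
        exact mul_le_mul (hGb _) (hFb _) (abs_nonneg _) hC))
    (Continuous.aestronglyMeasurable (continuous_finsetSum _ fun i _ =>
      ((continuous_apply i).mul (hGc.mul (hF'c.comp (hlin w₀)))).const_mul _))
    (ae_of_all _ fun z w hw => by
      rw [Real.norm_eq_abs]
      refine (Finset.abs_sum_le_sum_abs _ _).trans (Finset.sum_le_sum fun i _ => ?_)
      rw [abs_mul, abs_mul, abs_mul]
      have hb : |e' w i| ≤ B := (norm_le_pi_norm (e' w) i).trans (hB w (Metric.ball_subset_closedBall hw))
      have := mul_le_mul (hGb z) (hF'b (∑ j, e w j * z j)) (abs_nonneg _) hC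
      gcongr
      exact (abs_nonneg _).trans hb)
    (integrable_finsetSum _ fun i _ =>
      (((integrable_eval_stdGaussianPi i).abs.mul_const _).const_mul _))
    (ae_of_all _ fun z w _ => hder z w)
  refine main.2.congr_deriv ?_
  set H : (Fin (n + 1) → ℝ) → ℝ := fun z => G z * F' (∑ j, e w₀ j * z j) with hH
  set H' : Fin (n + 1) → (Fin (n + 1) → ℝ) → ℝ := fun i z => g i z * F' (∑ j, e w₀ j * z j)
    + e w₀ i * (G z * F'' (∑ j, e w₀ j * z j)) with hH'
  have hHb : ∀ z, |H z| ≤ C * C := fun z => by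
    rw [hH]; simp only [abs_mul]
    exact mul_le_mul (hGb z) (hF'b _) (abs_nonneg _) hC
  have hH'b : ∀ i z, |H' i z| ≤ C * C + |e w₀ i| * (C * C) := fun i z => by
    rw [hH']; refine (abs_add_le _ _).trans ?_
    rw [abs_mul, abs_mul, abs_mul]
    have h1 := mul_le_mul (hgb i z) (hF'b (∑ j, e w₀ j * z j)) (abs_nonneg _) hC
    have h2 := mul_le_mul (hGb z) (hF''b (∑ j, e w₀ j * z j)) (abs_nonneg _) hC
    gcongr
  have hHc : Continuous H := hGc.mul (hF'c.comp (hlin w₀))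
  have hH'c : ∀ i, Continuous (H' i) := fun i =>
    ((hgc i).mul (hF'c.comp (hlin w₀))).add ((hGc.mul (hF''c.comp (hlin w₀))).const_mul _)
  have stein : ∀ i, ∫ z, z i * H z ∂(stdGaussianPi (n + 1))
      = ∫ z, H' i z ∂(stdGaussianPi (n + 1)) := by
    intro i
    refine integral_eval_mul_stdGaussianPi i (C := C * C + |e w₀ i| * (C * C)) hHc.measurable
      (hH'c i).measurable (fun z => ?_) (fun z => (hHb z).trans ?_) (hH'b i)
    · have h1 := hasDerivAt_sum_mul_update (e w₀) z i
      have h2 := (hG i z).mul (HasDerivAt.comp (z i) (hF' _) h1)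
      refine h2.congr_deriv ?_
      simp only [Function.comp, Function.update_eq_self, hH']
      ring
    · have := mul_nonneg (abs_nonneg (e w₀ i)) (mul_nonneg hC hC)
      linarith
  have hi1 : ∀ i, Integrable (fun z => e' w₀ i * (z i * H z)) (stdGaussianPi (n + 1)) := fun i =>
    ((integrable_eval_stdGaussianPi i).mul_bdd (c := C * C) hHc.aestronglyMeasurable
      (ae_of_all _ fun x => by simpa using hHb x)).const_mul _
  have hi2 : ∀ i, Integrable (fun z => e' w₀ i * H' i z) (stdGaussianPi (n + 1)) := fun i =>
    (Integrable.of_bound (hH'c i).aestronglyMeasurable _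
      (ae_of_all _ fun x => by simpa using hH'b i x)).const_mul _
  calc ∫ z, ∑ i, e' w₀ i * (z i * H z) ∂(stdGaussianPi (n + 1))
      = ∑ i, ∫ z, e' w₀ i * H' i z ∂(stdGaussianPi (n + 1)) := by
        rw [integral_finsetSum _ fun i _ => hi1 i]
        refine Finset.sum_congr rfl fun i _ => ?_
        rw [integral_const_mul, integral_const_mul, stein]
    _ = ∫ z, ∑ i, e' w₀ i * H' i z ∂(stdGaussianPi (n + 1)) :=
        (integral_finsetSum _ fun i _ => hi2 i).symm
    _ = _ := by
        refine integral_congr_ae (ae_of_all _ fun z => ?_)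
        simp only [hH', mul_add, Finset.sum_add_distrib]
        -- The second-derivative terms carry the factor `⟨e, e'⟩`, which is zero: the variance of
        -- the moving coordinate is constant.
        have : ∑ i, e' w₀ i * (e w₀ i * (G z * F'' (∑ j, e w₀ j * z j))) = 0 := by
          have h0 := congrArg (· * (G z * F'' (∑ j, e w₀ j * z j))) (horth w₀)
          simp only [Finset.sum_mul, zero_mul] at h0
          rw [← h0]
          exact Finset.sum_congr rfl fun i _ => by ring
        rw [this, add_zero, Finset.sum_mul]
        exact Finset.sum_congr rfl fun i _ => by ring

/-! ### Concentration of a pair of Cauchy kernels at the origin. -/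

theorem gaussianPDFReal_zero_one_le (x : ℝ) :
    gaussianPDFReal 0 1 x ≤ (√(2 * Real.pi))⁻¹ := by
  have h : Real.exp (-(x - 0) ^ 2 / (2 * ((1 : NNReal) : ℝ))) ≤ 1 := by
    rw [Real.exp_le_one_iff]
    have := sq_nonneg (x - 0)
    simp only [NNReal.coe_one, mul_one]
    linarith
  simpa [gaussianPDFReal] using mul_le_mul_of_nonneg_left h
    (inv_nonneg.2 (Real.sqrt_nonneg (2 * Real.pi)))

theorem continuous_gaussianPDFReal_zero_one : Continuous (gaussianPDFReal 0 1) := by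
  unfold gaussianPDFReal; fun_prop

theorem gaussianPDFReal_zero_one_zero : gaussianPDFReal 0 1 0 = (√(2 * Real.pi))⁻¹ := by
  simp [gaussianPDFReal]

theorem inv_sqrt_two_pi_sq : (√(2 * Real.pi))⁻¹ * (√(2 * Real.pi))⁻¹ = (2 * Real.pi)⁻¹ := by
  rw [← mul_inv, Real.mul_self_sqrt (by positivity)]

theorem integral_eq_abs_inv_mul_integral_comp (f : ℝ → ℝ) {a : ℝ} (ha : a ≠ 0) (b : ℝ) :
    ∫ y, f y = |a|⁻¹ * ∫ y, f ((y - b) / a) := by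
  have h1 : ∫ y, f ((y - b) / a) = ∫ y, f (y / a) :=
    integral_sub_right_eq_self (fun y => f (y / a)) b
  rw [h1, Measure.integral_comp_div, smul_eq_mul, ← mul_assoc, inv_mul_cancel₀ (abs_ne_zero.2 ha),
    one_mul]

section Concentration

variable {Ω : Type*} [MeasurableSpace Ω] {P : Measure Ω} [IsProbabilityMeasure P]

/-- The product of Cauchy kernels at scale `1 / N` in the directions `(1, 0)` and `(c, t)`. -/
noncomputable def cauchyPair (N c t : ℝ) (x y : ℝ) : ℝ :=
  N * (1 + (N * x) ^ 2)⁻¹ * (N * (1 + (N * (c * x + t * y)) ^ 2)⁻¹)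

theorem continuous_inv_one_add_sq : Continuous fun x : ℝ => (1 + x ^ 2)⁻¹ :=
  (by fun_prop : Continuous fun x : ℝ => 1 + x ^ 2).inv₀ fun x => by positivity

theorem continuous_cauchyPair (N c t : ℝ) :
    Continuous fun p : ℝ × ℝ => cauchyPair N c t p.1 p.2 := by
  unfold cauchyPair
  have h1 : Continuous fun p : ℝ × ℝ => (1 + (N * p.1) ^ 2)⁻¹ :=
    continuous_inv_one_add_sq.comp (by fun_prop : Continuous fun p : ℝ × ℝ => N * p.1)
  have h2 : Continuous fun p : ℝ × ℝ => (1 + (N * (c * p.1 + t * p.2)) ^ 2)⁻¹ :=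
    continuous_inv_one_add_sq.comp
      (by fun_prop : Continuous fun p : ℝ × ℝ => N * (c * p.1 + t * p.2))
  exact (h1.const_mul N).mul (h2.const_mul N)

theorem inv_one_add_sq_le_one (x : ℝ) : (1 + x ^ 2)⁻¹ ≤ 1 :=
  inv_le_one_of_one_le₀ (by nlinarith [sq_nonneg x])

theorem abs_cauchyPair_le (N c t x y : ℝ) : |cauchyPair N c t x y| ≤ |N| * |N| := by
  have h1 := inv_one_add_sq_le_one (N * x)
  have h2 := inv_one_add_sq_le_one (N * (c * x + t * y))
  have p1 : 0 ≤ (1 + (N * x) ^ 2)⁻¹ := by positivity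
  have p2 : 0 ≤ (1 + (N * (c * x + t * y)) ^ 2)⁻¹ := by positivity
  rw [cauchyPair, abs_mul, abs_mul, abs_mul, abs_of_nonneg p1, abs_of_nonneg p2]
  have a1 : |N| * (1 + (N * x) ^ 2)⁻¹ ≤ |N| := mul_le_of_le_one_right (abs_nonneg _) h1
  have a2 : |N| * (1 + (N * (c * x + t * y)) ^ 2)⁻¹ ≤ |N| :=
    mul_le_of_le_one_right (abs_nonneg _) h2
  gcongr

/-- The integrand after rescaling. -/
noncomputable def rescaled (Q : ℝ → ℝ → Ω → ℝ) (N c t : ℝ) (p : ℝ × ℝ × Ω) : ℝ :=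
  ((1 + p.1 ^ 2)⁻¹ * (1 + p.2.1 ^ 2)⁻¹) * (gaussianPDFReal 0 1 (p.1 / N)
    * gaussianPDFReal 0 1 ((p.2.1 - c * p.1) / (t * N))
    * Q (p.1 / N) ((p.2.1 - c * p.1) / (t * N)) p.2.2)

theorem measurable_rescaled {Q : ℝ → ℝ → Ω → ℝ} (hQ : Measurable fun p : ℝ × ℝ × Ω => Q p.1 p.2.1 p.2.2)
    (N c t : ℝ) : Measurable (rescaled Q N c t) := by
  have hφ := continuous_gaussianPDFReal_zero_one.measurable
  have h1 : Measurable fun p : ℝ × ℝ × Ω => p.1 / N := by fun_prop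
  have h2 : Measurable fun p : ℝ × ℝ × Ω => (p.2.1 - c * p.1) / (t * N) := by fun_prop
  have h3 : Measurable fun p : ℝ × ℝ × Ω =>
      Q (p.1 / N) ((p.2.1 - c * p.1) / (t * N)) p.2.2 :=
    hQ.comp (h1.prodMk (h2.prodMk measurable_snd.snd))
  have h4 : Measurable fun p : ℝ × ℝ × Ω => (1 + p.1 ^ 2)⁻¹ :=
    continuous_inv_one_add_sq.measurable.comp measurable_fst
  have h5 : Measurable fun p : ℝ × ℝ × Ω => (1 + p.2.1 ^ 2)⁻¹ :=
    continuous_inv_one_add_sq.measurable.comp measurable_snd.fst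
  exact (h4.mul h5).mul (((hφ.comp h1).mul (hφ.comp h2)).mul h3)

-- The bound does not depend on `N`, so it serves both for uniform estimates and for dominated
-- convergence.
omit [MeasurableSpace Ω] in
theorem norm_rescaled_le {Q : ℝ → ℝ → Ω → ℝ} {C : ℝ} (hQb : ∀ x y ω, |Q x y ω| ≤ C)
    (N c t : ℝ) (p : ℝ × ℝ × Ω) :
    ‖rescaled Q N c t p‖ ≤ (1 + p.1 ^ 2)⁻¹ * ((1 + p.2.1 ^ 2)⁻¹ * ((2 * Real.pi)⁻¹ * C)) := by
  have p1 : 0 ≤ (1 + p.1 ^ 2)⁻¹ := by positivity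
  have p2 : 0 ≤ (1 + p.2.1 ^ 2)⁻¹ := by positivity
  have q : ∀ x, 0 ≤ gaussianPDFReal 0 1 x := gaussianPDFReal_nonneg 0 1
  rw [rescaled, Real.norm_eq_abs, abs_mul, abs_mul, abs_of_nonneg p1, abs_of_nonneg p2, abs_mul,
    abs_mul, abs_of_nonneg (q _), abs_of_nonneg (q _), ← inv_sqrt_two_pi_sq, mul_assoc]
  have h1 := gaussianPDFReal_zero_one_le (p.1 / N)
  have h2 := gaussianPDFReal_zero_one_le ((p.2.1 - c * p.1) / (t * N))
  have h3 := hQb (p.1 / N) ((p.2.1 - c * p.1) / (t * N)) p.2.2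
  have := q (p.1 / N)
  have := q ((p.2.1 - c * p.1) / (t * N))
  gcongr

theorem integrable_rescaled_bound (P : Measure Ω) [IsProbabilityMeasure P] (C : ℝ) :
    Integrable (fun p : ℝ × ℝ × Ω =>
      (1 + p.1 ^ 2)⁻¹ * ((1 + p.2.1 ^ 2)⁻¹ * ((2 * Real.pi)⁻¹ * C)))
      (volume.prod (volume.prod P)) :=
  integrable_inv_one_add_sq.mul_prod
    (integrable_inv_one_add_sq.mul_prod (integrable_const ((2 * Real.pi)⁻¹ * C)))

theorem integral_rescaled_bound (P : Measure Ω) [IsProbabilityMeasure P] (C : ℝ) :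
    ∫ p : ℝ × ℝ × Ω, (1 + p.1 ^ 2)⁻¹ * ((1 + p.2.1 ^ 2)⁻¹ * ((2 * Real.pi)⁻¹ * C))
      ∂(volume.prod (volume.prod P)) = Real.pi / 2 * C := by
  rw [integral_prod_mul (fun x : ℝ => (1 + x ^ 2)⁻¹)
    (fun q : ℝ × Ω => (1 + q.1 ^ 2)⁻¹ * ((2 * Real.pi)⁻¹ * C)),
    integral_prod_mul (fun x : ℝ => (1 + x ^ 2)⁻¹) (fun _ : Ω => (2 * Real.pi)⁻¹ * C),
    integral_univ_inv_one_add_sq]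
  simp
  have := Real.pi_pos.ne'
  field_simp

/-- Substitute `x / N` and `(y - c x) / (t N)` for the two Gaussian variables: both kernels become
standard Cauchy kernels, and the Jacobian `1 / (|t| N²)` absorbs their prefactors. -/
theorem integral_cauchyPair_mul {Q : ℝ → ℝ → Ω → ℝ} {C : ℝ}
    (hQ : Measurable fun p : ℝ × ℝ × Ω => Q p.1 p.2.1 p.2.2) (hQb : ∀ x y ω, |Q x y ω| ≤ C)
    {N c t : ℝ} (hN : 0 < N) (ht : t ≠ 0) :
    ∫ p, cauchyPair N c t p.1 p.2.1 * Q p.1 p.2.1 p.2.2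
        ∂((gaussianReal 0 1).prod ((gaussianReal 0 1).prod P))
      = |t|⁻¹ * ∫ p, rescaled Q N c t p ∂(volume.prod (volume.prod P)) := by
  have hKm : Measurable fun p : ℝ × ℝ × Ω => cauchyPair N c t p.1 p.2.1 * Q p.1 p.2.1 p.2.2 :=
    ((continuous_cauchyPair N c t).measurable.comp
      (measurable_fst.prodMk measurable_snd.fst)).mul hQ
  have hKb : ∀ x y ω, ‖cauchyPair N c t x y * Q x y ω‖ ≤ |N| * |N| * C := by
    intro x y ω
    rw [Real.norm_eq_abs, abs_mul]
    have h1 := abs_cauchyPair_le N c t x y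
    have h2 := hQb x y ω
    gcongr
  have hKint : Integrable (fun p : ℝ × ℝ × Ω => cauchyPair N c t p.1 p.2.1 * Q p.1 p.2.1 p.2.2)
      ((gaussianReal 0 1).prod ((gaussianReal 0 1).prod P)) :=
    Integrable.of_bound hKm.aestronglyMeasurable _ (ae_of_all _ fun p => hKb _ _ _)
  have hKint' : ∀ x, Integrable (fun p : ℝ × Ω => cauchyPair N c t x p.1 * Q x p.1 p.2)
      ((gaussianReal 0 1).prod P) := fun x =>
    Integrable.of_bound (hKm.comp measurable_prodMk_left).aestronglyMeasurable _
      (ae_of_all _ fun p => hKb _ _ _)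
  have hRm := measurable_rescaled hQ N c t
  have hRint : Integrable (rescaled Q N c t) (volume.prod (volume.prod P)) :=
    (integrable_rescaled_bound P C).mono' hRm.aestronglyMeasurable
      (ae_of_all _ fun p => norm_rescaled_le hQb N c t p)
  rw [integral_prod _ hKint, integral_gaussianReal_eq_integral_smul one_ne_zero,
    integral_eq_abs_inv_mul_integral_comp _ hN.ne' 0, integral_prod _ hRint,
    ← integral_const_mul, ← integral_const_mul]
  refine integral_congr_ae ?_
  filter_upwards [hRint.prod_right_ae] with x hx
  rw [integral_prod _ (hKint' _), integral_gaussianReal_eq_integral_smul one_ne_zero,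
    integral_eq_abs_inv_mul_integral_comp _ (mul_ne_zero ht hN.ne') (c * x), integral_prod _ hx,
    smul_eq_mul, ← integral_const_mul, ← integral_const_mul, ← integral_const_mul,
    ← integral_const_mul]
  refine integral_congr_ae (ae_of_all _ fun y => ?_)
  simp only [smul_eq_mul]
  rw [← integral_const_mul, ← integral_const_mul, ← integral_const_mul, ← integral_const_mul,
    ← integral_const_mul]
  refine integral_congr_ae (ae_of_all _ fun ω => ?_)
  have e1 : N * ((x - 0) / N) = x := by field_simp; ring
  have e2 : N * (c * ((x - 0) / N) + t * ((y - c * x) / (t * N))) = y := by field_simp; ring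
  simp only [rescaled, cauchyPair]
  rw [e1, e2, sub_zero, abs_of_pos hN, abs_mul, abs_of_pos hN]
  have := abs_pos.2 ht
  field_simp

theorem abs_integral_cauchyPair_mul_le {Q : ℝ → ℝ → Ω → ℝ} {C : ℝ}
    (hQ : Measurable fun p : ℝ × ℝ × Ω => Q p.1 p.2.1 p.2.2) (hQb : ∀ x y ω, |Q x y ω| ≤ C)
    {N c t : ℝ} (hN : 0 < N) (ht : t ≠ 0) :
    |∫ p, cauchyPair N c t p.1 p.2.1 * Q p.1 p.2.1 p.2.2
        ∂((gaussianReal 0 1).prod ((gaussianReal 0 1).prod P))| ≤ |t|⁻¹ * (Real.pi / 2 * C) := by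
  rw [integral_cauchyPair_mul hQ hQb hN ht, abs_mul, abs_of_nonneg (inv_nonneg.2 (abs_nonneg t)),
    ← integral_rescaled_bound P C]
  gcongr
  exact norm_integral_le_of_norm_le (integrable_rescaled_bound P C)
    (ae_of_all _ fun p => norm_rescaled_le hQb N c t p)

/-- Each Cauchy kernel has mass `π` and the two Gaussian densities at `0` contribute `1 / (2 π)`;
hence the factor `π / 2`. The function `Q` may depend on `n`, because the smoothed signs sharpen
together with the kernels. -/
theorem tendsto_integral_cauchyPair_mul {Q : ℕ → ℝ → ℝ → Ω → ℝ} {q : Ω → ℝ} {C : ℝ}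
    (hQ : ∀ n, Measurable fun p : ℝ × ℝ × Ω => Q n p.1 p.2.1 p.2.2)
    (hQb : ∀ n x y ω, |Q n x y ω| ≤ C) {N : ℕ → ℝ} (hN : ∀ n, 0 < N n)
    (hNt : Tendsto N atTop atTop) {c t : ℝ} (ht : t ≠ 0)
    (hlim : ∀ x y, ∀ᵐ ω ∂P, Tendsto (fun n => Q n (x / N n) ((y - c * x) / (t * N n)) ω)
      atTop (𝓝 (q ω))) (hq : Measurable q) :
    Tendsto (fun n => ∫ p, cauchyPair (N n) c t p.1 p.2.1 * Q n p.1 p.2.1 p.2.2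
        ∂((gaussianReal 0 1).prod ((gaussianReal 0 1).prod P))) atTop
      (𝓝 (|t|⁻¹ * (Real.pi / 2 * ∫ ω, q ω ∂P))) := by
  refine Tendsto.congr (fun n => (integral_cauchyPair_mul (c := c) (hQ n) (hQb n) (hN n) ht).symm) ?_
  refine Tendsto.const_mul _ ?_
  have hval : ∫ p : ℝ × ℝ × Ω, (1 + p.1 ^ 2)⁻¹ * ((1 + p.2.1 ^ 2)⁻¹ * ((2 * Real.pi)⁻¹ * q p.2.2))
      ∂(volume.prod (volume.prod P)) = Real.pi / 2 * ∫ ω, q ω ∂P := by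
    rw [integral_prod_mul (fun x : ℝ => (1 + x ^ 2)⁻¹)
      (fun z : ℝ × Ω => (1 + z.1 ^ 2)⁻¹ * ((2 * Real.pi)⁻¹ * q z.2)),
      integral_prod_mul (fun x : ℝ => (1 + x ^ 2)⁻¹) (fun ω : Ω => (2 * Real.pi)⁻¹ * q ω),
      integral_univ_inv_one_add_sq, integral_const_mul]
    have := Real.pi_pos.ne'
    field_simp
  rw [← hval]
  refine tendsto_integral_of_dominated_convergence _
    (fun n => (measurable_rescaled (hQ n) (N n) c t).aestronglyMeasurable)
    (integrable_rescaled_bound P C)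
    (fun n => ae_of_all _ fun p => norm_rescaled_le (hQb n) (N n) c t p) ?_
  have hset : MeasurableSet {p : ℝ × ℝ × Ω | Tendsto (fun n =>
      Q n (p.1 / N n) ((p.2.1 - c * p.1) / (t * N n)) p.2.2) atTop (𝓝 (q p.2.2))} := by
    refine measurableSet_tendsto_fun (fun n => ?_) (hq.comp measurable_snd.snd)
    exact (hQ n).comp ((by fun_prop : Measurable fun p : ℝ × ℝ × Ω => p.1 / N n).prodMk
      ((by fun_prop : Measurable fun p : ℝ × ℝ × Ω => (p.2.1 - c * p.1) / (t * N n)).prodMk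
        measurable_snd.snd))
  -- The exceptional null set depends on `x` and `y`; Fubini makes it null in the product.
  have hae : ∀ᵐ p ∂((volume : Measure ℝ).prod ((volume : Measure ℝ).prod P)), Tendsto (fun n =>
      Q n (p.1 / N n) ((p.2.1 - c * p.1) / (t * N n)) p.2.2) atTop (𝓝 (q p.2.2)) := by
    rw [Measure.ae_prod_iff_ae_ae hset]
    refine ae_of_all _ fun x => ?_
    exact (Measure.ae_prod_iff_ae_ae (measurable_prodMk_left (x := x) hset)).2
      (ae_of_all _ fun y => hlim x y)
  filter_upwards [hae] with p hp
  have hφ : ∀ s : ℝ, Tendsto (fun n => gaussianPDFReal 0 1 (s / N n)) atTop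
      (𝓝 (√(2 * Real.pi))⁻¹) := by
    intro s
    rw [← gaussianPDFReal_zero_one_zero]
    exact (continuous_gaussianPDFReal_zero_one.tendsto 0).comp (hNt.const_div_atTop s)
  have h2 : Tendsto (fun n => gaussianPDFReal 0 1 ((p.2.1 - c * p.1) / (t * N n))) atTop
      (𝓝 (√(2 * Real.pi))⁻¹) := by
    simpa only [div_div] using hφ ((p.2.1 - c * p.1) / t)
  have := (((hφ p.1).mul h2).mul hp).const_mul ((1 + p.1 ^ 2)⁻¹ * (1 + p.2.1 ^ 2)⁻¹)
  rw [inv_sqrt_two_pi_sq, mul_assoc] at this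
  exact this

end Concentration

/-! ### The correlation angle, and smooth approximations of the sign. -/

/-- `2 arctan (exp (-x))`, which is `arcsin (sech x)` for `x ≥ 0`. -/
noncomputable def sechAngle (x : ℝ) : ℝ := 2 * Real.arctan (Real.exp (-x))

theorem sechAngle_zero : sechAngle 0 = Real.pi / 2 := by
  simp [sechAngle]; ring

theorem hasDerivAt_sechAngle (x : ℝ) : HasDerivAt sechAngle (-sech x) x := by
  have h := ((hasDerivAt_neg x).exp.arctan).const_mul 2
  refine h.congr_deriv ?_
  have h1 : Real.exp (-x) * Real.exp x = 1 := by rw [← Real.exp_add]; simp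
  have h2 := Real.exp_pos x
  rw [sech, Real.cosh_eq, Real.exp_neg]
  field_simp

theorem continuous_sechAngle : Continuous sechAngle :=
  continuous_iff_continuousAt.2 fun x => (hasDerivAt_sechAngle x).continuousAt

/-- A smooth approximation of `π / 2 * sign`. -/
noncomputable def smoothSign (N x : ℝ) : ℝ := Real.arctan (N * x)

/-- The derivative of `smoothSign N`. -/
noncomputable def smoothDelta (N x : ℝ) : ℝ := N * (1 + (N * x) ^ 2)⁻¹

theorem hasDerivAt_smoothSign (N x : ℝ) : HasDerivAt (smoothSign N) (smoothDelta N x) x := by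
  have := ((hasDerivAt_id x).const_mul N).arctan
  refine this.congr_deriv ?_
  simp [smoothDelta, mul_comm]

theorem continuous_smoothSign (N : ℝ) : Continuous (smoothSign N) :=
  continuous_iff_continuousAt.2 fun x => (hasDerivAt_smoothSign N x).continuousAt

theorem abs_smoothSign_le (N x : ℝ) : |smoothSign N x| ≤ Real.pi / 2 :=
  abs_le.2 ⟨(Real.neg_pi_div_two_lt_arctan _).le, (Real.arctan_lt_pi_div_two _).le⟩

theorem hasDerivAt_smoothDelta (N x : ℝ) : HasDerivAt (smoothDelta N)
    (-(N * (2 * (N * x) * N) * ((1 + (N * x) ^ 2)⁻¹) ^ 2)) x := by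
  have h : HasDerivAt (fun x => 1 + (N * x) ^ 2) (2 * (N * x) * N) x := by
    have := (((hasDerivAt_id x).const_mul N).pow 2).const_add 1
    refine this.congr_deriv ?_
    simp
  have h0 : (1 + (N * x) ^ 2) ≠ 0 := by positivity
  refine ((h.inv h0).const_mul N).congr_deriv ?_
  field_simp

theorem continuous_smoothDelta (N : ℝ) : Continuous (smoothDelta N) :=
  continuous_iff_continuousAt.2 fun x => (hasDerivAt_smoothDelta N x).continuousAt

theorem abs_smoothDelta_le (N x : ℝ) : |smoothDelta N x| ≤ |N| := by
  have h1 := inv_one_add_sq_le_one (N * x)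
  have p1 : 0 ≤ (1 + (N * x) ^ 2)⁻¹ := by positivity
  rw [smoothDelta, abs_mul, abs_of_nonneg p1]
  exact mul_le_of_le_one_right (abs_nonneg _) h1

theorem continuous_deriv_smoothDelta (N : ℝ) :
    Continuous fun x => -(N * (2 * (N * x) * N) * ((1 + (N * x) ^ 2)⁻¹) ^ 2) := by
  have h : Continuous fun x : ℝ => (1 + (N * x) ^ 2)⁻¹ :=
    continuous_inv_one_add_sq.comp (by fun_prop : Continuous fun x : ℝ => N * x)
  fun_prop

theorem abs_deriv_smoothDelta_le (N x : ℝ) :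
    |-(N * (2 * (N * x) * N) * ((1 + (N * x) ^ 2)⁻¹) ^ 2)| ≤ |N| * |N| := by
  have h1 := inv_one_add_sq_le_one (N * x)
  have p1 : 0 ≤ (1 + (N * x) ^ 2)⁻¹ := by positivity
  have h2 : |2 * (N * x)| * (1 + (N * x) ^ 2)⁻¹ ≤ 1 := by
    rw [← div_eq_mul_inv, div_le_one (by positivity), abs_le]
    constructor <;> nlinarith [sq_nonneg (N * x + 1), sq_nonneg (N * x - 1)]
  have e : |-(N * (2 * (N * x) * N) * ((1 + (N * x) ^ 2)⁻¹) ^ 2)|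
      = (|N| * |N|) * ((|2 * (N * x)| * (1 + (N * x) ^ 2)⁻¹) * (1 + (N * x) ^ 2)⁻¹) := by
    rw [abs_neg, abs_mul, abs_mul, abs_mul (2 * (N * x)), abs_pow, abs_of_nonneg p1]
    ring
  rw [e]
  refine mul_le_of_le_one_right (by positivity) ?_
  have := mul_le_mul h2 h1 p1 zero_le_one
  linarith

/-- The offset `a` allows for variables pinned at scale `1 / N`, which stay bounded after
multiplication by `N` and do not affect the limiting sign. -/
theorem tendsto_arctan_of_sign {y : ℕ → ℝ} {N : ℕ → ℝ} (hN : Tendsto N atTop atTop) {a b : ℝ}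
    (hb : b ≠ 0) (hy : ∀ n, y n = a + N n * b) :
    Tendsto (fun n => Real.arctan (y n)) atTop (𝓝 (Real.pi / 2 * Real.sign b)) := by
  have hfun : y = fun n => a + N n * b := funext hy
  rcases lt_or_gt_of_ne hb with h | h
  · rw [Real.sign_of_neg h, mul_neg_one]
    refine (Real.tendsto_arctan_atBot.mono_right nhdsWithin_le_nhds).comp ?_
    rw [hfun]
    exact tendsto_atBot_add_const_left _ _ (hN.atTop_mul_const_of_neg h)
  · rw [Real.sign_of_pos h, mul_one]
    refine (Real.tendsto_arctan_atTop.mono_right nhdsWithin_le_nhds).comp ?_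
    rw [hfun]
    exact tendsto_atTop_add_const_left _ _ (hN.atTop_mul_const h)

theorem measurable_sign_real : Measurable Real.sign := by
  have : Real.sign = fun x : ℝ => if x < 0 then (-1 : ℝ) else if 0 < x then 1 else 0 := by
    ext x; rfl
  rw [this]
  exact Measurable.ite measurableSet_Iio measurable_const
    (Measurable.ite measurableSet_Ioi measurable_const measurable_const)

theorem abs_sign_le_one (x : ℝ) : |Real.sign x| ≤ 1 := by
  rcases Real.sign_apply_eq x with h | h | h <;> rw [h] <;> simp

theorem sign_mul_real (x y : ℝ) : Real.sign (x * y) = Real.sign x * Real.sign y := by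
  rcases lt_trichotomy x 0 with hx | hx | hx <;> rcases lt_trichotomy y 0 with hy | hy | hy
  · rw [Real.sign_of_neg hx, Real.sign_of_neg hy, Real.sign_of_pos (mul_pos_of_neg_of_neg hx hy)]
    norm_num
  · simp [hy]
  · rw [Real.sign_of_neg hx, Real.sign_of_pos hy, Real.sign_of_neg (mul_neg_of_neg_of_pos hx hy)]
    norm_num
  · simp [hx]
  · simp [hx]
  · simp [hx]
  · rw [Real.sign_of_pos hx, Real.sign_of_neg hy, Real.sign_of_neg (mul_neg_of_pos_of_neg hx hy)]
    norm_num
  · simp [hy]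
  · rw [Real.sign_of_pos hx, Real.sign_of_pos hy, Real.sign_of_pos (mul_pos hx hy)]
    norm_num

theorem sign_mul_self_of_ne_zero {x : ℝ} (hx : x ≠ 0) : Real.sign x * Real.sign x = 1 := by
  rw [← sign_mul_real, Real.sign_of_pos (mul_self_pos.2 hx)]

theorem tanh_pos_of_pos {x : ℝ} (hx : 0 < x) : 0 < Real.tanh x := by
  rw [Real.tanh_eq_sinh_div_cosh]; exact div_pos (Real.sinh_pos_iff.2 hx) (Real.cosh_pos x)

theorem tanh_neg_of_neg {x : ℝ} (hx : x < 0) : Real.tanh x < 0 := by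
  rw [Real.tanh_eq_sinh_div_cosh]
  exact div_neg_of_neg_of_pos (Real.sinh_neg_iff.2 hx) (Real.cosh_pos x)

theorem sign_tanh_sub_of_lt {a b : ℝ} (h : a < b) : Real.sign (Real.tanh (a - b)) = -1 :=
  Real.sign_of_neg (tanh_neg_of_neg (sub_neg.2 h))

theorem sign_tanh_sub_of_gt {a b : ℝ} (h : b < a) : Real.sign (Real.tanh (a - b)) = 1 :=
  Real.sign_of_pos (tanh_pos_of_pos (sub_pos.2 h))

theorem tanh_ne_zero {x : ℝ} (hx : x ≠ 0) : Real.tanh x ≠ 0 := by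
  rcases lt_or_gt_of_ne hx with h | h
  · exact (tanh_neg_of_neg h).ne
  · exact (tanh_pos_of_pos h).ne'

/-! ### Smoothed correlations as conditioning on two zeros. -/

namespace SechProcess

variable {Ω : Type*} [MeasurableSpace Ω] {P : Measure Ω} [IsProbabilityMeasure P]
  {X : ℝ → Ω → ℝ}

-- In the representation conditioned at `u` itself, the value at `u` is exactly the new standard
-- Gaussian coordinate, which has no atoms.
omit [IsProbabilityMeasure P] in
theorem ae_ne_zero [IsProbabilityMeasure P] (h : SechProcess P X) (u : ℝ) :
    ∀ᵐ ω ∂P, X u ω ≠ 0 := by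
  have h1 := h 1 fun _ => u
  have h2 := (h.prod u) 1 fun _ => u
  have hm := h1.map_eq h2
  have hS : MeasurableSet {y : Fin 1 → ℝ | y 0 = 0} :=
    measurableSet_eq_fun (measurable_pi_apply 0) measurable_const
  have e1 : P {ω | X u ω = 0} = P.map (fun ω (_ : Fin 1) => X u ω) {y | y 0 = 0} := by
    rw [Measure.map_apply h1.meas hS]; rfl
  have e2 : ((gaussianReal 0 1).prod P) {p | p.1 = 0}
      = ((gaussianReal 0 1).prod P).map (fun p (_ : Fin 1) => sech (u - u) * p.1
        + Real.tanh (u - u) * X u p.2) {y | y 0 = 0} := by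
    rw [Measure.map_apply h2.meas hS]; simp [sech_zero]
  have e3 : {p : ℝ × Ω | p.1 = 0} = ({0} : Set ℝ) ×ˢ Set.univ := by ext p; simp
  have : P {ω | X u ω = 0} = 0 := by
    rw [e1, hm, ← e2, e3, Measure.prod_prod]
    have := nullSingletonClass_gaussianReal (μ := 0) (v := 1) one_ne_zero
    simp
  simpa [ae_iff] using this

/-- The pair `(X v₁, X v₂)` becomes an explicit function of two independent variables. -/
theorem integral_smoothDelta_mul (h : SechProcess P X) {R : ℝ → ℝ → ℝ}
    (hR : Measurable fun p : ℝ × ℝ => R p.1 p.2) (N v₁ v₂ a b : ℝ) :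
    ∫ ω, smoothDelta N (X v₁ ω) * smoothDelta N (X v₂ ω) * R (X a ω) (X b ω) ∂P
      = ∫ p, cauchyPair N (sech (v₂ - v₁)) (Real.tanh (v₂ - v₁)) p.1 p.2.1 *
          R (sech (a - v₁) * p.1 + Real.tanh (a - v₁) *
              (sech (a - v₂) * p.2.1 + Real.tanh (a - v₂) * X a p.2.2))
            (sech (b - v₁) * p.1 + Real.tanh (b - v₁) *
              (sech (b - v₂) * p.2.1 + Real.tanh (b - v₂) * X b p.2.2))
        ∂((gaussianReal 0 1).prod ((gaussianReal 0 1).prod P)) := by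
  have h1 := h 4 ![v₁, v₂, a, b]
  -- Since `sech 0 = 1` and `tanh 0 = 0`, the values at `v₁` and `v₂` become `x` and `sech (v₂ - v₁)
  -- x + tanh (v₂ - v₁) y` in the two new variables. This is the pair of directions in `cauchyPair`.
  have h2 := (h.prod v₂).prod v₁ 4 ![v₁, v₂, a, b]
  have hd : ∀ i : Fin 4, Measurable fun y : Fin 4 → ℝ => smoothDelta N (y i) := fun i =>
    (continuous_smoothDelta N).measurable.comp (measurable_pi_apply i)
  have hRc : Measurable fun y : Fin 4 → ℝ => R (y 2) (y 3) := by
    have hp : Measurable fun y : Fin 4 → ℝ => (y 2, y 3) := by fun_prop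
    exact hR.comp hp
  have := h1.integral_comp_eq h2
    (Φ := fun y => smoothDelta N (y 0) * smoothDelta N (y 1) * R (y 2) (y 3))
    (((hd 0).mul (hd 1)).mul hRc)
  simp only [Matrix.cons_val_zero, Matrix.cons_val_one, Matrix.cons_val, sub_self, sech_zero,
    Real.tanh_zero, one_mul, zero_mul, add_zero] at this
  rw [this]
  rfl

/-- Uniform in `N`. The singularity as `v₂` tends to `v₁` is harmless: the derivative of the kernel
supplies a compensating factor `tanh`. -/
theorem abs_integral_smoothDelta_mul_le (h : SechProcess P X) {R : ℝ → ℝ → ℝ} {C : ℝ}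
    (hR : Measurable fun p : ℝ × ℝ => R p.1 p.2) (hRb : ∀ x y, |R x y| ≤ C) {N v₁ v₂ : ℝ}
    (hN : 0 < N) (hv : v₁ ≠ v₂) (a b : ℝ) :
    |∫ ω, smoothDelta N (X v₁ ω) * smoothDelta N (X v₂ ω) * R (X a ω) (X b ω) ∂P|
      ≤ |Real.tanh (v₂ - v₁)|⁻¹ * (Real.pi / 2 * C) := by
  rw [h.integral_smoothDelta_mul hR]
  have ha := h.measurable a
  have hb := h.measurable b
  refine abs_integral_cauchyPair_mul_le
    (Q := fun x y ω => R (sech (a - v₁) * x + Real.tanh (a - v₁) *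
              (sech (a - v₂) * y + Real.tanh (a - v₂) * X a ω))
            (sech (b - v₁) * x + Real.tanh (b - v₁) *
              (sech (b - v₂) * y + Real.tanh (b - v₂) * X b ω))) ?_ (fun x y ω => hRb _ _) hN
    (tanh_ne_zero (sub_ne_zero.2 hv.symm))
  exact hR.comp (Measurable.prodMk (by fun_prop) (by fun_prop))

theorem tendsto_integral_smoothDelta (h : SechProcess P X) {N : ℕ → ℝ} (hN : ∀ n, 0 < N n)
    (hNt : Tendsto N atTop atTop) {v₁ v₂ : ℝ} (hv : v₁ ≠ v₂) :
    Tendsto (fun n => ∫ ω, smoothDelta (N n) (X v₁ ω) * smoothDelta (N n) (X v₂ ω) ∂P) atTop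
      (𝓝 (|Real.tanh (v₂ - v₁)|⁻¹ * (Real.pi / 2))) := by
  have key := fun n => h.integral_smoothDelta_mul (R := fun _ _ => 1) measurable_const (N n) v₁ v₂ 0 0
  simp only [mul_one] at key
  simp_rw [key]
  have := tendsto_integral_cauchyPair_mul (P := P) (Q := fun _ _ _ _ => 1) (q := fun _ => 1) (C := 1)
    (fun n => measurable_const) (fun n x y ω => by simp) hN hNt (c := sech (v₂ - v₁))
    (tanh_ne_zero (sub_ne_zero.2 hv.symm)) (fun x y => ae_of_all _ fun ω => tendsto_const_nhds)
    measurable_const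
  simpa using this

/-- The value at `a` in the representation with base points `v₁` and `v₂`. -/
noncomputable def twoBase (X : ℝ → Ω → ℝ) (v₁ v₂ a x y : ℝ) (ω : Ω) : ℝ :=
  sech (a - v₁) * x + Real.tanh (a - v₁) *
    (sech (a - v₂) * y + Real.tanh (a - v₂) * X a ω)

omit [IsProbabilityMeasure P] in
theorem measurable_twoBase (h : SechProcess P X) (v₁ v₂ a : ℝ) :
    Measurable fun p : ℝ × ℝ × Ω => twoBase X v₁ v₂ a p.1 p.2.1 p.2.2 := by
  have := h.measurable a
  unfold twoBase
  fun_prop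

omit [MeasurableSpace Ω] in
theorem tendsto_smoothSign_twoBase {N : ℕ → ℝ}
    (hN : ∀ n, 0 < N n) (hNt : Tendsto N atTop atTop) {v₁ v₂ a : ℝ} (hv : v₁ ≠ v₂)
    (ha₁ : a ≠ v₁) (ha₂ : a ≠ v₂) {ω : Ω} (hω : X a ω ≠ 0) (x y : ℝ) :
    Tendsto (fun n => smoothSign (N n) (twoBase X v₁ v₂ a (x / N n)
        ((y - sech (v₂ - v₁) * x) / (Real.tanh (v₂ - v₁) * N n)) ω)) atTop
      (𝓝 (Real.pi / 2 * Real.sign (Real.tanh (a - v₁) * Real.tanh (a - v₂) * X a ω))) := by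
  have ht : Real.tanh (v₂ - v₁) ≠ 0 := tanh_ne_zero (sub_ne_zero.2 hv.symm)
  refine tendsto_arctan_of_sign hNt (a := sech (a - v₁) * x + Real.tanh (a - v₁) *
    (sech (a - v₂) * ((y - sech (v₂ - v₁) * x) / Real.tanh (v₂ - v₁))))
    (mul_ne_zero (mul_ne_zero (tanh_ne_zero (sub_ne_zero.2 ha₁))
      (tanh_ne_zero (sub_ne_zero.2 ha₂))) hω) fun n => ?_
  have := (hN n).ne'
  unfold twoBase
  generalize Real.tanh (v₂ - v₁) = t at *
  generalize Real.tanh (a - v₁) = t₁ at *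
  generalize Real.tanh (a - v₂) = t₂ at *
  field_simp
  ring

/-- In the limit the process is conditioned to vanish at `v₁` and `v₂`, so its value at `a` becomes
`tanh (a - v₁) tanh (a - v₂) X a`. The signs of the `tanh` factors leave the expectation, and an
unconditioned two-point correlation remains. -/
theorem tendsto_integral_smoothDelta_mul_smoothSign (h : SechProcess P X) {N : ℕ → ℝ}
    (hN : ∀ n, 0 < N n) (hNt : Tendsto N atTop atTop) {v₁ v₂ a b : ℝ} (hv : v₁ ≠ v₂)
    (ha₁ : a ≠ v₁) (ha₂ : a ≠ v₂) (hb₁ : b ≠ v₁) (hb₂ : b ≠ v₂) :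
    Tendsto (fun n => ∫ ω, smoothDelta (N n) (X v₁ ω) * smoothDelta (N n) (X v₂ ω) *
        (smoothSign (N n) (X a ω) * smoothSign (N n) (X b ω)) ∂P) atTop
      (𝓝 (|Real.tanh (v₂ - v₁)|⁻¹ * (Real.pi / 2) ^ 3 *
        (Real.sign (Real.tanh (a - v₁)) * Real.sign (Real.tanh (a - v₂))
          * (Real.sign (Real.tanh (b - v₁)) * Real.sign (Real.tanh (b - v₂)))
          * ∫ ω, Real.sign (X a ω) * Real.sign (X b ω) ∂P))) := by
  have hmR : ∀ n, Measurable fun p : ℝ × ℝ => smoothSign (N n) p.1 * smoothSign (N n) p.2 :=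
    fun n => ((continuous_smoothSign (N n)).measurable.comp measurable_fst).mul
      ((continuous_smoothSign (N n)).measurable.comp measurable_snd)
  have hma := h.measurable a
  have hmb := h.measurable b
  have ht : Real.tanh (v₂ - v₁) ≠ 0 := tanh_ne_zero (sub_ne_zero.2 hv.symm)
  refine Tendsto.congr (fun n => (h.integral_smoothDelta_mul
    (R := fun x y => smoothSign (N n) x * smoothSign (N n) y) (hmR n) (N n) v₁ v₂ a b).symm) ?_
  have hmQ : ∀ n, Measurable fun p : ℝ × ℝ × Ω =>
      smoothSign (N n) (twoBase X v₁ v₂ a p.1 p.2.1 p.2.2)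
        * smoothSign (N n) (twoBase X v₁ v₂ b p.1 p.2.1 p.2.2) := fun n =>
    ((continuous_smoothSign (N n)).measurable.comp (h.measurable_twoBase v₁ v₂ a)).mul
      ((continuous_smoothSign (N n)).measurable.comp (h.measurable_twoBase v₁ v₂ b))
  have hbQ : ∀ n x y ω, |smoothSign (N n) (twoBase X v₁ v₂ a x y ω)
      * smoothSign (N n) (twoBase X v₁ v₂ b x y ω)| ≤ Real.pi / 2 * (Real.pi / 2) := by
    intro n x y ω
    rw [abs_mul]
    exact mul_le_mul (abs_smoothSign_le _ _) (abs_smoothSign_le _ _) (abs_nonneg _) (by positivity)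
  have hmq : Measurable fun ω =>
      (Real.pi / 2 * Real.sign (Real.tanh (a - v₁) * Real.tanh (a - v₂) * X a ω))
        * (Real.pi / 2 * Real.sign (Real.tanh (b - v₁) * Real.tanh (b - v₂) * X b ω)) :=
    ((measurable_sign_real.comp (hma.const_mul _)).const_mul _).mul
      ((measurable_sign_real.comp (hmb.const_mul _)).const_mul _)
  have hlim : ∀ x y, ∀ᵐ ω ∂P, Tendsto (fun n =>
      smoothSign (N n) (twoBase X v₁ v₂ a (x / N n)
        ((y - sech (v₂ - v₁) * x) / (Real.tanh (v₂ - v₁) * N n)) ω)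
      * smoothSign (N n) (twoBase X v₁ v₂ b (x / N n)
        ((y - sech (v₂ - v₁) * x) / (Real.tanh (v₂ - v₁) * N n)) ω)) atTop
      (𝓝 ((Real.pi / 2 * Real.sign (Real.tanh (a - v₁) * Real.tanh (a - v₂) * X a ω))
        * (Real.pi / 2 * Real.sign (Real.tanh (b - v₁) * Real.tanh (b - v₂) * X b ω)))) := by
    intro x y
    filter_upwards [h.ae_ne_zero a, h.ae_ne_zero b] with ω hωa hωb
    exact (tendsto_smoothSign_twoBase hN hNt hv ha₁ ha₂ hωa x y).mul
      (tendsto_smoothSign_twoBase hN hNt hv hb₁ hb₂ hωb x y)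
  have main := tendsto_integral_cauchyPair_mul hmQ hbQ hN hNt ht hlim hmq
  have e : ∀ ω, (Real.pi / 2 * Real.sign (Real.tanh (a - v₁) * Real.tanh (a - v₂) * X a ω))
      * (Real.pi / 2 * Real.sign (Real.tanh (b - v₁) * Real.tanh (b - v₂) * X b ω))
      = (Real.pi / 2) ^ 2 * (Real.sign (Real.tanh (a - v₁)) * Real.sign (Real.tanh (a - v₂))
        * (Real.sign (Real.tanh (b - v₁)) * Real.sign (Real.tanh (b - v₂)))) *
        (Real.sign (X a ω) * Real.sign (X b ω)) := by
    intro ω; simp only [sign_mul_real]; ring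
  simp_rw [e] at main
  rw [integral_const_mul] at main
  refine main.trans (le_of_eq (congrArg 𝓝 ?_))
  ring

end SechProcess

/-! ### Two- and four-point sign correlations by interpolation in one time. -/

/-- Passage to the limit in the fundamental theorem of calculus by bounded convergence. Only the
open interval is used for the derivatives, because the limit formula fails where the moving time
meets a fixed one. -/
theorem sub_eq_sub_of_tendsto_deriv {κ κ' : ℕ → ℝ → ℝ} {Λ Λ' : ℝ → ℝ} {a b B α β : ℝ}
    (hab : a ≤ b) (hκ : ∀ n v, HasDerivAt (κ n) (κ' n v) v)
    (hb : ∀ n, ∀ v ∈ Set.Ioo a b, |κ' n v| ≤ B)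
    (hlim : ∀ v ∈ Set.Ioo a b, Tendsto (fun n => κ' n v) atTop (𝓝 (Λ' v)))
    (hΛ : ∀ v, HasDerivAt Λ (Λ' v) v) (hα : Tendsto (fun n => κ n a) atTop (𝓝 α))
    (hβ : Tendsto (fun n => κ n b) atTop (𝓝 β)) : β - α = Λ b - Λ a := by
  have hmeas : ∀ n, Measurable (κ' n) := fun n => by
    have : κ' n = deriv (κ n) := by ext v; exact (hκ n v).deriv.symm
    rw [this]; exact measurable_deriv _
  have hmeasΛ : Measurable Λ' := by
    have : Λ' = deriv Λ := by ext v; exact (hΛ v).deriv.symm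
    rw [this]; exact measurable_deriv _
  have hΛb : ∀ v ∈ Set.Ioo a b, |Λ' v| ≤ B := fun v hv =>
    le_of_tendsto (hlim v hv).abs (Eventually.of_forall fun n => hb n v hv)
  have hint : ∀ f : ℝ → ℝ, Measurable f → (∀ v ∈ Set.Ioo a b, |f v| ≤ B) →
      IntervalIntegrable f volume a b := by
    intro f hf hfb
    rw [intervalIntegrable_iff_integrableOn_Ioo_of_le hab]
    exact Measure.integrableOn_of_bounded (M := B) (by simp) hf.aestronglyMeasurable
      ((ae_restrict_iff' measurableSet_Ioo).2 (ae_of_all _ fun v hv => hfb v hv))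
  have e1 : ∀ n, ∫ v in a..b, κ' n v = κ n b - κ n a := fun n =>
    intervalIntegral.integral_eq_sub_of_hasDerivAt (fun v _ => hκ n v) (hint _ (hmeas n) (hb n))
  have e2 : ∫ v in a..b, Λ' v = Λ b - Λ a :=
    intervalIntegral.integral_eq_sub_of_hasDerivAt (fun v _ => hΛ v) (hint _ hmeasΛ hΛb)
  have lim : Tendsto (fun n => ∫ v in a..b, κ' n v) atTop (𝓝 (∫ v in a..b, Λ' v)) := by
    simp_rw [intervalIntegral.integral_of_le hab, integral_Ioc_eq_integral_Ioo]
    refine tendsto_integral_of_dominated_convergence (fun _ => B)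
      (fun n => (hmeas n).aestronglyMeasurable) (integrable_const B)
      (fun n => (ae_restrict_iff' measurableSet_Ioo).2 (ae_of_all _ fun v hv => hb n v hv))
      ((ae_restrict_iff' measurableSet_Ioo).2 (ae_of_all _ fun v hv => hlim v hv))
  rw [e2] at lim
  simp_rw [e1] at lim
  exact tendsto_nhds_unique (hβ.sub hα) lim

theorem hasDerivAt_smoothSign_sum_update {n : ℕ} (N : ℝ) (a z : Fin n → ℝ) (i : Fin n) :
    HasDerivAt (fun x => smoothSign N (∑ j, a j * Function.update z i x j))
      (smoothDelta N (∑ j, a j * z j) * a i) (z i) := by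
  have h1 := hasDerivAt_sum_mul_update a z i
  have h2 := HasDerivAt.comp (z i) (hasDerivAt_smoothSign N _) h1
  refine h2.congr_deriv ?_
  simp only [Function.update_eq_self]

/-- Gaussian expectations differentiated along a curve of unit vectors, for `smoothSign`. -/
theorem hasDerivAt_integral_mul_smoothSign {n : ℕ} {N : ℝ} {G : (Fin (n + 1) → ℝ) → ℝ}
    {g : Fin (n + 1) → (Fin (n + 1) → ℝ) → ℝ} {e e' : ℝ → Fin (n + 1) → ℝ} {C : ℝ}
    (hG : ∀ i z, HasDerivAt (fun x => G (Function.update z i x)) (g i z) (z i))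
    (hGc : Continuous G) (hgc : ∀ i, Continuous (g i)) (hGb : ∀ z, |G z| ≤ C)
    (hgb : ∀ i z, |g i z| ≤ C)
    (he : ∀ i w, HasDerivAt (fun w => e w i) (e' w i) w) (he'c : Continuous e')
    (hunit : ∀ w, ∑ i, e w i * e w i = 1) (w₀ : ℝ) :
    HasDerivAt (fun w => ∫ z, G z * smoothSign N (∑ i, e w i * z i) ∂(stdGaussianPi (n + 1)))
      (∫ z, (∑ i, e' w₀ i * g i z) * smoothDelta N (∑ i, e w₀ i * z i)
        ∂(stdGaussianPi (n + 1))) w₀ := by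
  have hC : 0 ≤ C := (abs_nonneg _).trans (hGb 0)
  have hpi := Real.pi_pos
  have hN := abs_nonneg N
  have hNN := mul_nonneg hN hN
  refine hasDerivAt_integral_mul_comp_inner (C := C + Real.pi / 2 + |N| + |N| * |N|) hG hGc hgc
    (fun z => (hGb z).trans (by linarith)) (fun i z => (hgb i z).trans (by linarith))
    (hasDerivAt_smoothSign N) (hasDerivAt_smoothDelta N) (continuous_deriv_smoothDelta N)
    (fun x => (abs_smoothSign_le N x).trans (by linarith))
    (fun x => (abs_smoothDelta_le N x).trans (by linarith))
    (fun x => (abs_deriv_smoothDelta_le N x).trans (by linarith)) he he'c (fun w => ?_) w₀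
  have h1 : HasDerivAt (fun w => ∑ i, e w i * e w i) (∑ i, (e' w i * e w i + e w i * e' w i)) w :=
    HasDerivAt.fun_sum fun i _ => (he i w).mul (he i w)
  have h2 : HasDerivAt (fun w => ∑ i, e w i * e w i) 0 w := by
    simp_rw [hunit]; exact hasDerivAt_const _ _
  have h3 := h1.unique h2
  have h4 : ∑ i, (e' w i * e w i + e w i * e' w i) = 2 * ∑ i, e w i * e' w i := by
    rw [Finset.mul_sum]; exact Finset.sum_congr rfl fun i _ => by ring
  linarith

/-- Converts the velocity of the curve of vectors into the derivative of the covariance with a fixed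
time. -/
theorem sum_deriv_mul_eq {n : ℕ} {e e' : ℝ → Fin n → ℝ}
    (he : ∀ i w, HasDerivAt (fun w => e w i) (e' w i) w) {u : ℝ}
    (hu : ∀ w, ∑ i, e w i * e u i = sech (w - u)) (w : ℝ) :
    ∑ i, e' w i * e u i = -(sech (w - u) * Real.tanh (w - u)) := by
  have h1 : HasDerivAt (fun w => ∑ i, e w i * e u i) (∑ i, e' w i * e u i) w :=
    HasDerivAt.fun_sum fun i _ => (he i w).mul_const _
  have h2 : HasDerivAt (fun w => ∑ i, e w i * e u i) (-(sech (w - u) * Real.tanh (w - u))) w := by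
    simp_rw [hu]
    have := (hasDerivAt_sech (w - u)).comp w ((hasDerivAt_id w).sub_const u)
    refine this.congr_deriv ?_
    simp
  exact h1.unique h2

theorem tendsto_smoothSign {N : ℕ → ℝ} (hNt : Tendsto N atTop atTop) {x : ℝ} (hx : x ≠ 0) :
    Tendsto (fun n => smoothSign (N n) x) atTop (𝓝 (Real.pi / 2 * Real.sign x)) :=
  tendsto_arctan_of_sign hNt (a := 0) hx fun n => by simp

/-- Coordinates of the process with respect to two base vectors. -/
noncomputable def sechCurveTwo (u w : ℝ) : Fin 2 → ℝ := ![sech (w - u), Real.tanh (w - u)]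

/-- Coordinates of the process with respect to four base vectors. -/
noncomputable def sechCurveFour (u₁ u₂ u₃ w : ℝ) : Fin 4 → ℝ :=
  ![sech (w - u₁), Real.tanh (w - u₁) * sech (w - u₂),
    Real.tanh (w - u₁) * Real.tanh (w - u₂) * sech (w - u₃),
    Real.tanh (w - u₁) * Real.tanh (w - u₂) * Real.tanh (w - u₃)]

theorem contDiff_sechCurveTwo (u : ℝ) (i : Fin 2) :
    ContDiff ℝ 1 fun w => sechCurveTwo u w i := by
  have h1 : ContDiff ℝ 1 fun w => sech (w - u) := contDiff_sech.comp (contDiff_id.sub contDiff_const)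
  have h2 : ContDiff ℝ 1 fun w => Real.tanh (w - u) :=
    contDiff_tanh_one.comp (contDiff_id.sub contDiff_const)
  fin_cases i
  · exact h1
  · exact h2

theorem contDiff_sechCurveFour (u₁ u₂ u₃ : ℝ) (i : Fin 4) :
    ContDiff ℝ 1 fun w => sechCurveFour u₁ u₂ u₃ w i := by
  have h1 : ∀ u, ContDiff ℝ 1 fun w => sech (w - u) := fun u =>
    contDiff_sech.comp (contDiff_id.sub contDiff_const)
  have h2 : ∀ u, ContDiff ℝ 1 fun w => Real.tanh (w - u) := fun u =>
    contDiff_tanh_one.comp (contDiff_id.sub contDiff_const)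
  fin_cases i
  · exact h1 u₁
  · exact (h2 u₁).mul (h1 u₂)
  · exact ((h2 u₁).mul (h2 u₂)).mul (h1 u₃)
  · exact ((h2 u₁).mul (h2 u₂)).mul (h2 u₃)

/-- The curve uses one common residual vector for all times, so its Gram matrix differs from the
kernel by `tanh (a - u) tanh (b - u) (1 - sech (a - b))`. This vanishes in the listed cases, which
are all that one moving time and fixed base times require. -/
theorem sum_sechCurveTwo {u a b : ℝ} (h : a = u ∨ b = u ∨ a = b) :
    ∑ i, sechCurveTwo u a i * sechCurveTwo u b i = sech (a - b) := by
  have h1 := sech_mul_add_tanh_mul a b u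
  have h0 : Real.tanh (a - u) * Real.tanh (b - u) * (1 - sech (a - b)) = 0 := by
    rcases h with h | h | h <;> simp [h, sech_zero]
  simp only [sechCurveTwo, Fin.sum_univ_two, Matrix.cons_val_zero, Matrix.cons_val_one]
  linarith

/-- Three successive conditionings, at `u₁`, `u₂` and `u₃`; the defect now carries all six `tanh`
factors. -/
theorem sum_sechCurveFour {u₁ u₂ u₃ a b : ℝ}
    (h : a = u₁ ∨ a = u₂ ∨ a = u₃ ∨ b = u₁ ∨ b = u₂ ∨ b = u₃ ∨ a = b) :
    ∑ i, sechCurveFour u₁ u₂ u₃ a i * sechCurveFour u₁ u₂ u₃ b i = sech (a - b) := by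
  have h1 := sech_mul_add_tanh_mul a b u₁
  have h2 := sech_mul_add_tanh_mul a b u₂
  have h3 := sech_mul_add_tanh_mul a b u₃
  have h0 : Real.tanh (a - u₁) * Real.tanh (a - u₂) * Real.tanh (a - u₃) *
      (Real.tanh (b - u₁) * Real.tanh (b - u₂) * Real.tanh (b - u₃)) * (1 - sech (a - b)) = 0 := by
    rcases h with h | h | h | h | h | h | h <;> simp [h, sech_zero]
  simp only [sechCurveFour, Fin.sum_univ_four, Matrix.cons_val_zero, Matrix.cons_val_one,
    Matrix.cons_val]
  linear_combination h0 + h1 + Real.tanh (a - u₁) * Real.tanh (b - u₁) * h2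
    + Real.tanh (a - u₁) * Real.tanh (b - u₁) * Real.tanh (a - u₂) * Real.tanh (b - u₂) * h3

theorem gaussVec_sechCurveTwo (u w : ℝ) :
    GaussVec (stdGaussianPi 2) (fun z j => ∑ i, sechCurveTwo u (![u, w] j) i * z i)
      (fun i j => sech (![u, w] i - ![u, w] j)) := by
  have := GaussVec.pi_gaussian (fun j : Fin 2 => sechCurveTwo u (![u, w] j))
  convert this using 3 with i j
  rw [sum_sechCurveTwo]
  fin_cases i <;> fin_cases j <;> simp

theorem gaussVec_sechCurveFour (u₁ u₂ u₃ w : ℝ) :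
    GaussVec (stdGaussianPi 4)
      (fun z j => ∑ i, sechCurveFour u₁ u₂ u₃ (![u₁, u₂, u₃, w] j) i * z i)
      (fun i j => sech (![u₁, u₂, u₃, w] i - ![u₁, u₂, u₃, w] j)) := by
  have := GaussVec.pi_gaussian (fun j : Fin 4 => sechCurveFour u₁ u₂ u₃ (![u₁, u₂, u₃, w] j))
  convert this using 3 with i j
  rw [sum_sechCurveFour]
  fin_cases i <;> fin_cases j <;> simp

namespace SechProcess

variable {Ω : Type*} [MeasurableSpace Ω] {P : Measure Ω} [IsProbabilityMeasure P]
  {X : ℝ → Ω → ℝ}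

/-- Plackett's identity: the derivative of the covariance times the expectation of the product of
derivatives. The variances are constant and contribute nothing. -/
theorem hasDerivAt_integral_smoothSign_two (h : SechProcess P X) (N u w : ℝ) :
    HasDerivAt (fun w => ∫ ω, smoothSign N (X u ω) * smoothSign N (X w ω) ∂P)
      (-(sech (w - u) * Real.tanh (w - u)) *
        ∫ ω, smoothDelta N (X u ω) * smoothDelta N (X w ω) ∂P) w := by
  have hs := continuous_smoothSign N
  have hd := continuous_smoothDelta N
  have tr : ∀ (Φ : (Fin 2 → ℝ) → ℝ), Continuous Φ → ∀ w,
      ∫ ω, Φ (fun j => X (![u, w] j) ω) ∂P = ∫ z, Φ (fun j =>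
        ∑ i, sechCurveTwo u (![u, w] j) i * z i) ∂(stdGaussianPi 2) := fun Φ hΦ w =>
    (h 2 ![u, w]).integral_comp_eq (gaussVec_sechCurveTwo u w) hΦ.measurable
  have t1 := tr (fun y => smoothSign N (y 0) * smoothSign N (y 1)) (by fun_prop)
  have t2 := tr (fun y => smoothDelta N (y 0) * smoothDelta N (y 1)) (by fun_prop) w
  simp only [Matrix.cons_val_zero, Matrix.cons_val_one] at t1 t2
  simp_rw [t1]
  rw [t2]
  have he : ∀ i w, HasDerivAt (fun w => sechCurveTwo u w i)
      (deriv (fun w => sechCurveTwo u w i) w) w := fun i w =>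
    ((contDiff_sechCurveTwo u i).differentiable one_ne_zero w).hasDerivAt
  have hlin : Continuous fun z : Fin 2 → ℝ => ∑ i, sechCurveTwo u u i * z i := by fun_prop
  have main := hasDerivAt_integral_mul_smoothSign (n := 1) (N := N)
    (G := fun z => smoothSign N (∑ i, sechCurveTwo u u i * z i))
    (g := fun i z => smoothDelta N (∑ j, sechCurveTwo u u j * z j) * sechCurveTwo u u i)
    (e := sechCurveTwo u) (e' := fun w i => deriv (fun w => sechCurveTwo u w i) w)
    (C := Real.pi / 2 + |N| * ∑ i, |sechCurveTwo u u i|)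
    (fun i z => hasDerivAt_smoothSign_sum_update N _ z i)
    (hs.comp hlin) (fun i => (hd.comp hlin).mul_const _)
    (fun z => (abs_smoothSign_le _ _).trans (le_add_of_nonneg_right (by positivity)))
    (fun i z => by
      rw [abs_mul]
      have h1 := abs_smoothDelta_le N (∑ j, sechCurveTwo u u j * z j)
      have h2 := Finset.single_le_sum (f := fun i => |sechCurveTwo u u i|)
        (fun i _ => abs_nonneg _) (Finset.mem_univ i)
      have h3 := mul_le_mul h1 h2 (abs_nonneg _) (abs_nonneg N)
      have := Real.pi_pos
      linarith)
    he (continuous_pi fun i => (contDiff_sechCurveTwo u i).continuous_deriv le_rfl)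
    (fun w => by rw [sum_sechCurveTwo (Or.inr (Or.inr rfl)), sub_self, sech_zero]) w
  refine main.congr_deriv ?_
  rw [← integral_const_mul]
  refine integral_congr_ae (ae_of_all _ fun z => ?_)
  simp only
  rw [← sum_deriv_mul_eq he (fun w => sum_sechCurveTwo (Or.inr (Or.inl rfl))) w, Finset.sum_mul,
    Finset.sum_mul]
  refine Finset.sum_congr rfl fun i _ => by ring

theorem tendsto_integral_smoothSign_two (h : SechProcess P X) {N : ℕ → ℝ}
    (hNt : Tendsto N atTop atTop) (u w : ℝ) :
    Tendsto (fun n => ∫ ω, smoothSign (N n) (X u ω) * smoothSign (N n) (X w ω) ∂P) atTop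
      (𝓝 ((Real.pi / 2) ^ 2 * ∫ ω, Real.sign (X u ω) * Real.sign (X w ω) ∂P)) := by
  rw [← integral_const_mul]
  have hs := fun n a => (continuous_smoothSign (N n)).measurable.comp (h.measurable a)
  refine tendsto_integral_of_dominated_convergence (fun _ => Real.pi / 2 * (Real.pi / 2))
    (fun n => ((hs n u).mul (hs n w)).aestronglyMeasurable) (integrable_const _)
    (fun n => ae_of_all _ fun ω => ?_) ?_
  · rw [Real.norm_eq_abs, abs_mul]
    exact mul_le_mul (abs_smoothSign_le _ _) (abs_smoothSign_le _ _) (abs_nonneg _) (by positivity)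
  · filter_upwards [h.ae_ne_zero u, h.ae_ne_zero w] with ω h1 h2
    have := (tendsto_smoothSign hNt h1).mul (tendsto_smoothSign hNt h2)
    refine this.trans (le_of_eq (congrArg 𝓝 ?_))
    ring

theorem integral_sign_mul_sign_self (h : SechProcess P X) (u : ℝ) :
    ∫ ω, Real.sign (X u ω) * Real.sign (X u ω) ∂P = 1 := by
  have : (fun ω => Real.sign (X u ω) * Real.sign (X u ω)) =ᵐ[P] fun _ => 1 := by
    filter_upwards [h.ae_ne_zero u] with ω hω using sign_mul_self_of_ne_zero hω
  rw [integral_congr_ae this]; simp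

/-- The two-point sign correlation. -/
theorem integral_sign_two (h : SechProcess P X) {u w : ℝ} (huw : u ≤ w) :
    ∫ ω, Real.sign (X u ω) * Real.sign (X w ω) ∂P = 2 / Real.pi * sechAngle (w - u) := by
  have hN : ∀ n : ℕ, (0 : ℝ) < n + 1 := fun n => by positivity
  have hNt : Tendsto (fun n : ℕ => (n : ℝ) + 1) atTop atTop :=
    tendsto_atTop_add_const_right _ _ tendsto_natCast_atTop_atTop
  have hpi := Real.pi_pos
  -- Integration starts at `v = u`, where the correlation is `1` and the angle is `π / 2`.
  have key := sub_eq_sub_of_tendsto_deriv (B := Real.pi / 2)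
    (Λ := fun v => Real.pi / 2 * sechAngle (v - u)) (Λ' := fun v => Real.pi / 2 * -sech (v - u)) huw
    (fun n v => h.hasDerivAt_integral_smoothSign_two (n + 1 : ℝ) u v) (fun n v hv => ?_)
    (fun v hv => ?_) (fun v => ?_) (h.tendsto_integral_smoothSign_two hNt u u)
    (h.tendsto_integral_smoothSign_two hNt u w)
  · rw [h.integral_sign_mul_sign_self] at key
    simp only [sub_self, sechAngle_zero] at key
    field_simp at key ⊢
    linarith
  · have ht := tanh_pos_of_pos (sub_pos.2 hv.1)
    have h1 := h.abs_integral_smoothDelta_mul_le (R := fun _ _ => 1) (C := 1) measurable_const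
      (fun _ _ => by simp) (hN n) hv.1.ne 0 0
    simp only [mul_one] at h1
    rw [abs_mul, abs_neg, abs_mul, abs_of_pos (sech_pos _)]
    calc _ ≤ sech (v - u) * |Real.tanh (v - u)| * (|Real.tanh (v - u)|⁻¹ * (Real.pi / 2)) := by
          have := (sech_pos (v - u)).le
          gcongr
      _ = sech (v - u) * (Real.pi / 2) := by
          have := (abs_pos.2 ht.ne').ne'
          field_simp
      _ ≤ Real.pi / 2 := mul_le_of_le_one_left (by positivity) (sech_le_one _)
  · have ht := tanh_pos_of_pos (sub_pos.2 hv.1)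
    have := (h.tendsto_integral_smoothDelta hN hNt hv.1.ne).const_mul
      (-(sech (v - u) * Real.tanh (v - u)))
    refine this.trans (le_of_eq (congrArg 𝓝 ?_))
    rw [abs_of_pos ht]
    field_simp
  · have := ((hasDerivAt_sechAngle (v - u)).comp v ((hasDerivAt_id v).sub_const u)).const_mul
      (Real.pi / 2)
    refine this.congr_deriv ?_
    simp

end SechProcess

namespace SechProcess

variable {Ω : Type*} [MeasurableSpace Ω] {P : Measure Ω} [IsProbabilityMeasure P]
  {X : ℝ → Ω → ℝ}

theorem integrable_smoothDelta_mul_smoothSign (h : SechProcess P X) (N a b c d : ℝ) :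
    Integrable (fun ω => smoothDelta N (X a ω) * smoothDelta N (X b ω) *
      (smoothSign N (X c ω) * smoothSign N (X d ω))) P := by
  have hs := fun a => (continuous_smoothSign N).measurable.comp (h.measurable a)
  have hd := fun a => (continuous_smoothDelta N).measurable.comp (h.measurable a)
  refine Integrable.of_bound (((hd a).mul (hd b)).mul ((hs c).mul (hs d))).aestronglyMeasurable
    (|N| * |N| * (Real.pi / 2 * (Real.pi / 2))) (ae_of_all _ fun ω => ?_)
  rw [Real.norm_eq_abs, abs_mul, abs_mul, abs_mul]
  exact mul_le_mul (mul_le_mul (abs_smoothDelta_le _ _) (abs_smoothDelta_le _ _) (abs_nonneg _)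
    (abs_nonneg _)) (mul_le_mul (abs_smoothSign_le _ _) (abs_smoothSign_le _ _) (abs_nonneg _)
    (by positivity)) (by positivity) (by positivity)

/-- Plackett's identity with only `w` moving: one term for each fixed time that it is paired with.
-/
theorem hasDerivAt_integral_smoothSign_four (h : SechProcess P X) (N u₁ u₂ u₃ w : ℝ) :
    HasDerivAt (fun w => ∫ ω, smoothSign N (X u₁ ω) * smoothSign N (X u₂ ω) *
        smoothSign N (X u₃ ω) * smoothSign N (X w ω) ∂P)
      (-(sech (w - u₁) * Real.tanh (w - u₁)) *
        (∫ ω, smoothDelta N (X u₁ ω) * smoothDelta N (X w ω) *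
          (smoothSign N (X u₂ ω) * smoothSign N (X u₃ ω)) ∂P)
      + -(sech (w - u₂) * Real.tanh (w - u₂)) *
        (∫ ω, smoothDelta N (X u₂ ω) * smoothDelta N (X w ω) *
          (smoothSign N (X u₁ ω) * smoothSign N (X u₃ ω)) ∂P)
      + -(sech (w - u₃) * Real.tanh (w - u₃)) *
        (∫ ω, smoothDelta N (X u₃ ω) * smoothDelta N (X w ω) *
          (smoothSign N (X u₁ ω) * smoothSign N (X u₂ ω)) ∂P)) w := by
  have hs := continuous_smoothSign N
  have hd := continuous_smoothDelta N
  have i₁ := (h.integrable_smoothDelta_mul_smoothSign N u₁ w u₂ u₃).const_mul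
    (-(sech (w - u₁) * Real.tanh (w - u₁)))
  have i₂ := (h.integrable_smoothDelta_mul_smoothSign N u₂ w u₁ u₃).const_mul
    (-(sech (w - u₂) * Real.tanh (w - u₂)))
  have i₃ := (h.integrable_smoothDelta_mul_smoothSign N u₃ w u₁ u₂).const_mul
    (-(sech (w - u₃) * Real.tanh (w - u₃)))
  have i₁₂ := integral_add i₁ i₂
  have i₁₂₃ := integral_add (i₁.add i₂) i₃
  simp only [Pi.add_apply] at i₁₂ i₁₂₃
  rw [← integral_const_mul, ← integral_const_mul, ← integral_const_mul, ← i₁₂, ← i₁₂₃]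
  set e := sechCurveFour u₁ u₂ u₃ with hedef
  have tr : ∀ (Φ : (Fin 4 → ℝ) → ℝ), Continuous Φ → ∀ w,
      ∫ ω, Φ (fun j => X (![u₁, u₂, u₃, w] j) ω) ∂P = ∫ z, Φ (fun j =>
        ∑ i, e (![u₁, u₂, u₃, w] j) i * z i) ∂(stdGaussianPi 4) := fun Φ hΦ w =>
    (h 4 ![u₁, u₂, u₃, w]).integral_comp_eq (gaussVec_sechCurveFour u₁ u₂ u₃ w) hΦ.measurable
  have t1 := tr (fun y => smoothSign N (y 0) * smoothSign N (y 1) * smoothSign N (y 2)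
    * smoothSign N (y 3)) (by fun_prop)
  have t2 := tr (fun y =>
    -(sech (w - u₁) * Real.tanh (w - u₁)) * (smoothDelta N (y 0) * smoothDelta N (y 3) *
          (smoothSign N (y 1) * smoothSign N (y 2)))
    + -(sech (w - u₂) * Real.tanh (w - u₂)) * (smoothDelta N (y 1) * smoothDelta N (y 3) *
          (smoothSign N (y 0) * smoothSign N (y 2)))
    + -(sech (w - u₃) * Real.tanh (w - u₃)) * (smoothDelta N (y 2) * smoothDelta N (y 3) *
          (smoothSign N (y 0) * smoothSign N (y 1)))) (by fun_prop) w
  simp only [Matrix.cons_val_zero, Matrix.cons_val_one, Matrix.cons_val] at t1 t2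
  simp_rw [t1]
  rw [t2]
  have he : ∀ i w, HasDerivAt (fun w => e w i) (deriv (fun w => e w i) w) w := fun i w =>
    ((contDiff_sechCurveFour u₁ u₂ u₃ i).differentiable one_ne_zero w).hasDerivAt
  have hlin : ∀ u, Continuous fun z : Fin 4 → ℝ => ∑ i, e u i * z i := fun u => by fun_prop
  set S := fun (u : ℝ) (z : Fin 4 → ℝ) => smoothSign N (∑ i, e u i * z i) with hS
  set D := fun (u : ℝ) (z : Fin 4 → ℝ) => smoothDelta N (∑ i, e u i * z i) with hD
  have hSc : ∀ u, Continuous (S u) := fun u => hs.comp (hlin u)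
  have hDc : ∀ u, Continuous (D u) := fun u => hd.comp (hlin u)
  have hSb : ∀ u z, |S u z| ≤ Real.pi / 2 := fun u z => abs_smoothSign_le _ _
  have hDb : ∀ u z, |D u z| ≤ |N| := fun u z => abs_smoothDelta_le _ _
  have hSd : ∀ u i z, HasDerivAt (fun x => S u (Function.update z i x)) (D u z * e u i) (z i) :=
    fun u i z => hasDerivAt_smoothSign_sum_update N (e u) z i
  have hpi := Real.pi_pos
  have hterm : ∀ u a b i z, |D u z * e u i * (S a z * S b z)|
      ≤ |N| * (∑ i, |e u i|) * (Real.pi / 2 * (Real.pi / 2)) := by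
    intro u a b i z
    have h2 := Finset.single_le_sum (f := fun i => |e u i|)
        (fun i _ => abs_nonneg _) (Finset.mem_univ i)
    rw [abs_mul, abs_mul, abs_mul]
    have := hDb u z
    have := hSb a z
    have := hSb b z
    gcongr
  have main := hasDerivAt_integral_mul_smoothSign (n := 3) (N := N)
    (G := fun z => S u₁ z * S u₂ z * S u₃ z)
    (g := fun i z => D u₁ z * e u₁ i * (S u₂ z * S u₃ z) + D u₂ z * e u₂ i * (S u₁ z * S u₃ z)
      + D u₃ z * e u₃ i * (S u₁ z * S u₂ z))
    (e := e) (e' := fun w i => deriv (fun w => e w i) w)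
    (C := Real.pi / 2 * (Real.pi / 2) * (Real.pi / 2)
      + |N| * (∑ i, |e u₁ i|) * (Real.pi / 2 * (Real.pi / 2))
      + |N| * (∑ i, |e u₂ i|) * (Real.pi / 2 * (Real.pi / 2))
      + |N| * (∑ i, |e u₃ i|) * (Real.pi / 2 * (Real.pi / 2)))
    (fun i z => by
      refine (((hSd u₁ i z).mul (hSd u₂ i z)).mul (hSd u₃ i z)).congr_deriv ?_
      simp only [Function.update_eq_self, Pi.mul_apply]
      ring)
    (((hSc u₁).mul (hSc u₂)).mul (hSc u₃)) (fun i => by fun_prop)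
    (fun z => by
      have : |S u₁ z * S u₂ z * S u₃ z| ≤ Real.pi / 2 * (Real.pi / 2) * (Real.pi / 2) := by
        rw [abs_mul, abs_mul]
        have := hSb u₁ z
        have := hSb u₂ z
        have := hSb u₃ z
        gcongr
      refine this.trans ?_
      rw [add_assoc, add_assoc]
      exact le_add_of_nonneg_right (by positivity))
    (fun i z => by
      have h1 := hterm u₁ u₂ u₃ i z
      have h2 := hterm u₂ u₁ u₃ i z
      have h3 := hterm u₃ u₁ u₂ i z
      have h4 : 0 ≤ Real.pi / 2 * (Real.pi / 2) * (Real.pi / 2) := by positivity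
      refine (abs_add_three _ _ _).trans ?_
      linarith)
    he (continuous_pi fun i => (contDiff_sechCurveFour u₁ u₂ u₃ i).continuous_deriv le_rfl)
    (fun w => by rw [hedef, sum_sechCurveFour (by simp), sub_self, sech_zero]) w
  refine main.congr_deriv (integral_congr_ae (ae_of_all _ fun z => ?_))
  have k₁ := sum_deriv_mul_eq (u := u₁) he (fun w => sum_sechCurveFour (by simp)) w
  have k₂ := sum_deriv_mul_eq (u := u₂) he (fun w => sum_sechCurveFour (by simp)) w
  have k₃ := sum_deriv_mul_eq (u := u₃) he (fun w => sum_sechCurveFour (by simp)) w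
  change (∑ i, deriv (fun w => e w i) w * (D u₁ z * e u₁ i * (S u₂ z * S u₃ z)
    + D u₂ z * e u₂ i * (S u₁ z * S u₃ z) + D u₃ z * e u₃ i * (S u₁ z * S u₂ z))) * D w z
    = -(sech (w - u₁) * Real.tanh (w - u₁)) * (D u₁ z * D w z * (S u₂ z * S u₃ z))
    + -(sech (w - u₂) * Real.tanh (w - u₂)) * (D u₂ z * D w z * (S u₁ z * S u₃ z))
    + -(sech (w - u₃) * Real.tanh (w - u₃)) * (D u₃ z * D w z * (S u₁ z * S u₂ z))
  rw [← k₁, ← k₂, ← k₃]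
  simp only [Finset.sum_mul]
  rw [← Finset.sum_add_distrib, ← Finset.sum_add_distrib]
  exact Finset.sum_congr rfl fun i _ => by ring

theorem tendsto_integral_smoothSign_four (h : SechProcess P X) {N : ℕ → ℝ}
    (hNt : Tendsto N atTop atTop) (u₁ u₂ u₃ w : ℝ) :
    Tendsto (fun n => ∫ ω, smoothSign (N n) (X u₁ ω) * smoothSign (N n) (X u₂ ω) *
        smoothSign (N n) (X u₃ ω) * smoothSign (N n) (X w ω) ∂P) atTop
      (𝓝 ((Real.pi / 2) ^ 4 * ∫ ω, Real.sign (X u₁ ω) * Real.sign (X u₂ ω) *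
        Real.sign (X u₃ ω) * Real.sign (X w ω) ∂P)) := by
  rw [← integral_const_mul]
  have hs := fun n a => (continuous_smoothSign (N n)).measurable.comp (h.measurable a)
  have hpi := Real.pi_pos
  refine tendsto_integral_of_dominated_convergence
    (fun _ => Real.pi / 2 * (Real.pi / 2) * (Real.pi / 2) * (Real.pi / 2))
    (fun n => ((((hs n u₁).mul (hs n u₂)).mul (hs n u₃)).mul (hs n w)).aestronglyMeasurable)
    (integrable_const _) (fun n => ae_of_all _ fun ω => ?_) ?_
  · have h1 := abs_smoothSign_le (N n)
    rw [Real.norm_eq_abs, abs_mul, abs_mul, abs_mul]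
    gcongr <;> exact h1 _
  · filter_upwards [h.ae_ne_zero u₁, h.ae_ne_zero u₂, h.ae_ne_zero u₃, h.ae_ne_zero w]
      with ω h1 h2 h3 h4
    have := (((tendsto_smoothSign hNt h1).mul (tendsto_smoothSign hNt h2)).mul
      (tendsto_smoothSign hNt h3)).mul (tendsto_smoothSign hNt h4)
    refine this.trans (le_of_eq (congrArg 𝓝 ?_))
    ring

theorem integral_sign_mul_sign_mul_self (h : SechProcess P X) (u₁ u₂ u₃ : ℝ) :
    ∫ ω, Real.sign (X u₁ ω) * Real.sign (X u₂ ω) * Real.sign (X u₃ ω) * Real.sign (X u₃ ω) ∂P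
      = ∫ ω, Real.sign (X u₁ ω) * Real.sign (X u₂ ω) ∂P := by
  refine integral_congr_ae ?_
  filter_upwards [h.ae_ne_zero u₃] with ω hω
  rw [mul_assoc, sign_mul_self_of_ne_zero hω, mul_one]

/-- The four-point sign correlation is a Pfaffian of two-point functions. -/
theorem integral_sign_four (h : SechProcess P X) {u₁ u₂ u₃ w : ℝ} (h₁₂ : u₁ < u₂) (h₂₃ : u₂ < u₃)
    (h₃ : u₃ ≤ w) :
    ∫ ω, Real.sign (X u₁ ω) * Real.sign (X u₂ ω) * Real.sign (X u₃ ω) * Real.sign (X w ω) ∂P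
      = (2 / Real.pi) ^ 2 * (sechAngle (u₂ - u₁) * sechAngle (w - u₃)
        - sechAngle (u₃ - u₁) * sechAngle (w - u₂)
        + sechAngle (w - u₁) * sechAngle (u₃ - u₂)) := by
  have hN : ∀ n : ℕ, (0 : ℝ) < n + 1 := fun n => by positivity
  have hNt : Tendsto (fun n : ℕ => (n : ℝ) + 1) atTop atTop :=
    tendsto_atTop_add_const_right _ _ tendsto_natCast_atTop_atTop
  have hpi := Real.pi_pos
  have h₁₃ := h₁₂.trans h₂₃
  set A₁₂ := sechAngle (u₂ - u₁) with hA₁₂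
  set A₁₃ := sechAngle (u₃ - u₁) with hA₁₃
  set A₂₃ := sechAngle (u₃ - u₂) with hA₂₃
  have i₁₂ := h.integral_sign_two h₁₂.le
  have i₁₃ := h.integral_sign_two h₁₃.le
  have i₂₃ := h.integral_sign_two h₂₃.le
  have hbound : ∀ (u a b v : ℝ) (n : ℕ), u < v →
      |-(sech (v - u) * Real.tanh (v - u)) * ∫ ω, smoothDelta (n + 1 : ℝ) (X u ω) *
        smoothDelta (n + 1 : ℝ) (X v ω) * (smoothSign (n + 1 : ℝ) (X a ω) *
          smoothSign (n + 1 : ℝ) (X b ω)) ∂P| ≤ (Real.pi / 2) ^ 3 := by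
    intro u a b v n hv
    have ht := tanh_pos_of_pos (sub_pos.2 hv)
    have hs := (continuous_smoothSign (n + 1 : ℝ)).measurable
    have h1 := h.abs_integral_smoothDelta_mul_le
      (R := fun x y => smoothSign (n + 1 : ℝ) x * smoothSign (n + 1 : ℝ) y)
      (C := Real.pi / 2 * (Real.pi / 2)) ((hs.comp measurable_fst).mul (hs.comp measurable_snd))
      (fun x y => by
        rw [abs_mul]
        exact mul_le_mul (abs_smoothSign_le _ _) (abs_smoothSign_le _ _) (abs_nonneg _)
          (by positivity)) (hN n) hv.ne a b
    rw [abs_mul, abs_neg, abs_mul, abs_of_pos (sech_pos _), abs_of_pos ht]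
    rw [abs_of_pos ht] at h1
    calc _ ≤ sech (v - u) * Real.tanh (v - u) *
          ((Real.tanh (v - u))⁻¹ * (Real.pi / 2 * (Real.pi / 2 * (Real.pi / 2)))) := by
          have := (sech_pos (v - u)).le
          gcongr
      _ = sech (v - u) * (Real.pi / 2) ^ 3 := by field_simp
      _ ≤ (Real.pi / 2) ^ 3 := mul_le_of_le_one_left (by positivity) (sech_le_one _)
  -- The zero at `v` flips both remaining signs, as `a` and `b` lie to its left, so its effect
  -- cancels. The zero at `u` leaves `σ`, which is `-1` exactly when `u` separates `a` from `b`;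
  -- this yields the alternating signs of the Pfaffian.
  have hlimit : ∀ (u a b v A σ : ℝ), u < v → a ≠ u → b ≠ u → a < v → b < v →
      ∫ ω, Real.sign (X a ω) * Real.sign (X b ω) ∂P = 2 / Real.pi * A →
      Real.sign (Real.tanh (a - u)) * Real.sign (Real.tanh (b - u)) = σ →
      Tendsto (fun n : ℕ => -(sech (v - u) * Real.tanh (v - u)) *
        ∫ ω, smoothDelta (n + 1 : ℝ) (X u ω) *
        smoothDelta (n + 1 : ℝ) (X v ω) * (smoothSign (n + 1 : ℝ) (X a ω) *
          smoothSign (n + 1 : ℝ) (X b ω)) ∂P) atTop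
        (𝓝 ((Real.pi / 2) ^ 2 * (σ * (-sech (v - u) * A)))) := by
    intro u a b v A σ hu hau hbu hav hbv hab hσ
    have ht := tanh_pos_of_pos (sub_pos.2 hu)
    have := (h.tendsto_integral_smoothDelta_mul_smoothSign hN hNt hu.ne hau hav.ne hbu
      hbv.ne).const_mul (-(sech (v - u) * Real.tanh (v - u)))
    refine this.trans (le_of_eq (congrArg 𝓝 ?_))
    rw [hab, sign_tanh_sub_of_lt hav, sign_tanh_sub_of_lt hbv, abs_of_pos ht, ← hσ]
    field_simp
  -- The constant of integration is fixed at `v = u₃`, where the four-point function collapses to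
  -- the correlation at `u₁` and `u₂`.
  have key := sub_eq_sub_of_tendsto_deriv
    (B := (Real.pi / 2) ^ 3 + (Real.pi / 2) ^ 3 + (Real.pi / 2) ^ 3)
    (Λ := fun v => (Real.pi / 2) ^ 2 * (1 * (sechAngle (v - u₁) * A₂₃))
      + (Real.pi / 2) ^ 2 * (-1 * (sechAngle (v - u₂) * A₁₃))
      + (Real.pi / 2) ^ 2 * (1 * (sechAngle (v - u₃) * A₁₂))) h₃
    (fun n v => h.hasDerivAt_integral_smoothSign_four (n + 1 : ℝ) u₁ u₂ u₃ v)
    (fun n v hv => (abs_add_three _ _ _).trans (add_le_add (add_le_add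
      (hbound u₁ u₂ u₃ v n (h₁₃.trans hv.1)) (hbound u₂ u₁ u₃ v n (h₂₃.trans hv.1)))
      (hbound u₃ u₁ u₂ v n hv.1)))
    (fun v hv => ((hlimit u₁ u₂ u₃ v A₂₃ 1 (h₁₃.trans hv.1) h₁₂.ne' h₁₃.ne' (h₂₃.trans hv.1) hv.1
        i₂₃ (by rw [sign_tanh_sub_of_gt h₁₂, sign_tanh_sub_of_gt h₁₃, one_mul])).add
      (hlimit u₂ u₁ u₃ v A₁₃ (-1) (h₂₃.trans hv.1) h₁₂.ne h₂₃.ne' (h₁₃.trans hv.1) hv.1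
        i₁₃ (by rw [sign_tanh_sub_of_lt h₁₂, sign_tanh_sub_of_gt h₂₃, mul_one]))).add
      (hlimit u₃ u₁ u₂ v A₁₂ 1 hv.1 h₁₃.ne h₂₃.ne (h₁₃.trans hv.1) (h₂₃.trans hv.1)
        i₁₂ (by rw [sign_tanh_sub_of_lt h₁₃, sign_tanh_sub_of_lt h₂₃]; norm_num)))
    (fun v => ?_) (h.tendsto_integral_smoothSign_four hNt u₁ u₂ u₃ u₃)
    (h.tendsto_integral_smoothSign_four hNt u₁ u₂ u₃ w)
  · rw [h.integral_sign_mul_sign_mul_self, i₁₂] at key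
    simp only [sub_self, sechAngle_zero] at key
    field_simp at key ⊢
    linarith
  · have hd : ∀ u, HasDerivAt (fun v => sechAngle (v - u)) (-sech (v - u)) v := fun u => by
      refine ((hasDerivAt_sechAngle (v - u)).comp v ((hasDerivAt_id v).sub_const u)).congr_deriv ?_
      simp
    exact (((((hd u₁).mul_const A₂₃).const_mul 1).const_mul _).add
      ((((hd u₂).mul_const A₁₃).const_mul (-1)).const_mul _)).add
      ((((hd u₃).mul_const A₁₂).const_mul 1).const_mul _)

end SechProcess

/-! ### Asymptotics of the double sum of grid covariances. -/

/-- A second antiderivative of `A A'' - A' ^ 2` for `A = sechAngle`. -/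
noncomputable def sechPotential (x : ℝ) : ℝ := sechAngle x ^ 2 / 2 - 2 * Real.log (Real.cosh x)

/-- The covariance of two sign products at distance `m` on a grid of step `h`, up to a constant. -/
noncomputable def gridCov (h : ℝ) (m : ℕ) : ℝ :=
  sechAngle ((m + 1) * h) * sechAngle ((m - 1) * h) - sechAngle (m * h) ^ 2

theorem abs_sech_sub_sech_le (x y : ℝ) : |sech x - sech y| ≤ |x - y| := by
  have := Convex.norm_image_sub_le_of_norm_hasDerivWithin_le (f := sech) (C := 1) (s := Set.univ)
    (x := y) (y := x) (fun z _ => (hasDerivAt_sech z).hasDerivWithinAt) (fun z _ => by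
      have h1 := sech_sq_add_tanh_sq z
      rw [Real.norm_eq_abs, abs_le]
      constructor <;> nlinarith [sq_nonneg (sech z - Real.tanh z), sq_nonneg (sech z + Real.tanh z)])
    convex_univ (Set.mem_univ _) (Set.mem_univ _)
  simpa using this

/-- From `cosh (τ + h) cosh (τ - h) = cosh² τ + sinh² h`. -/
theorem log_cosh_add_log_cosh (τ h : ℝ) :
    Real.log (Real.cosh (τ + h)) + Real.log (Real.cosh (τ - h)) - 2 * Real.log (Real.cosh τ)
      = Real.log (1 + Real.sinh h ^ 2 * sech τ ^ 2) := by
  have h1 := Real.cosh_pos (τ + h)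
  have h2 := Real.cosh_pos (τ - h)
  have h3 := Real.cosh_pos τ
  have e : 1 + Real.sinh h ^ 2 * sech τ ^ 2
      = Real.cosh (τ + h) * Real.cosh (τ - h) / (Real.cosh τ ^ 2) := by
    rw [sech, eq_div_iff (by positivity), Real.cosh_add, Real.cosh_sub]
    have a := Real.cosh_sq τ
    have b := Real.cosh_sq h
    field_simp
    nlinarith
  rw [e, Real.log_div (by positivity) (by positivity), Real.log_mul h1.ne' h2.ne', Real.log_pow]
  push_cast
  ring

theorem sinh_le_add_sq {h : ℝ} (h0 : 0 ≤ h) (h1 : h ≤ 1) : Real.sinh h ≤ h + h ^ 2 := by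
  have a := Real.abs_exp_sub_one_sub_id_le (x := h) (by rwa [abs_of_nonneg h0])
  have b := Real.add_one_le_exp (-h)
  rw [Real.sinh_eq]
  have := (abs_le.1 a).2
  nlinarith [sq_nonneg h]

/-- Subtracting the second difference of `A² / 2` leaves `-(A (τ + h) - A (τ - h))² / 2 = -2 h²
sech² ξ` for an intermediate `ξ`. The second difference of `2 log cosh` is `2 log (1 + sinh² h sech²
τ)`, and the two cancel up to order `h³`. The constant is `42 = 2 * 19 + 4`, from the logarithm and
from replacing `ξ` by `τ`. -/
theorem abs_gridCov_sub_le {h : ℝ} (h0 : 0 < h) (h1 : h ≤ 1) (τ : ℝ) :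
    |sechAngle (τ + h) * sechAngle (τ - h) - sechAngle τ ^ 2
      - (sechPotential (τ + h) + sechPotential (τ - h) - 2 * sechPotential τ)| ≤ 42 * h ^ 3 := by
  set s := sech τ with hs
  have s0 : 0 < s := sech_pos τ
  have s1 : s ≤ 1 := sech_le_one τ
  obtain ⟨ξ, hξ, hslope⟩ := exists_hasDerivAt_eq_slope sechAngle (fun x => -sech x)
    (by linarith : τ - h < τ + h) continuous_sechAngle.continuousOn
    (fun x _ => hasDerivAt_sechAngle x)
  have hdiff : sechAngle (τ + h) - sechAngle (τ - h) = -(2 * h * sech ξ) := by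
    rw [eq_div_iff (by linarith)] at hslope
    linarith
  have hσs : |sech ξ - s| ≤ h := (abs_sech_sub_sech_le ξ τ).trans
    (abs_le.2 ⟨by linarith [hξ.1], by linarith [hξ.2]⟩)
  set σ := sech ξ
  have σ0 : 0 < σ := sech_pos ξ
  have σ1 : σ ≤ 1 := sech_le_one ξ
  have hσ2 : |σ ^ 2 - s ^ 2| ≤ 2 * h := by
    have : σ ^ 2 - s ^ 2 = (σ - s) * (σ + s) := by ring
    rw [this, abs_mul, abs_of_pos (by linarith : 0 < σ + s)]
    nlinarith [abs_nonneg (σ - s)]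
  have hsinh0 : h ≤ Real.sinh h := Real.self_le_sinh_iff.2 h0.le
  have hsinh1 := sinh_le_add_sq h0.le h1
  set x := Real.sinh h ^ 2 * s ^ 2 with hx
  have hsinh2 : h ^ 2 ≤ Real.sinh h ^ 2 := by gcongr
  have hsinh3 : Real.sinh h ^ 2 ≤ h ^ 2 + 3 * h ^ 3 := by
    have : Real.sinh h ^ 2 ≤ (h + h ^ 2) ^ 2 := by
      have := h0.le.trans hsinh0
      gcongr
    nlinarith [mul_nonneg (pow_nonneg h0.le 3) (sub_nonneg.2 h1)]
  have s2 : s ^ 2 ≤ 1 := pow_le_one₀ s0.le s1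
  have x0 : 0 ≤ x := by positivity
  have xl : h ^ 2 * s ^ 2 ≤ x := by rw [hx]; gcongr
  have xu : x ≤ h ^ 2 * s ^ 2 + 3 * h ^ 3 := by
    have e1 : x ≤ (h ^ 2 + 3 * h ^ 3) * s ^ 2 := by rw [hx]; gcongr
    have e2 : 3 * h ^ 3 * s ^ 2 ≤ 3 * h ^ 3 * 1 := by gcongr
    linarith
  have x4 : x ≤ 4 * h ^ 2 := by
    have e1 : h ^ 2 * s ^ 2 ≤ h ^ 2 * 1 := by gcongr
    have e2 : h ^ 2 * h ≤ h ^ 2 * 1 := by gcongr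
    nlinarith
  have xsq : x ^ 2 ≤ 16 * h ^ 3 := by
    have e1 : x ^ 2 ≤ (4 * h ^ 2) ^ 2 := by gcongr
    have e2 : h ^ 3 * h ≤ h ^ 3 * 1 := by gcongr
    nlinarith
  have lu : Real.log (1 + x) ≤ x := by
    have := Real.log_le_sub_one_of_pos (by linarith : 0 < 1 + x)
    linarith
  have ll : x - x ^ 2 ≤ Real.log (1 + x) := by
    have e1 := Real.one_sub_inv_le_log_of_pos (by linarith : 0 < 1 + x)
    have e2 : x - x ^ 2 ≤ 1 - (1 + x)⁻¹ := by
      have : 1 - (1 + x)⁻¹ = x / (1 + x) := by field_simp; ring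
      rw [this, le_div_iff₀ (by linarith)]
      nlinarith [pow_nonneg x0 3]
    linarith
  have hlog := log_cosh_add_log_cosh τ h
  rw [← hs, ← hx] at hlog
  have e : sechAngle (τ + h) * sechAngle (τ - h) - sechAngle τ ^ 2
      - (sechPotential (τ + h) + sechPotential (τ - h) - 2 * sechPotential τ)
      = 2 * (Real.log (1 + x) - h ^ 2 * s ^ 2) - 2 * h ^ 2 * (σ ^ 2 - s ^ 2) := by
    have : -(1 / 2) * (sechAngle (τ + h) - sechAngle (τ - h)) ^ 2 = -(2 * h ^ 2 * σ ^ 2) := by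
      rw [hdiff]; ring
    rw [← hlog]
    simp only [sechPotential]
    linear_combination this
  have hlb : |Real.log (1 + x) - h ^ 2 * s ^ 2| ≤ 19 * h ^ 3 :=
    abs_le.2 ⟨by nlinarith [pow_pos h0 3], by nlinarith [pow_pos h0 3]⟩
  rw [e]
  refine (abs_sub _ _).trans ?_
  rw [abs_mul, abs_mul, abs_two, abs_of_pos (by positivity : (0 : ℝ) < 2 * h ^ 2)]
  have := mul_le_mul_of_nonneg_left hσ2 (by positivity : (0 : ℝ) ≤ 2 * h ^ 2)
  nlinarith

/-- Telescoping in `k - j`. The truncated subtractions are exact because `j < k`. -/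
theorem sum_second_difference (ψ : ℕ → ℝ) (k : ℕ) :
    ∑ j ∈ Finset.range k, (ψ (k - j + 1) + ψ (k - j - 1) - 2 * ψ (k - j))
      = ψ (k + 1) - ψ k - (ψ 1 - ψ 0) := by
  induction k with
  | zero => simp
  | succ k ih =>
    rw [Finset.sum_range_succ']
    simp only [Nat.reduceSubDiff, Nat.sub_zero, Nat.add_sub_cancel]
    rw [ih]; ring

theorem sum_sum_second_difference (ψ : ℕ → ℝ) (M : ℕ) :
    ∑ k ∈ Finset.range M, ∑ j ∈ Finset.range k,
      (ψ (k - j + 1) + ψ (k - j - 1) - 2 * ψ (k - j)) = ψ M - ψ 0 - M * (ψ 1 - ψ 0) := by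
  simp_rw [sum_second_difference]
  rw [Finset.sum_sub_distrib, Finset.sum_range_sub]
  simp
  ring

theorem abs_sum_gridCov_sub_le {h : ℝ} (h0 : 0 < h) (h1 : h ≤ 1) (M : ℕ) :
    |∑ k ∈ Finset.range M, ∑ j ∈ Finset.range k, gridCov h (k - j)
      - (sechPotential (M * h) - sechPotential 0 - M * (sechPotential h - sechPotential 0))|
      ≤ M * M * (42 * h ^ 3) := by
  have hs := sum_sum_second_difference (fun m => sechPotential (m * h)) M
  simp only [Nat.cast_zero, zero_mul, Nat.cast_one, one_mul] at hs
  rw [← hs, ← Finset.sum_sub_distrib]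
  simp_rw [← Finset.sum_sub_distrib]
  calc _ ≤ ∑ k ∈ Finset.range M, ∑ j ∈ Finset.range k, 42 * h ^ 3 := by
        refine (Finset.abs_sum_le_sum_abs _ _).trans (Finset.sum_le_sum fun k hk => ?_)
        refine (Finset.abs_sum_le_sum_abs _ _).trans (Finset.sum_le_sum fun j hj => ?_)
        have hjk : 1 ≤ k - j := by have := Finset.mem_range.1 hj; omega
        have := abs_gridCov_sub_le h0 h1 ((k - j : ℕ) * h)
        rw [gridCov]
        rw [Nat.cast_sub hjk, Nat.cast_add, Nat.cast_one]
        have e1 : (((k - j : ℕ) : ℝ) + 1) * h = (k - j : ℕ) * h + h := by ring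
        have e2 : (((k - j : ℕ) : ℝ) - 1) * h = (k - j : ℕ) * h - h := by ring
        rw [e1, e2]
        exact this
    _ ≤ ∑ k ∈ Finset.range M, M * (42 * h ^ 3) := by
        refine Finset.sum_le_sum fun k hk => ?_
        rw [Finset.sum_const, Finset.card_range, nsmul_eq_mul]
        have : (k : ℝ) ≤ M := by exact_mod_cast (Finset.mem_range.1 hk).le
        gcongr
    _ = _ := by
        rw [Finset.sum_const, Finset.card_range, nsmul_eq_mul]; ring

theorem tendsto_nat_mul_sub {f : ℝ → ℝ} {f' : ℝ} (hf : HasDerivAt f f' 0) (L : ℝ) :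
    Tendsto (fun M : ℕ => (M : ℝ) * (f (L / M) - f 0)) atTop (𝓝 (L * f')) := by
  have h1 : HasDerivAt (fun x => f (L * x)) (f' * L) 0 := by
    have h2 : HasDerivAt (fun x : ℝ => L * x) L 0 := by simpa using (hasDerivAt_id (0 : ℝ)).const_mul L
    have h3 : HasDerivAt f f' (L * 0) := by simpa using hf
    exact h3.comp 0 h2
  have h4 := h1.tendsto_slope_zero_right
  have h5 : Tendsto (fun M : ℕ => ((M : ℝ))⁻¹) atTop (𝓝[>] 0) :=
    tendsto_inv_atTop_nhdsGT_zero.comp tendsto_natCast_atTop_atTop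
  have := h4.comp h5
  rw [mul_comm]
  refine this.congr fun M => ?_
  simp [div_eq_mul_inv]

theorem hasDerivAt_sechPotential_zero : HasDerivAt sechPotential (-(Real.pi / 2)) 0 := by
  have h1 := ((hasDerivAt_sechAngle 0).pow 2).div_const 2
  have h2 := ((Real.hasDerivAt_cosh 0).log (Real.cosh_pos 0).ne').const_mul 2
  refine (h1.sub h2).congr_deriv ?_
  simp [sechAngle_zero, sech_zero]
  ring

theorem tendsto_sum_gridCov {L : ℝ} (hL : 0 < L) :
    Tendsto (fun M : ℕ => ∑ k ∈ Finset.range M, ∑ j ∈ Finset.range k, gridCov (L / M) (k - j))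
      atTop (𝓝 (sechPotential L - sechPotential 0 + L * (Real.pi / 2))) := by
  have h1 := (tendsto_nat_mul_sub hasDerivAt_sechPotential_zero L).const_sub
    (sechPotential L - sechPotential 0)
  rw [mul_neg, sub_neg_eq_add] at h1
  have h2 : Tendsto (fun M : ℕ => 42 * L ^ 3 * ((M : ℝ))⁻¹) atTop (𝓝 0) := by
    have := (tendsto_inv_atTop_nhds_zero_nat (𝕜 := ℝ)).const_mul (42 * L ^ 3)
    rwa [mul_zero] at this
  have h3 : Tendsto (fun M : ℕ => ∑ k ∈ Finset.range M, ∑ j ∈ Finset.range k, gridCov (L / M) (k - j)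
      - (sechPotential L - sechPotential 0 - M * (sechPotential (L / M) - sechPotential 0)))
      atTop (𝓝 0) := by
    refine squeeze_zero_norm' ?_ h2
    -- Ensures `L / M ≤ 1`. The error is then at most `M² * 42 (L / M)³`, of order `1 / M`.
    filter_upwards [eventually_ge_atTop (max 1 ⌈L⌉₊)] with M hM
    have hM1 : 1 ≤ M := (le_max_left _ _).trans hM
    have hM0 : (0 : ℝ) < M := by exact_mod_cast hM1
    have hML : L ≤ M := (Nat.le_ceil L).trans (by exact_mod_cast (le_max_right _ _).trans hM)
    have := abs_sum_gridCov_sub_le (div_pos hL hM0) ((div_le_one hM0).2 hML) M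
    rw [mul_div_cancel₀ _ hM0.ne'] at this
    refine this.trans (le_of_eq ?_)
    field_simp
  simpa using h3.add h1

/-! ### Moments of the number of sign changes on a grid. -/

namespace SechProcess

variable {Ω : Type*} [MeasurableSpace Ω] {P : Measure Ω} [IsProbabilityMeasure P]
  {X : ℝ → Ω → ℝ}

/-- The product of the signs at the endpoints of the `k`-th cell of the grid `s + h ℕ`. -/
noncomputable def signProd (X : ℝ → Ω → ℝ) (s h : ℝ) (k : ℕ) (ω : Ω) : ℝ :=
  Real.sign (X (s + k * h) ω) * Real.sign (X (s + (k + 1 : ℕ) * h) ω)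

/-- The number of sign changes among the first `M` cells of the grid `s + h ℕ`. -/
noncomputable def gridCount (X : ℝ → Ω → ℝ) (s h : ℝ) (M : ℕ) (ω : Ω) : ℝ :=
  ∑ k ∈ Finset.range M, (1 - signProd X s h k ω) / 2

omit [IsProbabilityMeasure P] in
theorem measurable_signProd (hX : SechProcess P X) (s h : ℝ) (k : ℕ) :
    Measurable (signProd X s h k) :=
  (measurable_sign_real.comp (hX.measurable _)).mul (measurable_sign_real.comp (hX.measurable _))

omit [MeasurableSpace Ω] in
theorem abs_signProd_le (s h : ℝ) (k : ℕ) (ω : Ω) : |signProd X s h k ω| ≤ 1 := by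
  rw [signProd, abs_mul]
  exact mul_le_one₀ (abs_sign_le_one _) (abs_nonneg _) (abs_sign_le_one _)

omit [IsProbabilityMeasure P] in
theorem measurable_gridCount (hX : SechProcess P X) (s h : ℝ) (M : ℕ) :
    Measurable (gridCount X s h M) :=
  Finset.measurable_sum _ fun k _ => ((hX.measurable_signProd s h k).const_sub 1).div_const 2

theorem integral_signProd (hX : SechProcess P X) (s : ℝ) {h : ℝ} (hh : 0 < h) (k : ℕ) :
    ∫ ω, signProd X s h k ω ∂P = 2 / Real.pi * sechAngle h := by
  simp only [signProd]
  rw [hX.integral_sign_two (by push_cast; nlinarith)]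
  congr 2
  push_cast; ring

/-- The first Pfaffian term is the product of the two means; the other two form `gridCov`. -/
theorem integral_signProd_mul_signProd (hX : SechProcess P X) (s : ℝ) {h : ℝ} (hh : 0 < h)
    {j k : ℕ} (hjk : j < k) :
    ∫ ω, signProd X s h j ω * signProd X s h k ω ∂P
      = (2 / Real.pi) ^ 2 * (sechAngle h ^ 2 + gridCov h (k - j)) := by
  have hjk' : (j : ℝ) + 1 ≤ k := by exact_mod_cast hjk
  have hpi := Real.pi_pos
  rw [gridCov, Nat.cast_sub hjk.le]
  rcases Nat.lt_or_ge (j + 1) k with h1 | h1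
  · have h1' : (j : ℝ) + 1 < k := by exact_mod_cast h1
    have := hX.integral_sign_four (u₁ := s + j * h) (u₂ := s + (j + 1 : ℕ) * h) (u₃ := s + k * h)
      (w := s + (k + 1 : ℕ) * h) (by push_cast; nlinarith) (by push_cast; nlinarith)
      (by push_cast; nlinarith)
    simp only [signProd]
    simp_rw [← mul_assoc]
    rw [this]
    have e1 : s + ((j + 1 : ℕ) : ℝ) * h - (s + j * h) = h := by push_cast; ring
    have e2 : s + ((k + 1 : ℕ) : ℝ) * h - (s + k * h) = h := by push_cast; ring
    have e3 : s + k * h - (s + j * h) = (k - j) * h := by ring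
    have e4 : s + ((k + 1 : ℕ) : ℝ) * h - (s + (j + 1 : ℕ) * h) = (k - j) * h := by push_cast; ring
    have e5 : s + ((k + 1 : ℕ) : ℝ) * h - (s + j * h) = (k - j + 1) * h := by push_cast; ring
    have e6 : s + k * h - (s + (j + 1 : ℕ) * h) = (k - j - 1) * h := by push_cast; ring
    rw [e1, e2, e3, e4, e5, e6]
    ring
  -- Adjacent cells share an endpoint, whose sign squares to `1`. The resulting two-point function
  -- fits the same formula because `sechAngle 0 = π / 2`.
  · obtain rfl : k = j + 1 := by omega
    have e : (fun ω => signProd X s h j ω * signProd X s h (j + 1) ω)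
        =ᵐ[P] fun ω => Real.sign (X (s + j * h) ω) * Real.sign (X (s + (j + 1 + 1 : ℕ) * h) ω) := by
      filter_upwards [hX.ae_ne_zero (s + (j + 1 : ℕ) * h)] with ω hω
      have := sign_mul_self_of_ne_zero hω
      simp only [signProd]
      linear_combination (Real.sign (X (s + j * h) ω)
        * Real.sign (X (s + (j + 1 + 1 : ℕ) * h) ω)) * this
    rw [integral_congr_ae e, hX.integral_sign_two (by push_cast; nlinarith)]
    have e1 : s + ((j + 1 + 1 : ℕ) : ℝ) * h - (s + j * h) = 2 * h := by push_cast; ring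
    have e2 : (((j + 1 : ℕ) : ℝ) - j + 1) * h = 2 * h := by push_cast; ring
    have e3 : (((j + 1 : ℕ) : ℝ) - j - 1) * h = 0 := by push_cast; ring
    have e4 : (((j + 1 : ℕ) : ℝ) - j) * h = h := by push_cast; ring
    rw [e1, e2, e3, e4, sechAngle_zero]
    field_simp
    ring

theorem integrable_signProd (hX : SechProcess P X) (s h : ℝ) (k : ℕ) :
    Integrable (signProd X s h k) P :=
  Integrable.of_bound (hX.measurable_signProd s h k).aestronglyMeasurable 1
    (ae_of_all _ fun ω => abs_signProd_le s h k ω)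

theorem integrable_signProd_mul (hX : SechProcess P X) (s h : ℝ) (j k : ℕ) :
    Integrable (fun ω => signProd X s h j ω * signProd X s h k ω) P :=
  Integrable.of_bound
    ((hX.measurable_signProd s h j).mul (hX.measurable_signProd s h k)).aestronglyMeasurable 1
    (ae_of_all _ fun ω => by
      rw [Real.norm_eq_abs, abs_mul]
      exact mul_le_one₀ (abs_signProd_le s h j ω) (abs_nonneg _) (abs_signProd_le s h k ω))

theorem integral_signProd_sq (hX : SechProcess P X) (s h : ℝ) (k : ℕ) :
    ∫ ω, signProd X s h k ω * signProd X s h k ω ∂P = 1 := by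
  have e : (fun ω => signProd X s h k ω * signProd X s h k ω) =ᵐ[P] fun _ => 1 := by
    filter_upwards [hX.ae_ne_zero (s + k * h), hX.ae_ne_zero (s + (k + 1 : ℕ) * h)] with ω h1 h2
    rw [signProd, mul_mul_mul_comm, sign_mul_self_of_ne_zero h1, sign_mul_self_of_ne_zero h2,
      one_mul]
  rw [integral_congr_ae e]; simp

theorem integrable_sum_signProd_sq (hX : SechProcess P X) (s h : ℝ) (M : ℕ) :
    Integrable (fun ω => (∑ k ∈ Finset.range M, signProd X s h k ω) ^ 2) P := by
  simp_rw [sq, Finset.sum_mul_sum]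
  exact integrable_finsetSum _ fun i _ => integrable_finsetSum _ fun j _ =>
    hX.integrable_signProd_mul s h i j

theorem integral_sum_signProd_sq (hX : SechProcess P X) (s : ℝ) {h : ℝ} (hh : 0 < h) (M : ℕ) :
    ∫ ω, (∑ k ∈ Finset.range M, signProd X s h k ω) ^ 2 ∂P
      = M + (2 / Real.pi * sechAngle h) ^ 2 * (M * M - M)
        + 2 * (2 / Real.pi) ^ 2 *
          ∑ k ∈ Finset.range M, ∑ j ∈ Finset.range k, gridCov h (k - j) := by
  induction M with
  | zero => simp
  | succ M ih =>
    have e : ∀ ω, (∑ k ∈ Finset.range (M + 1), signProd X s h k ω) ^ 2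
        = (∑ k ∈ Finset.range M, signProd X s h k ω) ^ 2
          + 2 * (∑ j ∈ Finset.range M, signProd X s h j ω * signProd X s h M ω)
          + signProd X s h M ω * signProd X s h M ω := by
      intro ω
      rw [Finset.sum_range_succ, ← Finset.sum_mul]; ring
    have i1 := hX.integrable_sum_signProd_sq s h M
    have i2 : Integrable (fun ω => 2 * ∑ j ∈ Finset.range M,
        signProd X s h j ω * signProd X s h M ω) P :=
      (integrable_finsetSum _ fun j _ => hX.integrable_signProd_mul s h j M).const_mul 2
    have i3 := hX.integrable_signProd_mul s h M M
    have s1 := integral_add i1 i2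
    have s2 := integral_add (i1.add i2) i3
    simp only [Pi.add_apply] at s1 s2
    simp_rw [e]
    rw [s2, s1, ih, hX.integral_signProd_sq, integral_const_mul,
      integral_finsetSum _ fun j _ => hX.integrable_signProd_mul s h j M,
      Finset.sum_congr rfl fun j hj =>
        hX.integral_signProd_mul_signProd s hh (Finset.mem_range.1 hj),
      ← Finset.mul_sum, Finset.sum_add_distrib, Finset.sum_range_succ]
    simp only [Finset.sum_const, Finset.card_range, nsmul_eq_mul]
    push_cast
    ring

omit [MeasurableSpace Ω] in
theorem gridCount_eq (s h : ℝ) (M : ℕ) (ω : Ω) :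
    gridCount X s h M ω = (M - ∑ k ∈ Finset.range M, signProd X s h k ω) / 2 := by
  rw [gridCount, ← Finset.sum_div, Finset.sum_sub_distrib]; simp

theorem integrable_sum_signProd (hX : SechProcess P X) (s h : ℝ) (M : ℕ) :
    Integrable (fun ω => ∑ k ∈ Finset.range M, signProd X s h k ω) P :=
  integrable_finsetSum _ fun k _ => hX.integrable_signProd s h k

theorem integral_sum_signProd (hX : SechProcess P X) (s : ℝ) {h : ℝ} (hh : 0 < h) (M : ℕ) :
    ∫ ω, ∑ k ∈ Finset.range M, signProd X s h k ω ∂P = M * (2 / Real.pi * sechAngle h) := by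
  rw [integral_finsetSum _ fun k _ => hX.integrable_signProd s h k,
    Finset.sum_congr rfl fun k _ => hX.integral_signProd s hh k]
  simp

theorem integral_gridCount (hX : SechProcess P X) (s : ℝ) {h : ℝ} (hh : 0 < h) (M : ℕ) :
    ∫ ω, gridCount X s h M ω ∂P = M * (1 - 2 / Real.pi * sechAngle h) / 2 := by
  simp_rw [gridCount_eq]
  rw [integral_div, integral_sub (integrable_const _) (hX.integrable_sum_signProd s h M),
    hX.integral_sum_signProd s hh]
  simp
  ring

/-- Arranged as squared mean plus variance, so that the diagonal part `M (1 - c) (1 + c) / 4` with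
`c = (2 / π) A h` has the finite limit `L / π`. -/
theorem integral_gridCount_sq (hX : SechProcess P X) (s : ℝ) {h : ℝ} (hh : 0 < h) (M : ℕ) :
    ∫ ω, gridCount X s h M ω ^ 2 ∂P
      = (M * (1 - 2 / Real.pi * sechAngle h) / 2) ^ 2
        + (M * (1 - 2 / Real.pi * sechAngle h) * (1 + 2 / Real.pi * sechAngle h)
          + 2 * (2 / Real.pi) ^ 2 *
            ∑ k ∈ Finset.range M, ∑ j ∈ Finset.range k, gridCov h (k - j)) / 4 := by
  have e : ∀ ω, gridCount X s h M ω ^ 2 = ((M : ℝ) ^ 2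
      - (2 * M) * (∑ k ∈ Finset.range M, signProd X s h k ω)
      + (∑ k ∈ Finset.range M, signProd X s h k ω) ^ 2) / 4 := by
    intro ω; rw [gridCount_eq]; ring
  have i1 := (hX.integrable_sum_signProd s h M).const_mul (2 * M : ℝ)
  have i2 := hX.integrable_sum_signProd_sq s h M
  have i0 : Integrable (fun _ : Ω => (M : ℝ) ^ 2) P := integrable_const _
  have s1 := integral_sub i0 i1
  have s2 := integral_add (i0.sub i1) i2
  simp only [Pi.sub_apply] at s1 s2
  simp_rw [e]
  rw [integral_div, s2, s1, integral_const_mul, hX.integral_sum_signProd s hh,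
    hX.integral_sum_signProd_sq s hh]
  simp
  ring

/-- The limit of the variances of the sign change counts over an interval of length `L`. -/
noncomputable def limitVar (L : ℝ) : ℝ :=
  L / Real.pi + 2 / Real.pi ^ 2 * (sechPotential L - sechPotential 0 + L * (Real.pi / 2))

theorem tendsto_nat_mul_one_sub (L : ℝ) :
    Tendsto (fun M : ℕ => (M : ℝ) * (1 - 2 / Real.pi * sechAngle (L / M))) atTop
      (𝓝 (2 * L / Real.pi)) := by
  have h := (tendsto_nat_mul_sub (hasDerivAt_sechAngle 0) L).const_mul (-(2 / Real.pi))
  have hpi := Real.pi_pos.ne'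
  rw [sech_zero, sechAngle_zero] at h
  refine (h.congr fun M => ?_).trans (le_of_eq (congrArg 𝓝 ?_))
  · field_simp
    ring
  · field_simp

theorem tendsto_integral_gridCount (hX : SechProcess P X) (s : ℝ) {L : ℝ} (hL : 0 < L) :
    Tendsto (fun M : ℕ => ∫ ω, gridCount X s (L / M) M ω ∂P) atTop (𝓝 (L / Real.pi)) := by
  have h := (tendsto_nat_mul_one_sub L).div_const 2
  refine (h.congr' ?_).trans (le_of_eq (congrArg 𝓝 (by ring)))
  filter_upwards [eventually_gt_atTop 0] with M hM
  rw [hX.integral_gridCount s (by positivity)]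

theorem tendsto_integral_gridCount_sq (hX : SechProcess P X) (s : ℝ) {L : ℝ} (hL : 0 < L) :
    Tendsto (fun M : ℕ => ∫ ω, gridCount X s (L / M) M ω ^ 2 ∂P) atTop
      (𝓝 ((L / Real.pi) ^ 2 + limitVar L)) := by
  have hpi := Real.pi_pos.ne'
  have h1 := tendsto_nat_mul_one_sub L
  have h2 : Tendsto (fun M : ℕ => 1 + 2 / Real.pi * sechAngle (L / M)) atTop (𝓝 2) := by
    have h3 : Tendsto (fun M : ℕ => sechAngle (L / M)) atTop (𝓝 (Real.pi / 2)) := by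
      rw [← sechAngle_zero]
      exact (continuous_sechAngle.tendsto 0).comp (tendsto_const_div_atTop_nhds_zero_nat L)
    refine ((h3.const_mul (2 / Real.pi)).const_add 1).trans (le_of_eq (congrArg 𝓝 ?_))
    field_simp
    norm_num
  have h := ((h1.div_const 2).pow 2).add
    (((h1.mul h2).add ((tendsto_sum_gridCov hL).const_mul (2 * (2 / Real.pi) ^ 2))).div_const 4)
  refine (h.congr' ?_).trans (le_of_eq (congrArg 𝓝 ?_))
  · filter_upwards [eventually_gt_atTop 0] with M hM
    rw [hX.integral_gridCount_sq s (by positivity)]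
  · rw [limitVar]
    field_simp
    ring

theorem abs_limitVar_sub_le {L : ℝ} (hL : 0 ≤ L) :
    |limitVar L - 2 * (1 - 2 / Real.pi) * (L / Real.pi)| ≤ 4 := by
  have hpi := Real.pi_pos
  have hpi3 := Real.pi_gt_three
  have a0 : 0 ≤ sechAngle L := by
    have := Real.arctan_nonneg.2 (Real.exp_pos (-L)).le
    rw [sechAngle]; linarith
  have a1 : sechAngle L ≤ Real.pi := by
    have := Real.arctan_lt_pi_div_two (Real.exp (-L))
    rw [sechAngle]; linarith
  have c1 : Real.log (Real.cosh L) ≤ L := by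
    rw [Real.log_le_iff_le_exp (Real.cosh_pos L), Real.cosh_eq]
    have : Real.exp (-L) ≤ Real.exp L := Real.exp_le_exp.2 (by linarith)
    linarith
  have c2 : L - 1 ≤ Real.log (Real.cosh L) := by
    rw [Real.le_log_iff_exp_le (Real.cosh_pos L), Real.cosh_eq, Real.exp_sub]
    have e2 : 2 ≤ Real.exp 1 := by
      have := Real.add_one_le_exp 1
      linarith
    have := Real.exp_pos (-L)
    have := Real.exp_pos L
    rw [div_le_iff₀ (Real.exp_pos 1)]
    nlinarith
  -- The linear terms cancel exactly; what remains is bounded since `L - 1 ≤ log cosh L ≤ L` and `0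
  -- ≤ A ≤ π`.
  have e : limitVar L - 2 * (1 - 2 / Real.pi) * (L / Real.pi)
      = (4 * (L - Real.log (Real.cosh L)) + sechAngle L ^ 2) / Real.pi ^ 2 - 1 / 4 := by
    rw [limitVar, sechPotential, sechPotential, sechAngle_zero]
    simp only [Real.cosh_zero, Real.log_one]
    field_simp
    ring
  have hsq : sechAngle L ^ 2 ≤ Real.pi ^ 2 := by gcongr
  have b1 : 0 ≤ (4 * (L - Real.log (Real.cosh L)) + sechAngle L ^ 2) / Real.pi ^ 2 := by
    have : 0 ≤ L - Real.log (Real.cosh L) := by linarith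
    positivity
  have b2 : (4 * (L - Real.log (Real.cosh L)) + sechAngle L ^ 2) / Real.pi ^ 2 ≤ 2 := by
    rw [div_le_iff₀ (by positivity)]
    nlinarith
  rw [e, abs_le]
  constructor <;> linarith

end SechProcess

/-! ### Sign changes on a grid versus zeros of a continuous function. -/

theorem one_sub_sign_mul_sign_div_two {x y : ℝ} (hx : x ≠ 0) (hy : y ≠ 0) :
    (1 - Real.sign x * Real.sign y) / 2 = if x * y < 0 then 1 else 0 := by
  rw [← sign_mul_real]
  split_ifs with h
  · rw [Real.sign_of_neg h]; norm_num
  · rw [Real.sign_of_pos (lt_of_le_of_ne (not_lt.1 h) (mul_ne_zero hx hy).symm)]; norm_num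

theorem exists_sign_change {v : ℕ → ℝ} {i j : ℕ} (hij : i ≤ j) (hne : ∀ k ≤ j, v k ≠ 0)
    (h : v i * v j < 0) : ∃ k, i ≤ k ∧ k < j ∧ v k * v (k + 1) < 0 := by
  induction j, hij using Nat.le_induction with
  | base => exact absurd h (not_lt.2 (mul_self_nonneg _))
  | succ j hij ih =>
    by_cases hc : v j * v (j + 1) < 0
    · exact ⟨j, hij, j.lt_succ_self, hc⟩
    · have h0 := hne j (Nat.le_succ j)
      have h1 := hne (j + 1) le_rfl
      have hpos : 0 < v j * v (j + 1) :=
        lt_of_le_of_ne (not_lt.1 hc) (mul_ne_zero h0 h1).symm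
      have : v i * v j < 0 := by
        by_contra hcon
        have h2 : 0 ≤ (v i * v j) * (v j * v (j + 1)) := mul_nonneg (not_lt.1 hcon) hpos.le
        have h3 : (v i * v j) * (v j * v (j + 1)) = (v i * v (j + 1)) * (v j * v j) := by ring
        have h4 := mul_neg_of_neg_of_pos h (mul_self_pos.2 h0)
        linarith
      obtain ⟨k, a, b, c⟩ := ih (fun k hk => hne k (hk.trans (Nat.le_succ j))) this
      exact ⟨k, a, b.trans j.lt_succ_self, c⟩

/-- A function whose zeros in every open interval are accompanied by both signs. -/
def CrossesAtZeros (F : ℝ → ℝ) : Prop :=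
  ∀ p q : ℝ, (∃ x ∈ Set.Ioo p q, F x = 0) →
    (∃ x ∈ Set.Ioo p q, 0 < F x) ∧ ∃ x ∈ Set.Ioo p q, F x < 0

/-- The number of sign changes of `F` in the first `M` cells of the grid `s + h ℕ`. -/
noncomputable def signChanges (F : ℝ → ℝ) (s h : ℝ) (M : ℕ) : Finset ℕ :=
  {k ∈ Finset.range M | F (s + k * h) * F (s + (k + 1 : ℕ) * h) < 0}

theorem gridCount_eq_card {Ω : Type*} {X : ℝ → Ω → ℝ} {ω : Ω} {s h : ℝ} {M : ℕ}
    (hne : ∀ k ≤ M, X (s + k * h) ω ≠ 0) :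
    SechProcess.gridCount X s h M ω = (signChanges (fun u => X u ω) s h M).card := by
  rw [SechProcess.gridCount, signChanges, Finset.card_filter]
  push_cast
  refine Finset.sum_congr rfl fun k hk => ?_
  have hk := Finset.mem_range.1 hk
  have := one_sub_sign_mul_sign_div_two (hne k hk.le) (hne (k + 1) hk)
  push_cast at this
  simpa only [SechProcess.signProd, Nat.cast_add, Nat.cast_one] using this

/-- The intermediate value theorem puts a zero inside each open cell with a sign change, and these
cells are disjoint. -/
theorem card_signChanges_le {F : ℝ → ℝ} (hF : Continuous F) {s L : ℝ} (hL : 0 < L) {M : ℕ}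
    (hfin : {u | u ∈ Set.Icc s (s + L) ∧ F u = 0}.Finite) :
    (signChanges F s (L / M) M).card ≤ {u | u ∈ Set.Icc s (s + L) ∧ F u = 0}.ncard := by
  rcases Nat.eq_zero_or_pos M with rfl | hM
  · simp [signChanges]
  have hM0 : (0 : ℝ) < M := by exact_mod_cast hM
  set h := L / M with hh
  have h0 : 0 < h := div_pos hL hM0
  have hMh : M * h = L := mul_div_cancel₀ _ hM0.ne'
  have hex : ∀ k ∈ signChanges F s h M, ∃ z ∈ Set.Ioo (s + k * h) (s + (k + 1 : ℕ) * h), F z = 0 := by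
    intro k hk
    have hneg := (Finset.mem_filter.1 hk).2
    have hlt : s + k * h ≤ s + (k + 1 : ℕ) * h := by push_cast; nlinarith
    rcases mul_neg_iff.1 hneg with ⟨ha, hb⟩ | ⟨ha, hb⟩
    · exact intermediate_value_Ioo' hlt hF.continuousOn ⟨hb, ha⟩
    · exact intermediate_value_Ioo hlt hF.continuousOn ⟨ha, hb⟩
  choose! z hz hz0 using hex
  rw [Set.ncard_eq_toFinset_card _ hfin]
  refine Finset.card_le_card_of_injOn z (fun k hk => ?_) (fun k hk l hl hkl => ?_)
  · have hkM : ((k + 1 : ℕ) : ℝ) ≤ M := by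
      exact_mod_cast Finset.mem_range.1 (Finset.mem_filter.1 hk).1
    have := hz k hk
    simp only [Set.Finite.coe_toFinset, Set.mem_ofPred_eq]
    refine ⟨⟨?_, ?_⟩, hz0 k hk⟩
    · have : 0 ≤ (k : ℝ) * h := by positivity
      linarith [(hz k hk).1]
    · have : ((k + 1 : ℕ) : ℝ) * h ≤ M * h := by gcongr
      linarith [(hz k hk).2]
  · have a := hz k hk
    have b := hz l hl
    rw [hkl] at a
    have h1 : (k : ℝ) * h < (l + 1 : ℕ) * h := by linarith [a.1, b.2]
    have h2 : (l : ℝ) * h < (k + 1 : ℕ) * h := by linarith [b.1, a.2]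
    have h1' := lt_of_mul_lt_mul_right h1 h0.le
    have h2' := lt_of_mul_lt_mul_right h2 h0.le
    have h3 : k < l + 1 := by exact_mod_cast h1'
    have h4 : l < k + 1 := by exact_mod_cast h2'
    omega

theorem exists_grid_near {s h x : ℝ} (h0 : 0 < h) (hx : s ≤ x) :
    ∃ i : ℕ, s + i * h ≤ x ∧ x < s + i * h + h := by
  refine ⟨⌊(x - s) / h⌋₊, ?_, ?_⟩
  · have := Nat.floor_le (div_nonneg (sub_nonneg.2 hx) h0.le)
    rw [le_div_iff₀ h0] at this
    linarith
  · have := Nat.lt_floor_add_one ((x - s) / h)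
    rw [div_lt_iff₀ h0] at this
    linarith

/-- The window contains open sets where `F` is positive and where it is negative. A fine grid meets
both, and between two such grid points some cell changes sign. -/
theorem eventually_exists_signChange {F : ℝ → ℝ} (hF : Continuous F) (hc : CrossesAtZeros F)
    {s L : ℝ} (hne : ∀ M k : ℕ, F (s + k * (L / M)) ≠ 0) {p q z : ℝ}
    (hp : s ≤ p) (hq : q ≤ s + L) (hz : z ∈ Set.Ioo p q) (hz0 : F z = 0) :
    ∀ᶠ M : ℕ in atTop, ∃ k ∈ signChanges F s (L / M) M, s + k * (L / M) ∈ Set.Ioo p q := by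
  obtain ⟨⟨x, hx, hxpos⟩, y, hy, hyneg⟩ := hc p q ⟨z, hz, hz0⟩
  have hL : 0 < L := by linarith [hz.1, hz.2]
  have nx : ∀ᶠ w in 𝓝 x, w ∈ Set.Ioo p q ∧ 0 < F w :=
    (show ∀ᶠ w in 𝓝 x, w ∈ Set.Ioo p q from isOpen_Ioo.mem_nhds hx).and (hF.continuousAt.eventually (lt_mem_nhds hxpos))
  have ny : ∀ᶠ w in 𝓝 y, w ∈ Set.Ioo p q ∧ F w < 0 :=
    (show ∀ᶠ w in 𝓝 y, w ∈ Set.Ioo p q from isOpen_Ioo.mem_nhds hy).and (hF.continuousAt.eventually (gt_mem_nhds hyneg))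
  obtain ⟨ε₁, hε₁, hb₁⟩ := Metric.eventually_nhds_iff.1 nx
  obtain ⟨ε₂, hε₂, hb₂⟩ := Metric.eventually_nhds_iff.1 ny
  have hmesh : ∀ᶠ M : ℕ in atTop, L / (M : ℝ) < min ε₁ ε₂ :=
    (tendsto_const_div_atTop_nhds_zero_nat L).eventually (gt_mem_nhds (lt_min hε₁ hε₂))
  filter_upwards [hmesh, eventually_gt_atTop 0] with M hM hMpos
  have hM0 : (0 : ℝ) < M := by exact_mod_cast hMpos
  set h := L / (M : ℝ) with hh
  have h0 : 0 < h := div_pos hL hM0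
  have hMh : M * h = L := mul_div_cancel₀ _ hM0.ne'
  obtain ⟨i, hi1, hi2⟩ := exists_grid_near h0 (hp.trans hx.1.le)
  obtain ⟨j, hj1, hj2⟩ := exists_grid_near h0 (hp.trans hy.1.le)
  obtain ⟨hiI, hiF⟩ := hb₁ (y := s + i * h) (by
    rw [Real.dist_eq, abs_lt]
    constructor <;> linarith [min_le_left ε₁ ε₂])
  obtain ⟨hjI, hjF⟩ := hb₂ (y := s + j * h) (by
    rw [Real.dist_eq, abs_lt]
    constructor <;> linarith [min_le_right ε₁ ε₂])
  have key : ∀ i j : ℕ, i ≤ j → s + i * h ∈ Set.Ioo p q → s + j * h ∈ Set.Ioo p q →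
      F (s + i * h) * F (s + j * h) < 0 →
      ∃ k ∈ signChanges F s h M, s + k * h ∈ Set.Ioo p q := by
    intro i j hij hi hj hneg
    obtain ⟨k, hk1, hk2, hk3⟩ := exists_sign_change (v := fun k : ℕ => F (s + k * h)) hij
      (fun k _ => hne M k) hneg
    have hk1' : (i : ℝ) * h ≤ k * h := by gcongr
    have hk2' : (k : ℝ) * h ≤ j * h := by gcongr
    refine ⟨k, Finset.mem_filter.2 ⟨Finset.mem_range.2 ?_, hk3⟩, ?_, ?_⟩
    · have h1 : (j : ℝ) * h < M * h := by linarith [hj.2]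
      have h2 : j < M := by exact_mod_cast lt_of_mul_lt_mul_right h1 h0.le
      omega
    · linarith [hi.1]
    · linarith [hj.2]
  rcases le_total i j with hij | hij
  · exact key i j hij hiI hjI (mul_neg_of_pos_of_neg hiF hjF)
  · exact key j i hij hjI hiI (mul_neg_of_neg_of_pos hjF hiF)

theorem eventually_card_le_signChanges {F : ℝ → ℝ} (hF : Continuous F) (hc : CrossesAtZeros F)
    {s L : ℝ} (hne : ∀ M k : ℕ, F (s + k * (L / M)) ≠ 0) (S : Finset ℝ)
    (hS : ∀ z ∈ S, z ∈ Set.Icc s (s + L) ∧ F z = 0) :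
    ∀ᶠ M : ℕ in atTop, S.card ≤ (signChanges F s (L / M) M).card := by
  have hends : ∀ z ∈ S, s < z ∧ z < s + L := by
    intro z hz
    obtain ⟨⟨h1, h2⟩, h3⟩ := hS z hz
    -- The grid with a single cell has the endpoints as its points, so neither endpoint is a zero.
    have e0 := hne 1 0
    have e1 := hne 1 1
    simp only [Nat.cast_zero, zero_mul, add_zero, Nat.cast_one, div_one, one_mul] at e0 e1
    exact ⟨lt_of_le_of_ne h1 fun h => e0 (h ▸ h3), lt_of_le_of_ne h2 fun h => e1 (h ▸ h3)⟩
  -- Disjoint windows around the zeros make the chosen cells distinct.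
  obtain ⟨δ, hδ, hsep⟩ : ∃ δ > 0, ∀ z ∈ S, ∀ y ∈ S, z ≠ y → 2 * δ ≤ |z - y| := by
    have : ∀ z ∈ S, ∀ y ∈ S, ∀ᶠ δ in 𝓝[>] (0 : ℝ), z ≠ y → 2 * δ ≤ |z - y| := by
      intro z _ y _
      by_cases hzy : z = y
      · exact Eventually.of_forall fun δ h => absurd hzy h
      · have hpos : 0 < |z - y| / 2 := half_pos (abs_pos.2 (sub_ne_zero.2 hzy))
        filter_upwards [Ioo_mem_nhdsGT hpos] with δ hδ _
        linarith [hδ.2]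
    have h2 := (Filter.eventually_all_finset S).2 fun z hz =>
      (Filter.eventually_all_finset S).2 fun y hy => this z hz y hy
    obtain ⟨δ, h3, h4⟩ := (h2.and self_mem_nhdsWithin).exists
    exact ⟨δ, h4, fun z hz y hy => h3 z hz y hy⟩
  have hev := (Filter.eventually_all_finset S).2 fun z hz =>
    eventually_exists_signChange hF hc hne (p := max s (z - δ)) (q := min (s + L) (z + δ)) (z := z)
      (le_max_left _ _) (min_le_left _ _)
      ⟨max_lt (hends z hz).1 (by linarith), lt_min (hends z hz).2 (by linarith)⟩ (hS z hz).2
  filter_upwards [hev] with M hM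
  choose! k hk1 hk2 using hM
  refine Finset.card_le_card_of_injOn k (fun z hz => hk1 z hz) (fun z hz y hy hzy => ?_)
  by_contra hne'
  have h1 := hk2 z hz
  have h2 := hk2 y hy
  rw [hzy] at h1
  have a1 := (le_max_right s (z - δ)).trans_lt h1.1
  have a2 := h1.2.trans_le (min_le_right (s + L) (z + δ))
  have b1 := (le_max_right s (y - δ)).trans_lt h2.1
  have b2 := h2.2.trans_le (min_le_right (s + L) (y + δ))
  have := hsep z hz y hy hne'
  have : |z - y| < 2 * δ := abs_lt.2 ⟨by linarith, by linarith⟩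
  linarith

/-! ### The random power series in the hyperbolic coordinate is a `sech` process. -/

theorem tanh_strictMono_real : StrictMono Real.tanh := by
  intro x y hxy
  have hx : Real.tanh x ∈ Set.Ioo (-1 : ℝ) 1 := ⟨Real.neg_one_lt_tanh x, Real.tanh_lt_one x⟩
  have hy : Real.tanh y ∈ Set.Ioo (-1 : ℝ) 1 := ⟨Real.neg_one_lt_tanh y, Real.tanh_lt_one y⟩
  rw [← Real.artanh_lt_artanh_iff hx hy, Real.artanh_tanh, Real.artanh_tanh]
  exact hxy

theorem tanh_mem_Ioo (x : ℝ) : Real.tanh x ∈ Set.Ioo (-1 : ℝ) 1 :=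
  ⟨Real.neg_one_lt_tanh x, Real.tanh_lt_one x⟩

/-- Evaluates the covariance `sech x sech y ∑ (tanh x tanh y)^k` of the normalised series. -/
theorem sech_mul_sech_mul_inv (x y : ℝ) :
    sech x * sech y * (1 - Real.tanh x * Real.tanh y)⁻¹ = sech (x - y) := by
  have hx := (Real.cosh_pos x).ne'
  have hy := (Real.cosh_pos y).ne'
  have hxy := (Real.cosh_pos (x - y)).ne'
  have e : 1 - Real.tanh x * Real.tanh y
      = Real.cosh (x - y) / (Real.cosh x * Real.cosh y) := by
    rw [Real.cosh_sub, Real.tanh_eq_sinh_div_cosh, Real.tanh_eq_sinh_div_cosh]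
    field_simp
  rw [e, sech, sech, sech]
  field_simp

/-- A coefficient sequence whose power series converges absolutely on `(-1, 1)`. -/
def GoodCoeff (c : ℕ → ℝ) : Prop := ∀ ρ ∈ Set.Ico (0 : ℝ) 1, Summable fun k => |c k| * ρ ^ k

theorem GoodCoeff.summable {c : ℕ → ℝ} (hc : GoodCoeff c) {t : ℝ} (ht : t ∈ Set.Ioo (-1 : ℝ) 1) :
    Summable fun k => c k * t ^ k := by
  refine Summable.of_norm ?_
  simpa [abs_mul, abs_pow] using hc |t| ⟨abs_nonneg t, abs_lt.2 ht⟩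

theorem GoodCoeff.continuousOn {Ω : Type*} {a : ℕ → Ω → ℝ} {ω : Ω}
    (hc : GoodCoeff fun k => a k ω) : ContinuousOn (randomSeries a ω) (Set.Ioo (-1) 1) := by
  intro t ht
  obtain ⟨ρ, h1, h2⟩ := exists_between (abs_lt.2 ht)
  have hρ : 0 ≤ ρ := (abs_nonneg t).trans h1.le
  have hcont : ContinuousOn (fun x => ∑' k, a k ω * x ^ k) (Set.Icc (-ρ) ρ) := by
    refine continuousOn_tsum (fun k => by fun_prop) (hc ρ ⟨hρ, h2⟩) fun k x hx => ?_
    rw [Real.norm_eq_abs, abs_mul, abs_pow]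
    have := abs_le.2 hx
    gcongr
  have hnhds : Set.Icc (-ρ) ρ ∈ 𝓝 t := Icc_mem_nhds (abs_lt.1 h1).1 (abs_lt.1 h1).2
  exact (hcont.continuousAt hnhds).continuousWithinAt

/-- The normalised series in the hyperbolic coordinate. -/
noncomputable def hypSeries {Ω : Type*} (a : ℕ → Ω → ℝ) (u : ℝ) (ω : Ω) : ℝ :=
  sech u * randomSeries a ω (Real.tanh u)

section Gaussian

variable {Ω : Type*} [MeasurableSpace Ω] {P : Measure Ω} [IsProbabilityMeasure P]
  {a : ℕ → Ω → ℝ}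

-- The absolute series has finite expectation, a constant times a geometric series in `ρ`.
omit [IsProbabilityMeasure P] in
theorem ae_summable_of_hasLaw (hm : ∀ k, Measurable (a k))
    (hlaw : ∀ k, HasLaw (a k) (gaussianReal 0 1) P) {ρ : ℝ} (hρ : ρ ∈ Set.Ico (0 : ℝ) 1) :
    ∀ᵐ ω ∂P, Summable fun k => |a k ω| * ρ ^ k := by
  have hint : Integrable (fun x : ℝ => x) (gaussianReal 0 1) :=
    memLp_one_iff_integrable.1 (memLp_id_gaussianReal 1)
  have hnorm : ∀ k, ∫⁻ ω, ‖a k ω‖ₑ ∂P = ∫⁻ x, ‖x‖ₑ ∂(gaussianReal 0 1) := fun k => by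
    rw [← (hlaw k).map_eq, lintegral_map (by fun_prop) (hm k)]
  have hmeas : ∀ k, Measurable fun ω => ‖a k ω‖ₑ * ENNReal.ofReal ρ ^ k := fun k =>
    ((hm k).enorm).mul_const _
  have hfin : ∫⁻ ω, ∑' k, ‖a k ω‖ₑ * ENNReal.ofReal ρ ^ k ∂P ≠ ⊤ := by
    rw [lintegral_tsum fun k => (hmeas k).aemeasurable]
    simp_rw [fun k => lintegral_mul_const (μ := P) (ENNReal.ofReal ρ ^ k) (hm k).enorm, hnorm]
    rw [ENNReal.tsum_mul_left, ENNReal.tsum_geometric]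
    refine ENNReal.mul_ne_top hint.2.ne (ENNReal.inv_ne_top.2 ?_)
    exact (tsub_pos_of_lt (ENNReal.ofReal_lt_one.2 hρ.2)).ne'
  filter_upwards [ae_lt_top (Measurable.tsum hmeas) hfin] with ω hω
  have := ENNReal.summable_toReal hω.ne
  refine this.congr fun k => ?_
  rw [ENNReal.toReal_mul, ENNReal.toReal_pow, ENNReal.toReal_ofReal hρ.1, toReal_enorm,
    Real.norm_eq_abs]

omit [IsProbabilityMeasure P] in
theorem ae_goodCoeff (hm : ∀ k, Measurable (a k))
    (hlaw : ∀ k, HasLaw (a k) (gaussianReal 0 1) P) :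
    ∀ᵐ ω ∂P, GoodCoeff fun k => a k ω := by
  have h : ∀ n : ℕ, ∀ᵐ ω ∂P, Summable fun k => |a k ω| * (1 - 1 / ((n : ℝ) + 1)) ^ k := fun n => by
    have h0 : (0 : ℝ) < n + 1 := by positivity
    refine ae_summable_of_hasLaw hm hlaw ⟨?_, ?_⟩
    · rw [sub_nonneg, div_le_one h0]; linarith [(Nat.cast_nonneg n : (0 : ℝ) ≤ n)]
    · have : 0 < 1 / ((n : ℝ) + 1) := by positivity
      linarith
  filter_upwards [ae_all_iff.2 h] with ω hω ρ hρ
  obtain ⟨n, hn⟩ := exists_nat_one_div_lt (sub_pos.2 hρ.2)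
  refine Summable.of_nonneg_of_le (fun k => mul_nonneg (abs_nonneg _) (pow_nonneg hρ.1 k))
    (fun k => ?_) (hω n)
  have := hρ.1
  gcongr
  linarith

theorem measurable_tsum_mul_const {Ω : Type*} {m : MeasurableSpace Ω} {b : ℕ → Ω → ℝ}
    (hb : ∀ k, Measurable (b k)) (c : ℕ → ℝ) : Measurable fun ω => ∑' k, b k ω * c k :=
  Measurable.tsum fun k => (hb k).mul_const _

omit [IsProbabilityMeasure P] in
theorem measurable_randomSeries (hm : ∀ k, Measurable (a k)) (t : ℝ) :
    Measurable fun ω => randomSeries a ω t :=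
  Measurable.tsum fun k => (hm k).mul_const _

omit [IsProbabilityMeasure P] in
theorem integral_exp_sum_range (hm : ∀ k, Measurable (a k))
    (hlaw : ∀ k, HasLaw (a k) (gaussianReal 0 1) P) (hind : iIndepFun a P) (b : ℕ → ℝ) (K : ℕ) :
    ∫ ω, Complex.exp ((∑ k ∈ Finset.range K, a k ω * b k : ℝ) * Complex.I) ∂P
      = Complex.exp (-((∑ k ∈ Finset.range K, b k ^ 2) / 2 : ℝ)) := by
  have hm' : ∀ k, Measurable fun ω => a k ω * b k := fun k => (hm k).mul_const _
  have hi : iIndepFun (fun k ω => a k ω * b k) P :=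
    hind.comp (fun k x => x * b k) fun k => measurable_id.mul_const _
  have h1 := congrFun (iIndepFun.charFun_map_fun_finsetSum_eq_prod (s := Finset.range K)
    (X := fun k ω => a k ω * b k) (fun k _ => (hm' k).aemeasurable) (hi.restrict _)) 1
  have h2 : ∀ k, charFun (P.map fun ω => a k ω * b k) 1 = Complex.exp (-((b k) ^ 2 / 2 : ℝ)) := by
    intro k
    have e : (P.map fun ω => a k ω * b k) = (gaussianReal 0 1).map (b k * ·) := by
      rw [← (hlaw k).map_eq, Measure.map_map (measurable_const_mul _) (hm k)]
      congr 1; ext ω; simp [mul_comm]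
    rw [e, charFun_map_mul, charFun_gaussianReal]
    congr 1
    push_cast
    simp
  have hms : Measurable fun ω => ∑ k ∈ Finset.range K, a k ω * b k :=
    Finset.measurable_sum _ fun k _ => hm' k
  rw [Finset.prod_apply, Finset.prod_congr rfl fun k _ => h2 k, ← Complex.exp_sum,
    Finset.sum_neg_distrib, ← Complex.ofReal_sum, ← Finset.sum_div, charFun_apply_real,
    integral_map hms.aemeasurable (by fun_prop)] at h1
  rw [← h1]
  simp

/-- A linear combination of values is a single series `∑ aₖ bₖ`. The characteristic functions of its
partial sums are explicit, and both sides pass to the limit. -/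
theorem sechProcess_hypSeries (hm : ∀ k, Measurable (a k))
    (hlaw : ∀ k, HasLaw (a k) (gaussianReal 0 1) P) (hind : iIndepFun a P) :
    SechProcess P (hypSeries a) := by
  intro n u
  refine ⟨measurable_pi_lambda _ fun j => (measurable_randomSeries hm _).const_mul _, fun θ => ?_⟩
  set b : ℕ → ℝ := fun k => ∑ j, θ j * sech (u j) * Real.tanh (u j) ^ k with hb
  have hsum : ∀ᵐ ω ∂P, HasSum (fun k => a k ω * b k) (∑ j, θ j * hypSeries a (u j) ω) := by
    filter_upwards [ae_goodCoeff hm hlaw] with ω hω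
    have h1 : ∀ j ∈ Finset.univ, HasSum (fun k => θ j * sech (u j) * (a k ω * Real.tanh (u j) ^ k))
        (θ j * sech (u j) * randomSeries a ω (Real.tanh (u j))) := fun j _ =>
      ((hω.summable (tanh_mem_Ioo (u j))).hasSum).mul_left _
    have h2 := hasSum_sum h1
    convert h2 using 1
    · ext k
      rw [hb, Finset.mul_sum]
      exact Finset.sum_congr rfl fun j _ => by ring
    · exact Finset.sum_congr rfl fun j _ => by rw [hypSeries]; ring
  have hvar : HasSum (fun k => b k ^ 2) (∑ i, ∑ j, θ i * θ j * sech (u i - u j)) := by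
    have h1 : ∀ i ∈ Finset.univ, HasSum (fun k => ∑ j, θ i * θ j * (sech (u i) * sech (u j)) *
        (Real.tanh (u i) * Real.tanh (u j)) ^ k) (∑ j, θ i * θ j * sech (u i - u j)) := by
      intro i _
      refine hasSum_sum fun j _ => ?_
      have hlt : |Real.tanh (u i) * Real.tanh (u j)| < 1 := by
        rw [abs_mul]
        exact mul_lt_one_of_nonneg_of_lt_one_left (abs_nonneg _) (Real.abs_tanh_lt_one _)
          (Real.abs_tanh_lt_one _).le
      have := (hasSum_geometric_of_abs_lt_one hlt).mul_left (θ i * θ j * (sech (u i) * sech (u j)))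
      rwa [mul_assoc (θ i * θ j), sech_mul_sech_mul_inv] at this
    refine (hasSum_sum h1).congr_fun ?_
    intro k
    simp only [hb]
    rw [sq, Finset.sum_mul_sum]
    exact Finset.sum_congr rfl fun i _ => Finset.sum_congr rfl fun j _ => by ring
  have hms : ∀ K, Measurable fun ω => ∑ k ∈ Finset.range K, a k ω * b k := fun K =>
    Finset.measurable_sum _ fun k _ => (hm k).mul_const _
  have hexp : Continuous fun x : ℝ => Complex.exp ((x : ℂ) * Complex.I) := by fun_prop
  have lim1 := tendsto_integral_of_dominated_convergence (μ := P)
    (F := fun (K : ℕ) ω => Complex.exp ((∑ k ∈ Finset.range K, a k ω * b k : ℝ) * Complex.I))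
    (f := fun ω => Complex.exp ((∑ j, θ j * hypSeries a (u j) ω : ℝ) * Complex.I))
    (fun _ => 1) (fun K => (hexp.measurable.comp (hms K)).aestronglyMeasurable) (integrable_const _)
    (fun K => ae_of_all _ fun ω => by rw [Complex.norm_exp_ofReal_mul_I]) (by
      filter_upwards [hsum] with ω hω
      exact (hexp.tendsto _).comp hω.tendsto_sum_nat)
  have lim2 : Tendsto (fun K : ℕ => Complex.exp (-((∑ k ∈ Finset.range K, b k ^ 2) / 2 : ℝ))) atTop
      (𝓝 (Complex.exp (-((∑ i, ∑ j, θ i * θ j * sech (u i - u j)) / 2 : ℝ)))) := by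
    have hc : Continuous fun x : ℝ => Complex.exp (-(x / 2 : ℝ)) := by fun_prop
    exact (hc.tendsto _).comp hvar.tendsto_sum_nat
  simp_rw [integral_exp_sum_range hm hlaw hind b] at lim1
  exact tendsto_nhds_unique lim1 lim2

/-! ### Almost surely, both signs occur near every zero. -/

/-- The `σ`-algebra generated by all coefficients but the constant one. -/
abbrev tailSigma (a : ℕ → Ω → ℝ) : MeasurableSpace Ω :=
  ⨆ k ∈ ({0}ᶜ : Set ℕ), MeasurableSpace.comap (a k) inferInstance

/-- The coefficient `a 0` is independent of `Y` and has no atoms, so by Fubini the diagonal is null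
for their joint law. -/
theorem ae_coeff_zero_ne (hm : ∀ k, Measurable (a k))
    (hlaw : ∀ k, HasLaw (a k) (gaussianReal 0 1) P) (hind : iIndepFun a P) {Y : Ω → ℝ}
    (hY : Measurable[tailSigma a] Y) : ∀ᵐ ω ∂P, a 0 ω ≠ Y ω := by
  have hle : ∀ k, MeasurableSpace.comap (a k) inferInstance ≤ (inferInstance : MeasurableSpace Ω) :=
    fun k => (hm k).comap_le
  have hYm : Measurable Y := hY.mono (iSup₂_le fun k _ => hle k) le_rfl
  have hindep := indep_iSup_of_disjoint hle hind.iIndep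
    (disjoint_compl_right : Disjoint ({0} : Set ℕ) {0}ᶜ)
  have h0 : IndepFun (a 0) Y P := by
    rw [IndepFun_iff_Indep]
    refine indep_of_indep_of_le_left (indep_of_indep_of_le_right hindep hY.comap_le) ?_
    exact le_iSup₂_of_le (f := fun k (_ : k ∈ ({0} : Set ℕ)) =>
      MeasurableSpace.comap (a k) inferInstance) 0 rfl le_rfl
  have hprod := (indepFun_iff_map_prod_eq_prod_map_map (hm 0).aemeasurable hYm.aemeasurable).1 h0
  rw [(hlaw 0).map_eq] at hprod
  have hdiag : MeasurableSet {p : ℝ × ℝ | p.1 = p.2} :=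
    measurableSet_eq_fun measurable_fst measurable_snd
  have : P {ω | a 0 ω = Y ω} = 0 := by
    have e : P {ω | a 0 ω = Y ω} = P.map (fun ω => (a 0 ω, Y ω)) {p | p.1 = p.2} := by
      rw [Measure.map_apply ((hm 0).prodMk hYm) hdiag]; rfl
    have := nullSingletonClass_gaussianReal (μ := 0) (v := 1) one_ne_zero
    have := Measure.isProbabilityMeasure_map (μ := P) hYm.aemeasurable
    rw [e, hprod, Measure.prod_apply_symm hdiag]
    have e2 : ∀ y : ℝ, (fun x : ℝ => (x, y)) ⁻¹' {p : ℝ × ℝ | p.1 = p.2} = {y} := fun y => by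
      ext x; simp
    simp [e2]
  simpa [ae_iff] using this

/-- The series without its constant term. -/
noncomputable def tailSeries (a : ℕ → Ω → ℝ) (t : ℝ) (ω : Ω) : ℝ :=
  ∑' k : ℕ, a (k + 1) ω * t ^ (k + 1)

omit [MeasurableSpace Ω] in
theorem measurable_tailSeries (a : ℕ → Ω → ℝ) (t : ℝ) :
    Measurable[tailSigma a] (tailSeries a t) := by
  have h : ∀ k, Measurable[tailSigma a] (a (k + 1)) := fun k =>
    (comap_measurable (a (k + 1))).mono
      (le_iSup₂_of_le (f := fun k (_ : k ∈ ({0}ᶜ : Set ℕ)) =>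
        MeasurableSpace.comap (a k) inferInstance) (k + 1) (Nat.succ_ne_zero k) le_rfl) le_rfl
  exact measurable_tsum_mul_const h fun k => t ^ (k + 1)

omit [MeasurableSpace Ω] in
theorem randomSeries_eq_add_tailSeries {ω : Ω} (hc : GoodCoeff fun k => a k ω) {t : ℝ}
    (ht : t ∈ Set.Ioo (-1 : ℝ) 1) : randomSeries a ω t = a 0 ω + tailSeries a t ω := by
  rw [randomSeries, (hc.summable ht).tsum_eq_zero_add, tailSeries]
  simp

end Gaussian

/-- If `c + g` is nonnegative with a zero, then `-c` is the infimum of `g` over the rationals. -/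
theorem eq_neg_iInf_of_nonneg {f g : ℝ → ℝ} {c : ℝ} {p q : ℝ} (hf : ContinuousOn f (Set.Ioo p q))
    (hfg : ∀ x ∈ Set.Ioo p q, f x = c + g x) (hpos : ∀ x ∈ Set.Ioo p q, 0 ≤ f x) {z : ℝ}
    (hz : z ∈ Set.Ioo p q) (hz0 : f z = 0) :
    c = -⨅ x : {x : ℚ // (x : ℝ) ∈ Set.Ioo p q}, g (x : ℚ) := by
  obtain ⟨x₀, h1, h2⟩ := exists_rat_btwn (hz.1.trans hz.2)
  have : Nonempty {x : ℚ // (x : ℝ) ∈ Set.Ioo p q} := ⟨⟨x₀, h1, h2⟩⟩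
  have hlow : ∀ x : {x : ℚ // (x : ℝ) ∈ Set.Ioo p q}, -c ≤ g (x : ℚ) := fun x => by
    have := hpos _ x.2
    rw [hfg _ x.2] at this
    linarith
  have hle : -c ≤ ⨅ x : {x : ℚ // (x : ℝ) ∈ Set.Ioo p q}, g (x : ℚ) := le_ciInf hlow
  -- By continuity, rational points near the zero come arbitrarily close to the minimum. Rational
  -- points keep the infimum countable, hence measurable in the tail coefficients.
  have hge : ⨅ x : {x : ℚ // (x : ℝ) ∈ Set.Ioo p q}, g (x : ℚ) ≤ -c := by
    refine le_of_forall_pos_lt_add fun ε hε => ?_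
    have hca : ContinuousAt f z := hf.continuousAt (isOpen_Ioo.mem_nhds hz)
    have hev : ∀ᶠ x in 𝓝 z, f x < ε ∧ x ∈ Set.Ioo p q :=
      (hca.eventually (gt_mem_nhds (by rwa [hz0]))).and
        (show ∀ᶠ x in 𝓝 z, x ∈ Set.Ioo p q from isOpen_Ioo.mem_nhds hz)
    obtain ⟨x, hx1, hx2⟩ := Rat.denseRange_cast.exists_mem_open (isOpen_interior)
      ⟨z, mem_interior_iff_mem_nhds.2 hev⟩ |>.imp fun x hx => interior_subset hx
    refine (ciInf_le ⟨-c, by rintro _ ⟨y, rfl⟩; exact hlow y⟩ ⟨x, hx2⟩).trans_lt ?_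
    have := hfg _ hx2
    simp only
    linarith
  linarith

theorem eq_neg_iSup_of_nonpos {f g : ℝ → ℝ} {c : ℝ} {p q : ℝ} (hf : ContinuousOn f (Set.Ioo p q))
    (hfg : ∀ x ∈ Set.Ioo p q, f x = c + g x) (hneg : ∀ x ∈ Set.Ioo p q, f x ≤ 0) {z : ℝ}
    (hz : z ∈ Set.Ioo p q) (hz0 : f z = 0) :
    c = ⨅ x : {x : ℚ // (x : ℝ) ∈ Set.Ioo p q}, -g (x : ℚ) := by
  have := eq_neg_iInf_of_nonneg (f := fun x => -f x) (g := fun x => -g x) (c := -c) hf.neg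
    (fun x hx => by rw [hfg x hx]; ring) (fun x hx => neg_nonneg.2 (hneg x hx)) hz (by simp [hz0])
  linarith

section Crossing

variable {Ω : Type*} [MeasurableSpace Ω] {P : Measure Ω} [IsProbabilityMeasure P]
  {a : ℕ → Ω → ℝ}

omit [MeasurableSpace Ω] in
theorem continuous_hypSeries {ω : Ω} (hc : GoodCoeff fun k => a k ω) :
    Continuous fun u => hypSeries a u ω := by
  refine continuous_sech.mul ?_
  exact hc.continuousOn.comp_continuous contDiff_tanh_one.continuous tanh_mem_Ioo

/-- If the series had a zero in an interval without taking both signs, `a 0` would equal a quantity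
measurable in the other coefficients. Rational intervals suffice, so only countably many null events
are excluded. -/
theorem ae_crossesAtZeros (hm : ∀ k, Measurable (a k))
    (hlaw : ∀ k, HasLaw (a k) (gaussianReal 0 1) P) (hind : iIndepFun a P) :
    ∀ᵐ ω ∂P, CrossesAtZeros fun u => hypSeries a u ω := by
  have h1 : ∀ p q : ℚ, ∀ᵐ ω ∂P, a 0 ω ≠
      -⨅ x : {x : ℚ // (x : ℝ) ∈ Set.Ioo (p : ℝ) q}, tailSeries a (x : ℚ) ω := fun p q =>
    ae_coeff_zero_ne hm hlaw hind
      (Measurable.neg (Measurable.iInf fun x => measurable_tailSeries a _))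
  have h2 : ∀ p q : ℚ, ∀ᵐ ω ∂P, a 0 ω ≠
      ⨅ x : {x : ℚ // (x : ℝ) ∈ Set.Ioo (p : ℝ) q}, -tailSeries a (x : ℚ) ω := fun p q =>
    ae_coeff_zero_ne hm hlaw hind
      (Measurable.iInf fun x => Measurable.neg (measurable_tailSeries a _))
  filter_upwards [ae_goodCoeff hm hlaw, ae_all_iff.2 fun p => ae_all_iff.2 (h1 p),
    ae_all_iff.2 fun p => ae_all_iff.2 (h2 p)] with ω hω g1 g2 p q hzero
  obtain ⟨z, hz, hz0⟩ := hzero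
  have hfz : randomSeries a ω (Real.tanh z) = 0 :=
    (mul_eq_zero.1 hz0).resolve_left (sech_pos z).ne'
  obtain ⟨p', hp1, hp2⟩ := exists_rat_btwn (tanh_strictMono_real hz.1)
  obtain ⟨q', hq1, hq2⟩ := exists_rat_btwn (tanh_strictMono_real hz.2)
  have hsub : Set.Ioo (p' : ℝ) q' ⊆ Set.Ioo (-1 : ℝ) 1 := fun x hx =>
    ⟨(Real.neg_one_lt_tanh p).trans (hp1.trans hx.1), hx.2.trans (hq2.trans (Real.tanh_lt_one q))⟩
  have hcont := hω.continuousOn.mono hsub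
  have hfg : ∀ x ∈ Set.Ioo (p' : ℝ) q', randomSeries a ω x = a 0 ω + tailSeries a x ω :=
    fun x hx => randomSeries_eq_add_tailSeries hω (hsub hx)
  have hlift : ∀ x ∈ Set.Ioo (p' : ℝ) q', Real.artanh x ∈ Set.Ioo p q ∧
      hypSeries a (Real.artanh x) ω = sech (Real.artanh x) * randomSeries a ω x := by
    intro x hx
    have hx1 := hsub hx
    have ht := Real.tanh_artanh hx1
    refine ⟨⟨?_, ?_⟩, by rw [hypSeries, ht]⟩
    · rw [← tanh_strictMono_real.lt_iff_lt, ht]; exact hp1.trans hx.1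
    · rw [← tanh_strictMono_real.lt_iff_lt, ht]; exact hx.2.trans hq2
  constructor
  · by_contra! hcon
    refine g2 p' q' (eq_neg_iSup_of_nonpos hcont hfg (fun x hx => ?_) ⟨hp2, hq1⟩ hfz)
    obtain ⟨hI, he⟩ := hlift x hx
    have := hcon _ hI
    rw [he] at this
    exact nonpos_of_mul_nonpos_right this (sech_pos _)
  · by_contra! hcon
    refine g1 p' q' (eq_neg_iInf_of_nonneg hcont hfg (fun x hx => ?_) ⟨hp2, hq1⟩ hfz)
    obtain ⟨hI, he⟩ := hlift x hx
    have := hcon _ hI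
    rw [he] at this
    exact nonneg_of_mul_nonneg_right this (sech_pos _)

end Crossing

/-! ### From grid counts to the moments of the number of zeros. -/

section Limit

variable {Ω : Type*} [MeasurableSpace Ω] {P : Measure Ω} [IsProbabilityMeasure P]

omit [IsProbabilityMeasure P] in
/-- Fatou's lemma for sequences that eventually dominate a given function. -/
theorem lintegral_le_of_eventually_le {C : ℕ → Ω → ℝ} {g : Ω → ENNReal} {B : ℝ}
    (hm : ∀ n, Measurable (C n)) (hC : ∀ n ω, 0 ≤ C n ω) (hint : ∀ n, Integrable (C n) P)
    (hlim : Tendsto (fun n => ∫ ω, C n ω ∂P) atTop (𝓝 B))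
    (hg : ∀ᵐ ω ∂P, g ω ≤ liminf (fun n => ENNReal.ofReal (C n ω)) atTop) :
    ∫⁻ ω, g ω ∂P ≤ ENNReal.ofReal B := by
  calc ∫⁻ ω, g ω ∂P ≤ ∫⁻ ω, liminf (fun n => ENNReal.ofReal (C n ω)) atTop ∂P :=
        lintegral_mono_ae hg
    _ ≤ liminf (fun n => ∫⁻ ω, ENNReal.ofReal (C n ω) ∂P) atTop :=
        lintegral_liminf_le fun n => (hm n).ennreal_ofReal
    _ = ENNReal.ofReal B := by
        have e : ∀ n, ∫⁻ ω, ENNReal.ofReal (C n ω) ∂P = ENNReal.ofReal (∫ ω, C n ω ∂P) := fun n =>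
          (ofReal_integral_eq_lintegral_ofReal (hint n) (ae_of_all _ (hC n))).symm
        simp_rw [e]
        exact (ENNReal.tendsto_ofReal hlim).liminf_eq

/-- The zero set in a compact interval. -/
def zeroSet (X : ℝ → Ω → ℝ) (s L : ℝ) (ω : Ω) : Set ℝ :=
  {u | u ∈ Set.Icc s (s + L) ∧ X u ω = 0}

namespace SechProcess

variable {X : ℝ → Ω → ℝ}

theorem ae_grid_ne_zero (hX : SechProcess P X) (s L : ℝ) :
    ∀ᵐ ω ∂P, ∀ M k : ℕ, X (s + k * (L / M)) ω ≠ 0 :=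
  ae_all_iff.2 fun _ => ae_all_iff.2 fun _ => hX.ae_ne_zero _

omit [MeasurableSpace Ω] in
theorem gridCount_nonneg (s h : ℝ) (M : ℕ) (ω : Ω) : 0 ≤ gridCount X s h M ω :=
  Finset.sum_nonneg fun k _ => by
    have := (abs_le.1 (abs_signProd_le (X := X) s h k ω)).2
    linarith

theorem integrable_gridCount (hX : SechProcess P X) (s h : ℝ) (M : ℕ) :
    Integrable (gridCount X s h M) P :=
  integrable_finsetSum _ fun k _ =>
    ((integrable_const _).sub (hX.integrable_signProd s h k)).div_const 2

theorem integrable_gridCount_sq (hX : SechProcess P X) (s h : ℝ) (M : ℕ) :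
    Integrable (fun ω => gridCount X s h M ω ^ 2) P := by
  refine Integrable.of_bound ((hX.measurable_gridCount s h M).pow_const 2).aestronglyMeasurable
    ((M : ℝ) ^ 2) (ae_of_all _ fun ω => ?_)
  have h0 := gridCount_nonneg (X := X) s h M ω
  have h1 : gridCount X s h M ω ≤ M := by
    rw [gridCount_eq]
    have := (Finset.abs_sum_le_sum_abs (fun k => signProd X s h k ω) (Finset.range M)).trans
      (Finset.sum_le_sum fun k _ => abs_signProd_le s h k ω)
    simp only [Finset.sum_const, Finset.card_range, nsmul_eq_mul, mul_one] at this
    have := (abs_le.1 this).1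
    linarith
  rw [Real.norm_eq_abs, abs_of_nonneg (by positivity)]
  gcongr

variable {s L : ℝ}

theorem ae_eventually_card_le (hX : SechProcess P X) (hc : ∀ᵐ ω ∂P, Continuous fun u => X u ω)
    (hcross : ∀ᵐ ω ∂P, CrossesAtZeros fun u => X u ω) (s L : ℝ) :
    ∀ᵐ ω ∂P, ∀ S : Finset ℝ, (S : Set ℝ) ⊆ zeroSet X s L ω →
      ∀ᶠ M : ℕ in atTop, (S.card : ℝ) ≤ gridCount X s (L / M) M ω := by
  filter_upwards [hc, hcross, hX.ae_grid_ne_zero s L] with ω h1 h2 h3 S hS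
  filter_upwards [eventually_card_le_signChanges h1 h2 h3 S fun z hz => hS hz] with M hM
  rw [gridCount_eq_card fun k _ => h3 M k]
  exact_mod_cast hM

/-- By Fatou the lower limit of the grid counts has finite expectation, hence is almost surely
finite; infinitely many zeros would make it infinite. Using this lower limit avoids any
measurability question about the zero set. -/
theorem ae_finite_zeroSet (hX : SechProcess P X) (hc : ∀ᵐ ω ∂P, Continuous fun u => X u ω)
    (hcross : ∀ᵐ ω ∂P, CrossesAtZeros fun u => X u ω) (hL : 0 < L) :
    ∀ᵐ ω ∂P, (zeroSet X s L ω).Finite := by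
  set G : Ω → ENNReal := fun ω =>
    liminf (fun M : ℕ => ENNReal.ofReal (gridCount X s (L / M) M ω)) atTop with hG
  have hGm : Measurable G := Measurable.liminf fun M =>
    (hX.measurable_gridCount s (L / M) M).ennreal_ofReal
  have hGi := lintegral_le_of_eventually_le (P := P) (g := G)
    (fun M => hX.measurable_gridCount s (L / M) M) (fun M ω => gridCount_nonneg s (L / M) M ω)
    (fun M => hX.integrable_gridCount s (L / M) M) (hX.tendsto_integral_gridCount s hL)
    (ae_of_all _ fun ω => le_rfl)
  filter_upwards [ae_lt_top hGm (hGi.trans_lt ENNReal.ofReal_lt_top).ne,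
    hX.ae_eventually_card_le hc hcross s L] with ω hω hcard
  by_contra hinf
  refine hω.ne (ENNReal.eq_top_of_forall_nnreal_le fun r => ?_)
  obtain ⟨S, hS, hSc⟩ := Set.Infinite.exists_subset_card_eq hinf ⌈r⌉₊
  refine le_liminf_of_le (by isBoundedDefault) ?_
  filter_upwards [hcard S hS] with M hM
  rw [← ENNReal.ofReal_coe_nnreal]
  refine ENNReal.ofReal_le_ofReal (le_trans ?_ hM)
  rw [hSc]
  exact_mod_cast Nat.le_ceil r

theorem ae_gridCount_le_and_tendsto (hX : SechProcess P X)
    (hc : ∀ᵐ ω ∂P, Continuous fun u => X u ω)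
    (hcross : ∀ᵐ ω ∂P, CrossesAtZeros fun u => X u ω) (hL : 0 < L) :
    ∀ᵐ ω ∂P, (∀ M : ℕ, gridCount X s (L / M) M ω ≤ (zeroSet X s L ω).ncard) ∧
      Tendsto (fun M : ℕ => gridCount X s (L / M) M ω) atTop (𝓝 (zeroSet X s L ω).ncard) := by
  filter_upwards [hc, hX.ae_grid_ne_zero s L, hX.ae_eventually_card_le hc hcross s L,
    hX.ae_finite_zeroSet (s := s) hc hcross hL] with ω h1 h3 hcard hfin
  have hle : ∀ M : ℕ, gridCount X s (L / M) M ω ≤ (zeroSet X s L ω).ncard := fun M => by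
    rw [gridCount_eq_card fun k _ => h3 M k]
    exact_mod_cast card_signChanges_le h1 hL hfin
  refine ⟨hle, tendsto_const_nhds.congr' ?_⟩
  filter_upwards [hcard hfin.toFinset (by simp)] with M hM
  refine le_antisymm ?_ (hle M)
  rwa [← Set.ncard_eq_toFinset_card _ hfin] at hM

/-- The moments of the number of zeros in an interval of length `L`. -/
theorem zero_count_moments (hX : SechProcess P X) (hc : ∀ᵐ ω ∂P, Continuous fun u => X u ω)
    (hcross : ∀ᵐ ω ∂P, CrossesAtZeros fun u => X u ω) (hL : 0 < L) :
    MemLp (fun ω => ((zeroSet X s L ω).ncard : ℝ)) 2 P ∧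
      ∫ ω, ((zeroSet X s L ω).ncard : ℝ) ∂P = L / Real.pi ∧
      variance (fun ω => ((zeroSet X s L ω).ncard : ℝ)) P = limitVar L := by
  set N : Ω → ℝ := fun ω => ((zeroSet X s L ω).ncard : ℝ) with hN
  have hN0 : ∀ ω, 0 ≤ N ω := fun ω => Nat.cast_nonneg _
  have hae := hX.ae_gridCount_le_and_tendsto (s := s) hc hcross hL
  have hNm : AEMeasurable N P := aemeasurable_of_tendsto_metrizable_ae atTop
    (fun M : ℕ => (hX.measurable_gridCount s (L / M) M).aemeasurable) (hae.mono fun ω h => h.2)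
  -- Square integrability of `N` must come first, from Fatou, because `N` and `N²` are the
  -- dominating functions below.
  have hfat := lintegral_le_of_eventually_le (P := P) (g := fun ω => ENNReal.ofReal (N ω ^ 2))
    (C := fun M ω => gridCount X s (L / M) M ω ^ 2)
    (fun M => (hX.measurable_gridCount s (L / M) M).pow_const 2) (fun M ω => sq_nonneg _)
    (fun M => hX.integrable_gridCount_sq s (L / M) M) (hX.tendsto_integral_gridCount_sq s hL)
    (hae.mono fun ω h => (ENNReal.tendsto_ofReal (h.2.pow 2)).liminf_eq.ge)
  have hNsq : Integrable (fun ω => N ω ^ 2) P := by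
    refine ⟨(hNm.pow_const 2).aestronglyMeasurable, ?_⟩
    rw [hasFiniteIntegral_iff_ofReal (ae_of_all _ fun ω => sq_nonneg _)]
    exact hfat.trans_lt ENNReal.ofReal_lt_top
  have hmem : MemLp N 2 P := (memLp_two_iff_integrable_sq hNm.aestronglyMeasurable).2 hNsq
  have hNi : Integrable N P := hmem.integrable one_le_two
  have hmean : ∫ ω, N ω ∂P = L / Real.pi := by
    refine tendsto_nhds_unique ?_ (hX.tendsto_integral_gridCount s hL)
    refine tendsto_integral_of_dominated_convergence N
      (fun M => (hX.measurable_gridCount s (L / M) M).aestronglyMeasurable) hNi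
      (fun M => hae.mono fun ω h => ?_) (hae.mono fun ω h => h.2)
    rw [Real.norm_eq_abs, abs_of_nonneg (gridCount_nonneg _ _ _ _)]
    exact h.1 M
  have hsecond : ∫ ω, N ω ^ 2 ∂P = (L / Real.pi) ^ 2 + limitVar L := by
    refine tendsto_nhds_unique ?_ (hX.tendsto_integral_gridCount_sq s hL)
    refine tendsto_integral_of_dominated_convergence (fun ω => N ω ^ 2)
      (fun M => ((hX.measurable_gridCount s (L / M) M).pow_const 2).aestronglyMeasurable) hNsq
      (fun M => hae.mono fun ω h => ?_) (hae.mono fun ω h => h.2.pow 2)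
    have h0 := gridCount_nonneg (X := X) s (L / M) M ω
    rw [Real.norm_eq_abs, abs_of_nonneg (sq_nonneg _)]
    exact pow_le_pow_left₀ h0 (h.1 M) 2
  refine ⟨hmem, hmean, ?_⟩
  rw [variance_eq_sub hmem, hmean]
  simp only [Pi.pow_apply]
  rw [hsecond]
  ring

end SechProcess

end Limit

/-! ### Return to the zeros of the power series in `[-r, r]`. -/

section RealZeros

variable {Ω : Type*} [MeasurableSpace Ω] {P : Measure Ω} {a : ℕ → Ω → ℝ} {r : ℝ}

omit [MeasurableSpace Ω] in
/-- In the coordinate `t = tanh u`, the zeros in `[-r, r]` become the zeros of `hypSeries a` in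
`[-artanh r, artanh r]`. -/
theorem realZeros_eq_image (hr : r ∈ Set.Ioo (0 : ℝ) 1) (ω : Ω) :
    realZeros a r ω =
      Real.tanh '' zeroSet (hypSeries a) (-Real.artanh r) (2 * Real.artanh r) ω := by
  have hr' : Real.tanh (Real.artanh r) = r := Real.tanh_artanh ⟨by linarith [hr.1], hr.2⟩
  ext t
  simp only [realZeros, zeroSet, Set.mem_image, Set.mem_ofPred_eq, hypSeries, Set.mem_Icc]
  constructor
  · rintro ⟨⟨h1, h2⟩, h0⟩
    have ht : Real.tanh (Real.artanh t) = t :=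
      Real.tanh_artanh ⟨by linarith [hr.2], by linarith [hr.2]⟩
    refine ⟨Real.artanh t, ⟨⟨?_, ?_⟩, by rw [ht, h0, mul_zero]⟩, ht⟩
    · rw [← tanh_strictMono_real.le_iff_le, Real.tanh_neg, hr', ht]; exact h1
    · rw [← tanh_strictMono_real.le_iff_le, ht,
        show -Real.artanh r + 2 * Real.artanh r = Real.artanh r by ring, hr']
      exact h2
  · rintro ⟨u, ⟨⟨h1, h2⟩, h0⟩, rfl⟩
    refine ⟨⟨?_, ?_⟩, (mul_eq_zero.1 h0).resolve_left (sech_pos u).ne'⟩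
    · have := tanh_strictMono_real.monotone h1
      rwa [Real.tanh_neg, hr'] at this
    · have := tanh_strictMono_real.monotone (show u ≤ Real.artanh r by linarith)
      rwa [hr'] at this

theorem two_mul_artanh (hr : r ∈ Set.Ioo (0 : ℝ) 1) :
    2 * Real.artanh r = Real.log ((1 + r) / (1 - r)) := by
  rw [Real.artanh_eq_half_log ⟨by linarith [hr.1], hr.2.le⟩]
  ring

/-- The moments of the number of zeros in `[-r, r]`, for measurable coefficients. -/
theorem realZeroCount_moments_of_measurable [IsProbabilityMeasure P]
    (hm : ∀ k, Measurable (a k)) (hlaw : ∀ k, HasLaw (a k) (gaussianReal 0 1) P)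
    (hind : iIndepFun a P) (hr : r ∈ Set.Ioo (0 : ℝ) 1) :
    (∀ᵐ ω ∂P, (realZeros a r ω).Finite) ∧ MemLp (realZeroCount a r) 2 P ∧
      ∫ ω, realZeroCount a r ω ∂P = 1 / Real.pi * Real.log ((1 + r) / (1 - r)) ∧
      variance (realZeroCount a r) P
        = SechProcess.limitVar (Real.log ((1 + r) / (1 - r))) := by
  have hX := sechProcess_hypSeries hm hlaw hind
  have hc : ∀ᵐ ω ∂P, Continuous fun u => hypSeries a u ω :=
    (ae_goodCoeff hm hlaw).mono fun ω h => continuous_hypSeries h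
  have hcross := ae_crossesAtZeros hm hlaw hind
  have hL : 0 < 2 * Real.artanh r := by linarith [Real.artanh_pos hr]
  have hN : realZeroCount a r = fun ω =>
      ((zeroSet (hypSeries a) (-Real.artanh r) (2 * Real.artanh r) ω).ncard : ℝ) := by
    ext ω
    rw [realZeroCount, realZeros_eq_image hr,
      Set.ncard_image_of_injective _ Real.tanh_injective]
  obtain ⟨h1, h2, h3⟩ := hX.zero_count_moments (s := -Real.artanh r) hc hcross hL
  rw [hN, ← two_mul_artanh hr]
  refine ⟨?_, h1, by rw [h2]; ring, h3⟩
  filter_upwards [hX.ae_finite_zeroSet (s := -Real.artanh r) hc hcross hL] with ω hω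
  rw [realZeros_eq_image hr]
  exact hω.image _

/-- Gaussian coefficients may be replaced by measurable ones, up to a null set. -/
theorem exists_measurable_coeff (hlaw : ∀ k, HasLaw (a k) (gaussianReal 0 1) P)
    (hind : iIndepFun a P) :
    ∃ b : ℕ → Ω → ℝ, (∀ k, Measurable (b k)) ∧ (∀ k, HasLaw (b k) (gaussianReal 0 1) P) ∧
      iIndepFun b P ∧ ∀ᵐ ω ∂P, ∀ k, a k ω = b k ω := by
  have h : ∀ k, a k =ᵐ[P] (hlaw k).aemeasurable.mk (a k) :=
    fun k => (hlaw k).aemeasurable.ae_eq_mk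
  exact ⟨fun k => (hlaw k).aemeasurable.mk (a k), fun k => (hlaw k).aemeasurable.measurable_mk,
    fun k => (hlaw k).congr (h k).symm, hind.congr h, ae_all_iff.2 h⟩

omit [MeasurableSpace Ω] in
theorem realZeros_congr {b : ℕ → Ω → ℝ} {ω : Ω} (h : ∀ k, a k ω = b k ω) :
    realZeros a r ω = realZeros b r ω := by
  simp only [realZeros, randomSeries, h]

/-- The moments of the number of zeros in `[-r, r]`. -/
theorem realZeroCount_moments [IsProbabilityMeasure P]
    (hlaw : ∀ k, HasLaw (a k) (gaussianReal 0 1) P)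
    (hind : iIndepFun a P) (hr : r ∈ Set.Ioo (0 : ℝ) 1) :
    (∀ᵐ ω ∂P, (realZeros a r ω).Finite) ∧ MemLp (realZeroCount a r) 2 P ∧
      ∫ ω, realZeroCount a r ω ∂P = 1 / Real.pi * Real.log ((1 + r) / (1 - r)) ∧
      variance (realZeroCount a r) P
        = SechProcess.limitVar (Real.log ((1 + r) / (1 - r))) := by
  obtain ⟨b, hbm, hbl, hbi, hab⟩ := exists_measurable_coeff hlaw hind
  have hN : realZeroCount b r =ᵐ[P] realZeroCount a r := by
    filter_upwards [hab] with ω hω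
    rw [realZeroCount, realZeroCount, realZeros_congr hω]
  obtain ⟨h1, h2, h3, h4⟩ := realZeroCount_moments_of_measurable hbm hbl hbi hr
  refine ⟨?_, h2.ae_eq hN, by rw [← h3, integral_congr_ae hN], by rw [← h4, variance_congr hN]⟩
  filter_upwards [hab, h1] with ω hω h
  rwa [realZeros_congr hω]

end RealZeros

theorem mainTheorem6 {Ω : Type*} [MeasurableSpace Ω] (P : Measure Ω) [IsProbabilityMeasure P]
    (a : ℕ → Ω → ℝ) (ha_law : ∀ k, HasLaw (a k) (gaussianReal 0 1) P)
    (ha_indep : iIndepFun a P) :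
    -- the series converges on `(-1, 1)` almost surely
    (∀ᵐ ω ∂P, ∀ t ∈ Set.Ioo (-1 : ℝ) 1, Summable fun k : ℕ => a k ω * t ^ k) ∧
    -- `N_r` is almost surely finite, square integrable, and its mean is given exactly
    (∀ r ∈ Set.Ioo (0 : ℝ) 1,
      (∀ᵐ ω ∂P, (realZeros a r ω).Finite) ∧
      MemLp (realZeroCount a r) 2 P ∧
      ∫ ω, realZeroCount a r ω ∂P = 1 / Real.pi * Real.log ((1 + r) / (1 - r))) ∧
    -- the variance, as `r → 1` from below
    (fun r : ℝ => variance (realZeroCount a r) P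
        - 2 * (1 - 2 / Real.pi) * ∫ ω, realZeroCount a r ω ∂P)
      =O[𝓝[<] 1] (fun _ : ℝ => (1 : ℝ)) := by
  refine ⟨?_, fun r hr => ?_, ?_⟩
  · obtain ⟨b, hbm, hbl, -, hab⟩ := exists_measurable_coeff ha_law ha_indep
    filter_upwards [hab, ae_goodCoeff hbm hbl] with ω hω hg t ht
    simpa only [hω] using hg.summable ht
  · obtain ⟨h1, h2, h3, -⟩ := realZeroCount_moments ha_law ha_indep hr
    exact ⟨h1, h2, h3⟩
  · refine IsBigO.of_bound 4 ?_
    filter_upwards [Ioo_mem_nhdsLT (zero_lt_one' ℝ)] with r hr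
    obtain ⟨-, -, h3, h4⟩ := realZeroCount_moments ha_law ha_indep hr
    have hL : 0 ≤ Real.log ((1 + r) / (1 - r)) := by
      rw [← two_mul_artanh hr]
      linarith [Real.artanh_pos hr]
    rw [h3, h4, Real.norm_eq_abs, norm_one, mul_one, one_div_mul_eq_div]
    exact SechProcess.abs_limitVar_sub_le hL
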